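/- **The algebra and the Verma modules.** Let $\mathcal T$ be the topological $N=2$ superconformal algebra: the complex Lie superalgebra with even basis elements $\mathcal L_m,\mathcal H_m$ $(m\in\mathbb Z)$ and $C$, odd basis elements $\mathcal G_m,\mathcal Q_m$ $(m\in\mathbb Z)$, $C$ central, and $$[\mathcal L_m,\mathcal L_n]=(m-n)\mathcal L_{m+n},\quad [\mathcal H_m,\mathcal H_n]=\tfrac C3 m\,\delta_{m+n,0},\quad [\mathcal L_m,\mathcal G_n]=(m-n)\mathcal G_{m+n},\quad [\mathcal H_m,\mathcal G_n]=\mathcal G_{m+n},$$ $$[\mathcal L_m,\mathcal Q_n]=-n\mathcal Q_{m+n},\quad [\mathcal H_m,\mathcal Q_n]=-\mathcal Q_{m+n},\quad [\mathcal L_m,\mathcal H_n]=-n\mathcal H_{m+n}+\tfrac C6(m^2+m)\delta_{m+n,0},$$ $$\{\mathcal G_m,\mathcal Q_n\}=2\mathcal L_{m+n}-2n\mathcal H_{m+n}+\tfrac C3(m^2+m)\delta_{m+n,0},\quad \{\mathcal G_m,\mathcal G_n\}=\{\mathcal Q_m,\mathcal Q_n\}=0 .$$ For $q,c\in\mathbb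 C$ the no-label Verma module $\mathcal V_{0,q}$ with central charge $c$ is the $U(\mathcal T)$-module generated by a vector $|0,q\rangle$ subject only to $\mathcal L_0|0,q\rangle=0$, $\mathcal H_0|0,q\rangle=q|0,q\rangle$, $C|0,q\rangle=c|0,q\rangle$ and $\mathcal L_j|0,q\rangle=\mathcal H_j|0,q\rangle=\mathcal G_j|0,q\rangle=\mathcal Q_j|0,q\rangle=0$ for $j\ge1$. Let $U(\mathcal T)^+$ be the span of all $Y\in U(\mathcal T)$ with $[\mathcal L_0,Y]=lY$ for some integer $l<0$. **Terms.** For $m\in\mathbb N_0$, $n\in\mathbb Z$ let $\mathcal C_{m,n}$ be the set of all terms $$X=L\,H\,G\,Q\;\mathcal L_{-1}^{k}\,\mathcal G_{-1}^{r_1}\,\mathcal Q_{-1}^{r_2}\,\mathcal G_0^{r_4}\,\mathcal Q_0^{r_3},\qquad k\in\mathbb N_0,\ r_i\in\{0,1\},$$ where $L=\mathcal L_{-l_s}\cdots\mathcal L_{-l_1}$ with $l_s\ge\dots\ge l_1\ge2$, $H=\mathcal H_{-h_t}\cdots\mathcal H_{-h_1}$ with $h_t\ge\dots\ge h_1\ge1$,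 $G=\mathcal G_{-g_u}\cdots\mathcal G_{-g_1}$ with $g_u>\dots>g_1\ge2$, $Q=\mathcal Q_{-p_v}\cdots\mathcal Q_{-p_1}$ with $p_v>\dots>p_1\ge2$ (each product may be empty, i.e. equal to $1$), of level $\sum l_i+\sum h_i+\sum g_i+\sum p_i+k+r_1+r_2=m$ and charge $u-v+r_1-r_2+r_4-r_3=n$. **The ordering $\prec_{GQ}$.** For two different products $Z=\mathcal Z_{-z_s}\cdots \mathcal Z_{-z_1}$ and $Z'=\mathcal Z_{-z'_{s'}}\cdots \mathcal Z_{-z'_1}$ of the same type put $Z\prec Z'$ if $z_j<z'_j$ at the smallest index $j\le\min(s,s')$ with $z_j\ne z'_j$, or if there is no such index and $s>s'$. For two different terms in $\mathcal C_{m,n}$ put $X\prec_{GQ}X'$ according to the first of the following comparisons that is not a tie: $k>k'$; $r_1+r_2>r_1'+r_2'$; $Q\prec Q'$; $G\prec G'$; $L\prec L'$; $H\prec H'$; $r_1>r_1'$; $r_3+r_4>r_3'+r_4'$. **Adapted orderings.** Let $\mathcal K\subset U(\mathcal T)$ be a set of annihilation operators. A total ordering on $\mathcal C_{m,n}$ with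 a global minimum (if $\mathcal C_{m,n}\neq\emptyset$) is adapted to a subset $\mathcal C^A\subset\mathcal C_{m,n}$ in $\mathcal V_{0,q}$ with annihilation operators $\mathcal K$ if for every $X_0\in\mathcal C^A$ there are $\Gamma\in\mathcal K$, a vector space basis $\mathcal B$ of $\mathcal V_{0,q}$ and an element $\tilde X\in\mathcal B$ such that the coefficient of $\tilde X$ in the expansion of $\Gamma X_0|0,q\rangle$ in $\mathcal B$ is non-zero, while the coefficient of $\tilde X$ in $\Gamma Y|0,q\rangle$ is zero for every $Y\in\mathcal C_{m,n}$ with $Y\ne X_0$ that is larger than $X_0$. The complement $\mathcal C_{m,n}\setminus\mathcal C^A$ is called the ordering kernel. **Theorem.** Let $c,q\in\mathbb C$ with $c\ne3$, and let the annihilation operators contain $\mathcal G_0$ or $\mathcal Q_0$ but not both, i.e. let $\mathcal K$ be $U(\mathcal T)^+\oplus\mathbb C\,\mathcal G_0$ or $U(\mathcal T)^+\oplus\mathbb C\,\mathcal Q_0$. Then for all $m\in\mathbb N_0$, $n\in\mathbb Z$ the ordering $\prec_{GQ}$ on $\mathcal C_{m,n}$ is adapted in $\mathcal V_{0,q}$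 with annihilation operators $\mathcal K$, with the following ordering kernels (for $m=0$ the entries with a factor $\mathcal L_{-1}^{m-1}$ are to be omitted). For $\mathcal K=U(\mathcal T)^+\oplus\mathbb C\,\mathcal G_0$: * $n=2$: $\{\mathcal L_{-1}^{m-1}\mathcal G_{-1}\mathcal G_0\}$ * $n=1$: $\{\mathcal L_{-1}^{m}\mathcal G_0,\ \mathcal L_{-1}^{m-1}\mathcal G_{-1},\ \mathcal L_{-1}^{m-1}\mathcal G_{-1}\mathcal G_0\mathcal Q_0\}$ * $n=0$: $\{\mathcal L_{-1}^{m},\ \mathcal L_{-1}^{m}\mathcal G_0\mathcal Q_0,\ \mathcal L_{-1}^{m-1}\mathcal G_{-1}\mathcal Q_0\}$ * $n=-1$: $\{\mathcal L_{-1}^{m}\mathcal Q_0\}$ * every other $n$: $\emptyset$ For $\mathcal K=U(\mathcal T)^+\oplus\mathbb C\,\mathcal Q_0$: * $n=1$: $\{\mathcal L_{-1}^{m}\mathcal G_0\}$ * $n=0$: $\{\mathcal L_{-1}^{m},\ \mathcal L_{-1}^{m}\mathcal G_0\mathcal Q_0,\ \mathcal L_{-1}^{m-1}\mathcal Q_{-1}\mathcal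 G_0\}$ * $n=-1$: $\{\mathcal L_{-1}^{m}\mathcal Q_0,\ \mathcal L_{-1}^{m-1}\mathcal Q_{-1},\ \mathcal L_{-1}^{m-1}\mathcal Q_{-1}\mathcal G_0\mathcal Q_0\}$ * $n=-2$: $\{\mathcal L_{-1}^{m-1}\mathcal Q_{-1}\mathcal Q_0\}$ * every other $n$: $\emptyset$ -/

import Mathlib

namespace TopN2

/-- Basis elements of the topological `N = 2` superconformal algebra: `L m`, `H m` and the central
`C` are even, `G m` and `Q m` are odd. -/
inductive Gen : Type
  | L (m : ℤ)
  | H (m : ℤ)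
  | G (m : ℤ)
  | Q (m : ℤ)
  | C

/-- A generator as an element of the free algebra. -/
noncomputable abbrev gen (x : Gen) : FreeAlgebra ℂ Gen := FreeAlgebra.ι ℂ x

/-- Commutator in an associative algebra. -/
def comm {A : Type*} [Ring A] (x y : A) : A := x * y - y * x

/-- Anticommutator in an associative algebra. -/
def acomm {A : Type*} [Ring A] (x y : A) : A := x * y + y * x

/-- The (anti-)commutation relations of the topological `N = 2` superconformal algebra. -/
inductive Rel : FreeAlgebra ℂ Gen → FreeAlgebra ℂ Gen → Prop
  | LL (m n : ℤ) : Rel (comm (gen (.L m)) (gen (.L n))) (((m : ℂ) - n) • gen (.L (m + n)))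
  | HH (m n : ℤ) : Rel (comm (gen (.H m)) (gen (.H n)))
      (if m + n = 0 then ((m : ℂ) / 3) • gen .C else 0)
  | LG (m n : ℤ) : Rel (comm (gen (.L m)) (gen (.G n))) (((m : ℂ) - n) • gen (.G (m + n)))
  | HG (m n : ℤ) : Rel (comm (gen (.H m)) (gen (.G n))) (gen (.G (m + n)))
  | LQ (m n : ℤ) : Rel (comm (gen (.L m)) (gen (.Q n))) ((-(n : ℂ)) • gen (.Q (m + n)))
  | HQ (m n : ℤ) : Rel (comm (gen (.H m)) (gen (.Q n))) (-gen (.Q (m + n)))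
  | LH (m n : ℤ) : Rel (comm (gen (.L m)) (gen (.H n)))
      ((-(n : ℂ)) • gen (.H (m + n)) +
        if m + n = 0 then (((m : ℂ) ^ 2 + m) / 6) • gen .C else 0)
  | GQ (m n : ℤ) : Rel (acomm (gen (.G m)) (gen (.Q n)))
      ((2 : ℂ) • gen (.L (m + n)) - (2 * (n : ℂ)) • gen (.H (m + n)) +
        if m + n = 0 then (((m : ℂ) ^ 2 + m) / 3) • gen .C else 0)
  | GG (m n : ℤ) : Rel (acomm (gen (.G m)) (gen (.G n))) 0
  | QQ (m n : ℤ) : Rel (acomm (gen (.Q m)) (gen (.Q n))) 0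
  | central (x : Gen) : Rel (comm (gen .C) (gen x)) 0

/-- The universal enveloping algebra of the topological `N = 2` superconformal algebra: the
associative unital algebra generated by a basis of the Lie superalgebra, subject to
`x y - (-1)^{|x||y|} y x = [x, y]`. -/
abbrev U : Type := RingQuot Rel

/-- The image of a basis element of the superconformal algebra in its enveloping algebra. -/
noncomputable def op (x : Gen) : U := RingQuot.mkAlgHom ℂ Rel (gen x)

/-- The left ideal of `U` that annihilates a highest weight vector with `L₀`-eigenvalue `0`,
`H₀`-eigenvalue `q`, `C`-eigenvalue `c`, and no condition imposed by `G₀` or `Q₀`. -/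
noncomputable def vermaIdeal (c q : ℂ) : Submodule U U :=
  Submodule.span U
    ({op (.L 0), op (.H 0) - algebraMap ℂ U q, op .C - algebraMap ℂ U c} ∪
      {Y | ∃ j : ℤ, 1 ≤ j ∧ (Y = op (.L j) ∨ Y = op (.H j) ∨ Y = op (.G j) ∨ Y = op (.Q j))})

/-- The no-label Verma module `V_{0,q}` with central charge `c`: the `U`-module induced from the
one-dimensional module over `span{L₀, H₀, C} ⊕ (positive operators)`. -/
abbrev NoLabelVerma (c q : ℂ) : Type := U ⧸ vermaIdeal c q

/-- The highest weight vector `|0,q⟩`. -/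
noncomputable def hwVec (c q : ℂ) : NoLabelVerma c q := Submodule.Quotient.mk 1

/-- The part `U⁺` of negative `L₀`-grade: sums of `Y` with `[L₀, Y] = l Y`, `l < 0`. -/
noncomputable def positivePart : Submodule ℂ U :=
  Submodule.span ℂ {Y | ∃ l : ℤ, l < 0 ∧ comm (op (.L 0)) Y = (l : ℂ) • Y}

/-- The annihilation operators `U⁺ ⊕ span{Z}`, for a zero mode `Z`. -/
noncomputable def annihilators (Z : U) : Submodule ℂ U :=
  positivePart ⊔ Submodule.span ℂ {Z}

/-- The data of a term
`L_{-l_L}⋯L_{-l_1} H_{-h_H}⋯H_{-h_1} G_{-g_G}⋯G_{-g_1} Q_{-q_Q}⋯Q_{-q_1}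
  L_{-1}^k G_{-1}^{r₁} Q_{-1}^{r₂} G_0^{r₄} Q_0^{r₃}`;
the list `Ls` is `[l_1, …, l_L]`, i.e. it reads the modes from right to left, and likewise for
`Hs`, `Gs`, `Qs`. -/
@[ext] structure Term : Type where
  Ls : List ℕ
  Hs : List ℕ
  Gs : List ℕ
  Qs : List ℕ
  k : ℕ
  r₁ : ℕ
  r₂ : ℕ
  r₄ : ℕ
  r₃ : ℕ

namespace Term

/-- The product `Z_{-z_s} ⋯ Z_{-z_1}` for the list `[z_1, …, z_s]`. -/
noncomputable def modesOp (Z : ℤ → Gen) (zs : List ℕ) : U :=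
  (zs.reverse.map fun z => op (Z (-(z : ℤ)))).prod

/-- The element of the enveloping algebra denoted by a term. -/
noncomputable def toU (X : Term) : U :=
  modesOp .L X.Ls * modesOp .H X.Hs * modesOp .G X.Gs * modesOp .Q X.Qs *
    op (.L (-1)) ^ X.k * op (.G (-1)) ^ X.r₁ * op (.Q (-1)) ^ X.r₂ *
    op (.G 0) ^ X.r₄ * op (.Q 0) ^ X.r₃

/-- The level of a term. -/
def level (X : Term) : ℕ :=
  X.Ls.sum + X.Hs.sum + X.Gs.sum + X.Qs.sum + X.k + X.r₁ + X.r₂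

/-- The charge of a term. -/
def charge (X : Term) : ℤ :=
  (X.Gs.length : ℤ) - X.Qs.length + X.r₁ - X.r₂ + X.r₄ - X.r₃

end Term

/-- The set `𝒞_{m,n}` of terms of level `m` and charge `n`. -/
def termSet (m : ℕ) (n : ℤ) : Set Term :=
  {X | (X.Ls.Pairwise (· ≤ ·) ∧ ∀ a ∈ X.Ls, 2 ≤ a) ∧
    (X.Hs.Pairwise (· ≤ ·) ∧ ∀ a ∈ X.Hs, 1 ≤ a) ∧
    (X.Gs.Pairwise (· < ·) ∧ ∀ a ∈ X.Gs, 2 ≤ a) ∧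
    (X.Qs.Pairwise (· < ·) ∧ ∀ a ∈ X.Qs, 2 ≤ a) ∧
    X.r₁ ≤ 1 ∧ X.r₂ ≤ 1 ∧ X.r₃ ≤ 1 ∧ X.r₄ ≤ 1 ∧
    X.level = m ∧ X.charge = n}

/-- Strict ordering of two products of modes of the same type, read from right to left: at the
first disagreement the smaller mode decides; if there is none, the longer product is smaller. -/
def seqLT : List ℕ → List ℕ → Prop
  | [], _ => False
  | _ :: _, [] => True
  | a :: s, b :: t => a < b ∨ (a = b ∧ seqLT s t)

/-- The strict ordering `≺_{GQ}`. -/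
def termLT (X Y : Term) : Prop :=
  X.k > Y.k ∨ (X.k = Y.k ∧
  (X.r₁ + X.r₂ > Y.r₁ + Y.r₂ ∨ (X.r₁ + X.r₂ = Y.r₁ + Y.r₂ ∧
  (seqLT X.Qs Y.Qs ∨ (X.Qs = Y.Qs ∧
  (seqLT X.Gs Y.Gs ∨ (X.Gs = Y.Gs ∧
  (seqLT X.Ls Y.Ls ∨ (X.Ls = Y.Ls ∧
  (seqLT X.Hs Y.Hs ∨ (X.Hs = Y.Hs ∧
  (X.r₁ > Y.r₁ ∨ (X.r₁ = Y.r₁ ∧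
  X.r₃ + X.r₄ > Y.r₃ + Y.r₄)))))))))))))

/-- The ordering `⪯_{GQ}`. -/
def termLE (X Y : Term) : Prop := X = Y ∨ termLT X Y

/-- `le` is a total ordering on the set `S` of terms, with a global minimum if `S` is nonempty, that
is adapted to the subset `A` in the module `M` with highest weight vector `v` and annihilation
operators `K`. -/
structure IsAdapted {M : Type} [AddCommGroup M] [Module ℂ M] [Module U M] (v : M) (K : Set U)
    (S A : Set Term) (le : Term → Term → Prop) : Prop where
  subset : A ⊆ S
  refl : ∀ X ∈ S, le X X
  antisymm : ∀ X ∈ S, ∀ Y ∈ S, le X Y → le Y X → X = Y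
  trans : ∀ X ∈ S, ∀ Y ∈ S, ∀ Z ∈ S, le X Y → le Y Z → le X Z
  total : ∀ X ∈ S, ∀ Y ∈ S, le X Y ∨ le Y X
  exists_min : S.Nonempty → ∃ X ∈ S, ∀ Y ∈ S, le X Y
  adapted : ∀ X₀ ∈ A, ∃ Γ ∈ K, ∃ (ι : Type) (b : Module.Basis ι ℂ M) (i : ι),
    b.repr (Γ • X₀.toU • v) i ≠ 0 ∧
    ∀ Y ∈ S, le X₀ Y → X₀ ≠ Y → b.repr (Γ • Y.toU • v) i = 0

/-- `le` is an adapted ordering on `S` with ordering kernel `N`, i.e. `N ⊆ S` and `le` is adapted to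
the complement `S \ N`. -/
def IsAdaptedWithKernel {M : Type} [AddCommGroup M] [Module ℂ M] [Module U M] (v : M) (K : Set U)
    (S N : Set Term) (le : Term → Term → Prop) : Prop :=
  N ⊆ S ∧ IsAdapted v K S (S \ N) le

/-- The term `L_{-1}^k G_{-1}^{r₁} Q_{-1}^{r₂} G_0^{r₄} Q_0^{r₃}`. -/
def shortTerm (k r₁ r₂ r₄ r₃ : ℕ) : Term := ⟨[], [], [], [], k, r₁, r₂, r₄, r₃⟩

/-- The ordering kernels for the annihilation operators containing `G₀`. The intersection with
`termSet m n` only discards, for `m = 0`, the entries with the factor `L_{-1}^{m-1}`. -/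
def kernelG (m : ℕ) (n : ℤ) : Set Term :=
  (if n = 2 then {shortTerm (m - 1) 1 0 1 0}
    else if n = 1 then
      {shortTerm m 0 0 1 0, shortTerm (m - 1) 1 0 0 0, shortTerm (m - 1) 1 0 1 1}
    else if n = 0 then
      {shortTerm m 0 0 0 0, shortTerm m 0 0 1 1, shortTerm (m - 1) 1 0 0 1}
    else if n = -1 then {shortTerm m 0 0 0 1}
    else ∅) ∩ termSet m n

/-- The ordering kernels for the annihilation operators containing `Q₀`. The intersection with
`termSet m n` only discards, for `m = 0`, the entries with the factor `L_{-1}^{m-1}`. -/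
def kernelQ (m : ℕ) (n : ℤ) : Set Term :=
  (if n = 1 then {shortTerm m 0 0 1 0}
    else if n = 0 then
      {shortTerm m 0 0 0 0, shortTerm m 0 0 1 1, shortTerm (m - 1) 0 1 1 0}
    else if n = -1 then
      {shortTerm m 0 0 0 1, shortTerm (m - 1) 0 1 0 0, shortTerm (m - 1) 0 1 1 1}
    else if n = -2 then {shortTerm (m - 1) 0 1 0 1}
    else ∅) ∩ termSet m n

end TopN2

/-! Adaptedness is a statement about singular vectors. A basis may be chosen for each term
separately, so it suffices to find one annihilation operator Γ for which Γ X₀|0,q⟩ lies outside the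
span of the Γ Y|0,q⟩ with Y larger than X₀; a linear functional separating the two extends to a
basis. The same Γ serves every X₀: the sum of the allowed zero mode Z and of all G_j, Q_j, H_j with
1 ≤ j ≤ m. Its summands have distinct bidegrees (mode, charge), so Γ kills a homogeneous vector only
if each summand does. The L_j then come for free from {G_0, Q_j} or {G_j, Q_0}. If separation fails,
some combination s of X₀ and larger terms, with X₀ present, is killed by Z and by all positive
modes. It remains to show that X₀ is then one of the listed kernel terms.

For linear independence of the terms, words are rewritten into standard form by an abstract diamond
lemma for Lie superalgebras (`HWData.reducible`). The normal forms carry an action of the enveloping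
algebra, and distinct terms give distinct standard words.

To find the leading terms of s, filter by weight: L_{-1} has weight 2, the other L and all G, Q have
weight 1, H and C have weight 0. In the leading bracket `topBracket` the letter L_{-1} is central,
[L_j, L_{-1-j}] = (2j+1) L_{-1}, {G_j, Q_{-1-j}} = 2 L_{-1}, and the H act on G and Q as charge
currents. The zero modes G_0, Q_0 at the end of a word become inert labels (`nf_append_tail`). The
weight-maximal part of s with a fixed tail is therefore killed, in a Fock-type module, by the
leading versions of the same operators (`fock_ρ_topPart`).

In that module letters are detected one at a time (`fock_singular`). The operator 2 L_{-1} H_h + ∑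
Q_{h-1-a} G_a commutes with all L, G, Q and sends H_{-h} to (2h/3)(c-3) L_{-1}. Since c ≠ 3, no H
survives. Then L_j detects L_{-1-j}, and on words without H the modes G_j and Q_j detect Q_{-1-j}
and G_{-1-j}. The words of maximal weight thus contain only L_{-1}, G_{-1}, Q_{-1} and a tail; Z =
G_0 excludes Q_{-1}, and Z = Q_0 excludes G_{-1}.

Such a word has k ≥ m-1. The ordering compares k and then r₁+r₂ first, so the smaller term X₀ is
either L_{-1}^m with a tail or itself of maximal weight, and hence lies in the kernel. -/

open Finsupp

/-! ### Diamond lemma for a Lie superalgebra acting on a highest weight vector. -/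

/-- The sign picked up when exchanging two letters of given parities. -/
noncomputable def superSign (p r : Bool) : ℂ := if p && r then -1 else 1

theorem superSign_comm (p r : Bool) : superSign p r = superSign r p := by
  cases p <;> cases r <;> rfl

theorem superSign_mul_self (p r : Bool) : superSign p r * superSign p r = 1 := by
  cases p <;> cases r <;> simp [superSign]

theorem superSign_xor_left (p r t : Bool) :
    superSign (xor p r) t = superSign p t * superSign r t := by
  cases p <;> cases r <;> cases t <;> simp [superSign]

/-- A Lie superalgebra with an ordered basis `I` and structure constants `br`, such that odd basis
elements have square zero, together with a character `χ` of the subalgebra spanned by the upper set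
`bd` of basis elements. -/
structure HWData (I : Type) [LinearOrder I] where
  odd : I → Bool
  br : I → I → I →₀ ℂ
  bd : I → Prop
  χ : I → ℂ
  br_parity : ∀ a b k, br a b k ≠ 0 → odd k = xor (odd a) (odd b)
  br_symm : ∀ a b, br b a = -(superSign (odd a) (odd b)) • br a b
  br_self : ∀ a, br a a = 0
  jacobi : ∀ x y z, linearCombination ℂ (br x) (br y z) =
    linearCombination ℂ (fun k => br k z) (br x y) +
      superSign (odd x) (odd y) • linearCombination ℂ (br y) (br x z)
  bd_mono : ∀ a b, a ≤ b → bd a → bd b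
  bd_br : ∀ a b k, bd a → bd b → br a b k ≠ 0 → bd k
  χ_odd : ∀ a, bd a → odd a = true → χ a = 0
  χ_br : ∀ a b, bd a → bd b → linearCombination ℂ χ (br a b) = 0

/-- The number of strict inversions of a word. -/
def inversions {I : Type} [LinearOrder I] : List I → ℕ
  | [] => 0
  | a :: w => w.countP (fun b => decide (b < a)) + inversions w

theorem inversions_swap_lt {I : Type} [LinearOrder I] (u : List I) {a b : I} (v : List I)
    (h : b < a) : inversions (u ++ b :: a :: v) < inversions (u ++ a :: b :: v) := by
  induction u with
  | nil => simp [inversions, h, h.le]; omega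
  | cons c u ih =>
    simp only [List.cons_append, inversions]
    have : (u ++ b :: a :: v).countP (fun b => decide (b < c)) =
        (u ++ a :: b :: v).countP (fun b => decide (b < c)) :=
      List.Perm.countP_eq _ (List.Perm.append_left _ (List.Perm.swap _ _ _))
    omega

namespace HWData

variable {I : Type} [LinearOrder I] (D : HWData I)

/-- The sign of the exchange of two letters. -/
noncomputable def sgn (a b : I) : ℂ := superSign (D.odd a) (D.odd b)

theorem sgn_comm (a b : I) : D.sgn a b = D.sgn b a := superSign_comm _ _

theorem sgn_mul_self (a b : I) : D.sgn a b * D.sgn a b = 1 := superSign_mul_self _ _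

theorem sgn_br {a b k : I} (h : D.br a b k ≠ 0) (c : I) :
    D.sgn k c = D.sgn a c * D.sgn b c := by
  rw [sgn, D.br_parity a b k h, superSign_xor_left]; rfl

/-- Two adjacent letters that are to be rewritten. -/
def Inv (a b : I) : Prop := b < a ∨ (a = b ∧ D.odd a = true)

/-- A word of letters outside `bd` in weakly increasing order, in which no odd letter is
repeated. -/
def Std (w : List I) : Prop := w.Pairwise (fun a b => ¬ D.Inv a b) ∧ ∀ a ∈ w, ¬ D.bd a

open Classical in
/-- The normal form of the word `w` acting on the highest weight vector, as a linear combination of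
standard words. -/
noncomputable def nf (w : List I) : List I →₀ ℂ :=
  if h : ∃ (u : List I) (b : I), w = u ++ [b] ∧ D.bd b then
    D.χ h.choose_spec.choose • nf h.choose
  else if h : ∃ (u : List I) (a b : I) (v : List I), w = u ++ a :: b :: v ∧ D.Inv a b then
    let u := h.choose
    let a := h.choose_spec.choose
    let b := h.choose_spec.choose_spec.choose
    let v := h.choose_spec.choose_spec.choose_spec.choose
    if b < a then
      D.sgn a b • nf (u ++ b :: a :: v) + (D.br a b).sum fun k z => z • nf (u ++ k :: v)
    -- Only a = b odd is left here: the square of an odd letter is half its bracket with itself,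
    -- which vanishes.
    else 0
  else single w 1
termination_by (w.length, inversions w)
decreasing_by
  · have := h.choose_spec.choose_spec.1
    apply Prod.Lex.left
    conv_rhs => rw [this]
    simp
  · have := h.choose_spec.choose_spec.choose_spec.choose_spec.1
    conv_rhs => rw [this]
    rename_i hlt
    have e : (u ++ b :: a :: v).length = (u ++ a :: b :: v).length := by simp
    rw [e]
    exact Prod.Lex.right _ (inversions_swap_lt _ _ hlt)
  · have := h.choose_spec.choose_spec.choose_spec.choose_spec.1
    apply Prod.Lex.left
    conv_rhs => rw [this]
    simp only [List.length_append, List.length_cons]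
    omega

theorem nf_append_bd (u : List I) {b : I} (hb : D.bd b) :
    D.nf (u ++ [b]) = D.χ b • D.nf u := by
  have h : ∃ (u' : List I) (b' : I), u ++ [b] = u' ++ [b'] ∧ D.bd b' := ⟨u, b, rfl, hb⟩
  rw [nf, dif_pos h]
  have h2 := List.append_inj' h.choose_spec.choose_spec.1 rfl
  simp only [List.cons.injEq, and_true] at h2
  exact congrArg₂ (fun b u => D.χ b • D.nf u) h2.2.symm h2.1.symm

/-- The rewriting of an adjacent pair of letters. -/
noncomputable def red (a b : I) : List I →₀ ℂ :=
  if b < a then D.sgn a b • single [b, a] 1 + (D.br a b).mapDomain (fun k => [k]) else 0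

theorem linearCombination_red_of_lt {M : Type} [AddCommGroup M] [Module ℂ M] (φ : List I → M)
    {a b : I} (h : b < a) : linearCombination ℂ φ (D.red a b) =
      D.sgn a b • φ [b, a] + linearCombination ℂ (fun k => φ [k]) (D.br a b) := by
  rw [red, if_pos h, map_add, map_smul, linearCombination_single, one_smul,
    linearCombination_mapDomain]
  rfl

/-- `Smaller w' w`: the word `w'` is shorter than `w`, or has the same length and fewer
inversions. -/
def Smaller (w' w : List I) : Prop :=
  w'.length < w.length ∨ (w'.length = w.length ∧ inversions w' < inversions w)

theorem smaller_red {a b : I} {r : List I} (hr : D.red a b r ≠ 0) (u v : List I) :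
    Smaller (u ++ r ++ v) (u ++ a :: b :: v) := by
  rw [red] at hr
  split_ifs at hr with h
  · by_cases h1 : r = [b, a]
    · right
      subst h1
      simpa using inversions_swap_lt u v h
    · left
      have h2 : (D.br a b).mapDomain (fun k => [k]) r ≠ 0 := by
        intro h3
        apply hr
        rw [Finsupp.add_apply, h3, Finsupp.smul_apply, single_apply, if_neg (Ne.symm h1)]
        simp
      have h3 := mapDomain_support (mem_support_iff.2 h2)
      simp only [Finset.mem_image] at h3
      obtain ⟨k, -, rfl⟩ := h3
      simp
  · simp at hr

theorem smaller_wf : WellFounded (Smaller : List I → List I → Prop) := by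
  have : (Smaller : List I → List I → Prop) =
      InvImage (Prod.Lex (· < ·) (· < ·)) fun w => (w.length, inversions w) := by
    ext w' w
    simp [Smaller, InvImage, Prod.lex_def]
  rw [this]
  exact InvImage.wf _ (WellFounded.prod_lex wellFounded_lt wellFounded_lt)

theorem nf_cases (w : List I) (hw : ¬ ∃ (u : List I) (b : I), w = u ++ [b] ∧ D.bd b) :
    (∃ (u : List I) (a b : I) (v : List I), w = u ++ a :: b :: v ∧ D.Inv a b ∧
      D.nf w = linearCombination ℂ (fun r => D.nf (u ++ r ++ v)) (D.red a b)) ∨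
    ((¬ ∃ (u : List I) (a b : I) (v : List I), w = u ++ a :: b :: v ∧ D.Inv a b) ∧
      D.nf w = single w 1) := by
  by_cases h : ∃ (u : List I) (a b : I) (v : List I), w = u ++ a :: b :: v ∧ D.Inv a b
  · left
    refine ⟨h.choose, h.choose_spec.choose, h.choose_spec.choose_spec.choose,
      h.choose_spec.choose_spec.choose_spec.choose,
      h.choose_spec.choose_spec.choose_spec.choose_spec.1,
      h.choose_spec.choose_spec.choose_spec.choose_spec.2, ?_⟩
    rw [nf, dif_neg hw, dif_pos h]
    dsimp only
    split_ifs with hlt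
    · rw [linearCombination_red_of_lt _ _ hlt]
      simp [linearCombination_apply]
    · rw [red, if_neg hlt, map_zero]
  · right
    refine ⟨h, ?_⟩
    rw [nf, dif_neg hw, dif_neg h]

theorem linearCombination_congr {J M : Type} [AddCommGroup M] [Module ℂ M] {φ ψ : J → M}
    {f : J →₀ ℂ} (h : ∀ k, f k ≠ 0 → φ k = ψ k) :
    linearCombination ℂ φ f = linearCombination ℂ ψ f := by
  rw [linearCombination_apply, linearCombination_apply]
  exact Finset.sum_congr rfl fun k hk => by simp only [h k (mem_support_iff.1 hk)]

theorem linearCombination_swap {J K M : Type} [AddCommGroup M] [Module ℂ M] (φ : J → K → M)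
    (f : J →₀ ℂ) (g : K →₀ ℂ) :
    linearCombination ℂ (fun a => linearCombination ℂ (φ a) g) f =
      linearCombination ℂ (fun b => linearCombination ℂ (fun a => φ a b) f) g := by
  simp only [linearCombination_apply, Finsupp.sum, Finset.smul_sum]
  rw [Finset.sum_comm]
  exact Finset.sum_congr rfl fun _ _ => Finset.sum_congr rfl fun _ _ => smul_comm _ _ _

theorem linearCombination_comp_apply {J M M' : Type} [AddCommGroup M] [Module ℂ M]
    [AddCommGroup M'] [Module ℂ M'] (T : M →ₗ[ℂ] M') (φ : J → M) (f : J →₀ ℂ) :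
    T (linearCombination ℂ φ f) = linearCombination ℂ (fun k => T (φ k)) f :=
  apply_linearCombination ℂ T φ f

theorem linearCombination_nested {J K M : Type} [AddCommGroup M] [Module ℂ M] (φ : J → M)
    (B : K → J →₀ ℂ) (f : K →₀ ℂ) :
    linearCombination ℂ φ (linearCombination ℂ B f) =
      linearCombination ℂ (fun k => linearCombination ℂ φ (B k)) f :=
  linearCombination_comp_apply (linearCombination ℂ φ) B f

theorem linearCombination_smul_fun {J M : Type} [AddCommGroup M] [Module ℂ M] (c : ℂ) (φ : J → M)
    (f : J →₀ ℂ) :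
    linearCombination ℂ (fun k => c • φ k) f = c • linearCombination ℂ φ f := by
  simp only [linearCombination_apply, Finsupp.sum, Finset.smul_sum]
  exact Finset.sum_congr rfl fun _ _ => smul_comm _ _ _

theorem linearCombination_add_fun {J M : Type} [AddCommGroup M] [Module ℂ M] (φ ψ : J → M)
    (f : J →₀ ℂ) :
    linearCombination ℂ (fun k => φ k + ψ k) f =
      linearCombination ℂ φ f + linearCombination ℂ ψ f := by
  simp only [linearCombination_apply, smul_add, Finsupp.sum_add]

/-- Every inversion of `w` may be rewritten without changing the normal form. -/
def Reducible (w : List I) : Prop :=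
  ∀ (u : List I) (a b : I) (v : List I), w = u ++ a :: b :: v → D.Inv a b →
    D.nf w = linearCombination ℂ (fun r => D.nf (u ++ r ++ v)) (D.red a b)

/-- The exchange relation for adjacent letters in words of length `n`. -/
def Exchange (n : ℕ) : Prop :=
  ∀ (u : List I) (a b : I) (v : List I), (u ++ a :: b :: v).length = n →
    D.nf (u ++ a :: b :: v) = D.sgn a b • D.nf (u ++ b :: a :: v) +
      linearCombination ℂ (fun k => D.nf (u ++ k :: v)) (D.br a b)

theorem Reducible.lt {D : HWData I} {u : List I} {a b : I} {v : List I}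
    (h : D.Reducible (u ++ a :: b :: v)) (hab : b < a) :
    D.nf (u ++ a :: b :: v) = D.sgn a b • D.nf (u ++ b :: a :: v) +
      linearCombination ℂ (fun k => D.nf (u ++ k :: v)) (D.br a b) := by
  rw [h u a b v rfl (Or.inl hab), linearCombination_red_of_lt _ _ hab]
  simp

theorem Reducible.odd {D : HWData I} {u : List I} {a : I} {v : List I}
    (h : D.Reducible (u ++ a :: a :: v)) (ha : D.odd a = true) :
    D.nf (u ++ a :: a :: v) = 0 := by
  rw [h u a a v rfl (Or.inr ⟨rfl, ha⟩), red, if_neg (lt_irrefl _), map_zero]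

/-- A pair already in increasing order satisfies the relation because the rule for the reversed pair
can be read backwards, the sign being its own inverse. The exchange relation thus becomes
independent of the order of the letters. -/
theorem exchange_of_reducible {n : ℕ} (h : ∀ w : List I, w.length = n → D.Reducible w) :
    D.Exchange n := by
  intro u a b v hn
  rcases lt_trichotomy a b with hab | rfl | hab
  · have hn' : (u ++ b :: a :: v).length = n := by simpa using hn
    have := (h _ hn').lt hab
    rw [this, D.br_symm a b, map_smul, smul_add, smul_smul, smul_smul, D.sgn_comm b a,
      sgn_mul_self, mul_neg]
    change _ = _ + -(D.sgn a b * D.sgn a b) • _ + _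
    rw [sgn_mul_self]
    simp
  · rw [D.br_self, map_zero, add_zero]
    by_cases ha : D.odd a = true
    · rw [(h _ hn).odd ha, smul_zero]
    · simp [sgn, superSign, ha]
  · exact (h _ hn).lt hab

/-- The exchange of a letter with a letter produced by a bracket. -/
theorem exchange_br_left {n : ℕ} (h : D.Exchange n) (u v : List I) (x y z : I)
    (hn : (u ++ x :: z :: v).length = n) :
    linearCombination ℂ (fun k => D.nf (u ++ k :: z :: v)) (D.br x y) =
      (D.sgn x z * D.sgn y z) • linearCombination ℂ (fun k => D.nf (u ++ z :: k :: v)) (D.br x y) +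
      linearCombination ℂ (fun k => D.nf (u ++ k :: v))
        (linearCombination ℂ (fun k => D.br k z) (D.br x y)) := by
  rw [linearCombination_nested, ← linearCombination_smul_fun, ← linearCombination_add_fun]
  refine linearCombination_congr fun k hk => ?_
  rw [h u k z v (by simpa using hn), D.sgn_br hk]

theorem exchange_br_right {n : ℕ} (h : D.Exchange n) (u v : List I) (x y z : I)
    (hn : (u ++ x :: z :: v).length = n) :
    linearCombination ℂ (fun k => D.nf (u ++ z :: k :: v)) (D.br x y) =
      (D.sgn x z * D.sgn y z) • linearCombination ℂ (fun k => D.nf (u ++ k :: z :: v)) (D.br x y) +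
      linearCombination ℂ (fun k => D.nf (u ++ k :: v))
        (linearCombination ℂ (D.br z) (D.br x y)) := by
  rw [linearCombination_nested, ← linearCombination_smul_fun, ← linearCombination_add_fun]
  refine linearCombination_congr fun k hk => ?_
  rw [h u z k v (by simpa using hn), D.sgn_comm z k, D.sgn_br hk]

theorem sgn_self {x : I} (hx : D.odd x = true) : D.sgn x x = -1 := by
  simp [sgn, superSign, hx]

/-- For x odd the Jacobi identity for x, x, z says that this element is its own negative. -/
theorem br_self_br_left {x z : I} (hx : D.odd x = true) :
    linearCombination ℂ (D.br x) (D.br x z) = 0 := by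
  have h := D.jacobi x x z
  rw [D.br_self, map_zero, zero_add, show superSign (D.odd x) (D.odd x) = D.sgn x x from rfl,
    D.sgn_self hx, neg_one_smul] at h
  exact self_eq_neg.1 h

theorem br_br_self_right {x y : I} (hy : D.odd y = true) :
    linearCombination ℂ (fun k => D.br k y) (D.br x y) = 0 := by
  have h := D.jacobi x y y
  have h1 : linearCombination ℂ (D.br y) (D.br x y) =
      D.sgn x y • linearCombination ℂ (fun k => D.br k y) (D.br x y) := by
    rw [← linearCombination_smul_fun]
    refine linearCombination_congr fun k hk => ?_
    rw [D.br_symm k y, show superSign (D.odd k) (D.odd y) = D.sgn k y from rfl, D.sgn_br hk,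
      D.sgn_self hy]
    simp
  rw [D.br_self, map_zero, h1, smul_smul, show superSign (D.odd x) (D.odd y) = D.sgn x y from rfl,
    sgn_mul_self, one_smul] at h
  exact self_eq_neg.1 (eq_neg_of_add_eq_zero_left h.symm)

/-- Rewritings at two disjoint places commute: after performing the other one, both sides become the
same double sum. -/
theorem reducible_disjoint {u m v : List I} {a b a' b' : I}
    (hi : D.Inv a b) (hi' : D.Inv a' b')
    (ih : ∀ w, Smaller w (u ++ a :: b :: (m ++ a' :: b' :: v)) → D.Reducible w) :
    linearCombination ℂ (fun r => D.nf (u ++ r ++ (m ++ a' :: b' :: v))) (D.red a b) =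
      linearCombination ℂ (fun r => D.nf (u ++ a :: b :: m ++ r ++ v)) (D.red a' b') := by
  have h1 : linearCombination ℂ (fun r => D.nf (u ++ r ++ (m ++ a' :: b' :: v))) (D.red a b) =
      linearCombination ℂ (fun r => linearCombination ℂ
        (fun r' => D.nf (u ++ r ++ m ++ r' ++ v)) (D.red a' b')) (D.red a b) := by
    refine linearCombination_congr fun r hr => ?_
    exact ih _ (D.smaller_red hr _ _) (u ++ r ++ m) a' b' v (by simp) hi'
  have h2 : linearCombination ℂ (fun r => D.nf (u ++ a :: b :: m ++ r ++ v)) (D.red a' b') =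
      linearCombination ℂ (fun r' => linearCombination ℂ
        (fun r => D.nf (u ++ r ++ m ++ r' ++ v)) (D.red a b)) (D.red a' b') := by
    refine linearCombination_congr fun r hr => ?_
    have hs := D.smaller_red hr (u ++ a :: b :: m) v
    rw [ih _ (by simpa using hs) u a b (m ++ r ++ v) (by simp) hi]
    simp
  rw [h1, h2, linearCombination_swap]

/-- The overlap ambiguity x y z. Resolving it from the left and from the right differs by exactly
the Jacobi identity, and by its consequences for repeated odd letters when x = y or y = z. -/
theorem reducible_overlap {u v : List I} {x y z : I} (hxy : D.Inv x y) (hyz : D.Inv y z)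
    (ih : ∀ w, Smaller w (u ++ x :: y :: z :: v) → D.Reducible w) :
    linearCombination ℂ (fun r => D.nf (u ++ r ++ z :: v)) (D.red x y) =
      linearCombination ℂ (fun r => D.nf (u ++ [x] ++ r ++ v)) (D.red y z) := by
  -- Letters produced by a bracket have no known position relative to the third letter. In words one
  -- letter shorter they may be exchanged in either direction.
  have hex : D.Exchange (u.length + 2 + v.length) := by
    refine D.exchange_of_reducible fun w hw => ih w (Or.inl ?_)
    simp; omega
  have sw : ∀ w : List I, w.length = (u ++ x :: y :: z :: v).length →
      inversions w < inversions (u ++ x :: y :: z :: v) → D.Reducible w :=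
    fun w h1 h2 => ih w (Or.inr ⟨h1, h2⟩)
  rcases hxy with hxy | ⟨rfl, hx⟩ <;> rcases hyz with hyz | ⟨rfl, hy⟩
  · have i1 : inversions (u ++ y :: x :: z :: v) < inversions (u ++ x :: y :: z :: v) :=
      inversions_swap_lt u _ hxy
    have i2 : inversions (u ++ x :: z :: y :: v) < inversions (u ++ x :: y :: z :: v) := by
      simpa using inversions_swap_lt (u ++ [x]) v hyz
    have i3 : inversions (u ++ y :: z :: x :: v) < inversions (u ++ y :: x :: z :: v) := by
      simpa using inversions_swap_lt (u ++ [y]) v (hyz.trans hxy)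
    have i4 : inversions (u ++ z :: x :: y :: v) < inversions (u ++ x :: z :: y :: v) :=
      inversions_swap_lt u _ (hyz.trans hxy)
    have e1 := (show D.Reducible ((u ++ [y]) ++ x :: z :: v) from
      sw _ (by simp) (by simpa using i1)).lt (hyz.trans hxy)
    have e2 := (sw (u ++ y :: z :: x :: v) (by simp) (i3.trans i1)).lt hyz
    have e3 := (sw (u ++ x :: z :: y :: v) (by simp) i2).lt (hyz.trans hxy)
    have e4 := (show D.Reducible ((u ++ [z]) ++ x :: y :: v) from
      sw _ (by simp) (by simpa using i4.trans i2)).lt hxy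
    have f1 := D.exchange_br_left hex u v x y z (by simp; omega)
    have f2 := D.exchange_br_right hex u v x z y (by simp; omega)
    have f3 := D.exchange_br_right hex u v y z x (by simp; omega)
    rw [linearCombination_red_of_lt _ _ hxy, linearCombination_red_of_lt _ _ hyz]
    simp only [List.append_assoc, List.cons_append, List.nil_append] at *
    rw [e1, e2, e3, e4, f1, f2, f3, D.jacobi x y z, map_add, map_smul]
    simp only [smul_add, smul_smul]
    have s1 : D.sgn x y * (D.sgn x y * D.sgn z y) = D.sgn y z := by
      rw [← mul_assoc, sgn_mul_self, one_mul, D.sgn_comm]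
    rw [D.sgn_comm y x, D.sgn_comm z x]
    rw [s1, show superSign (D.odd x) (D.odd y) = D.sgn x y from rfl]
    module
  · have i1 : inversions (u ++ y :: x :: y :: v) < inversions (u ++ x :: y :: y :: v) :=
      inversions_swap_lt u _ hxy
    have i3 : inversions (u ++ y :: y :: x :: v) < inversions (u ++ y :: x :: y :: v) := by
      simpa using inversions_swap_lt (u ++ [y]) v hxy
    have e1 := (show D.Reducible ((u ++ [y]) ++ x :: y :: v) from
      sw _ (by simp) (by simpa using i1)).lt hxy
    have e2 := (sw (u ++ y :: y :: x :: v) (by simp) (i3.trans i1)).odd hy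
    have f1 := D.exchange_br_left hex u v x y y (by simp; omega)
    have e0 : D.red y y = 0 := by rw [red, if_neg (lt_irrefl _)]
    rw [linearCombination_red_of_lt _ _ hxy, e0, map_zero]
    simp only [List.append_assoc, List.cons_append, List.nil_append] at *
    rw [e1, e2, f1, D.br_br_self_right hy, D.sgn_self hy, map_zero]
    module
  · have i2 : inversions (u ++ x :: z :: x :: v) < inversions (u ++ x :: x :: z :: v) := by
      simpa using inversions_swap_lt (u ++ [x]) v hyz
    have i4 : inversions (u ++ z :: x :: x :: v) < inversions (u ++ x :: z :: x :: v) :=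
      inversions_swap_lt u _ hyz
    have e3 := (sw (u ++ x :: z :: x :: v) (by simp) i2).lt hyz
    have e4 := (show D.Reducible ((u ++ [z]) ++ x :: x :: v) from
      sw _ (by simp) (by simpa using i4.trans i2)).odd hx
    have f2 := D.exchange_br_right hex u v x z x (by simp; omega)
    have e0 : D.red x x = 0 := by rw [red, if_neg (lt_irrefl _)]
    rw [linearCombination_red_of_lt _ _ hyz, e0, map_zero]
    simp only [List.append_assoc, List.cons_append, List.nil_append] at *
    rw [e3, e4, f2, D.br_self_br_left hx, D.sgn_self hx, map_zero, D.sgn_comm z x]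
    module
  · rw [red, if_neg (lt_irrefl _), map_zero, map_zero]

theorem Inv.bd_of_bd {D : HWData I} {a b : I} (h : D.Inv a b) (hb : D.bd b) : D.bd a := by
  rcases h with h | ⟨rfl, -⟩
  · exact D.bd_mono _ _ h.le hb
  · exact hb

/-- Confluence, by induction on length and then inversions. The ambiguities are an inversion against
the removal of a last letter in `bd`, and two inversions against each other. -/
theorem reducible (w : List I) : D.Reducible w := by
  refine (smaller_wf (I := I)).induction w fun w ih => ?_
  intro u a b v hw hab
  subst hw
  have hex : ∀ n < (u ++ a :: b :: v).length, D.Exchange n := fun n hn =>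
    D.exchange_of_reducible fun w hw => ih w (Or.inl (hw ▸ hn))
  by_cases hbd : ∃ (u' : List I) (z : I), u ++ a :: b :: v = u' ++ [z] ∧ D.bd z
  · obtain ⟨u', z, hz, hbz⟩ := hbd
    -- If the inversion involves the last letter, both letters lie in `bd`, as `bd` is an upper set,
    -- and consistency is the statement that χ is a character. Otherwise the last letter is removed
    -- first.
    rcases List.eq_nil_or_concat v with rfl | ⟨v', z', rfl⟩
    · have h0 : (u ++ [a]) ++ [b] = u' ++ [z] := by simpa using hz
      obtain ⟨-, h2⟩ := List.append_inj' h0 rfl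
      obtain rfl : b = z := by simpa using h2
      have ha := hab.bd_of_bd hbz
      rw [show u ++ [a, b] = (u ++ [a]) ++ [b] by simp, nf_append_bd _ _ hbz, nf_append_bd _ _ ha]
      rcases hab with hab | ⟨rfl, hodd⟩
      · have hbr : linearCombination ℂ (fun k => D.nf (u ++ [k])) (D.br a b) = 0 := by
          have : linearCombination ℂ (fun k => D.nf (u ++ [k])) (D.br a b) =
              linearCombination ℂ (fun k => D.χ k • D.nf u) (D.br a b) :=
            linearCombination_congr fun k hk => D.nf_append_bd _ (D.bd_br a b k ha hbz hk)
          rw [this]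
          have h3 := linearCombination_comp_apply (LinearMap.toSpanSingleton ℂ _ (D.nf u)) D.χ
            (D.br a b)
          simp only [D.χ_br a b ha hbz, map_zero, LinearMap.toSpanSingleton_apply] at h3
          exact h3.symm
        rw [linearCombination_red_of_lt _ _ hab]
        simp only [List.append_nil]
        rw [hbr, add_zero, show u ++ [b, a] = (u ++ [b]) ++ [a] by simp, nf_append_bd _ _ ha,
          nf_append_bd _ _ hbz, smul_smul, smul_smul, smul_smul]
        congr 1
        by_cases hs : D.odd a = true
        · rw [D.χ_odd a ha hs]; ring
        · simp [sgn, superSign, hs]; ring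
      · rw [D.χ_odd a ha hodd, red, if_neg (lt_irrefl _), map_zero, zero_smul]
    · have h0 : (u ++ a :: b :: v') ++ [z'] = u' ++ [z] := by simpa using hz
      obtain ⟨-, h2⟩ := List.append_inj' h0 rfl
      obtain rfl : z' = z := by simpa using h2
      have e : u ++ a :: b :: (v' ++ [z']) = (u ++ a :: b :: v') ++ [z'] := by simp
      rw [List.concat_eq_append, e, nf_append_bd _ _ hbz,
        ih (u ++ a :: b :: v') (Or.inl (by simp)) u a b v' rfl hab, ← linearCombination_smul_fun]
      refine linearCombination_congr fun r _ => ?_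
      rw [← nf_append_bd _ _ hbz]
      simp
  · rcases D.nf_cases _ hbd with ⟨u', a', b', v', hw, hab', h⟩ | ⟨h, -⟩
    · rw [h]
      -- Compare the given pair with the pair chosen by `nf`: they coincide, share one letter, or
      -- are disjoint.
      rcases List.append_eq_append_iff.1 hw with ⟨s, h1, h2⟩ | ⟨s, h1, h2⟩
      · rcases s with _ | ⟨x, _ | ⟨y, s⟩⟩
        · simp only [List.append_nil] at h1
          simp only [List.nil_append, List.cons.injEq] at h2
          obtain ⟨rfl, rfl, rfl⟩ := h2
          rw [h1]
        · simp only [List.cons_append, List.nil_append, List.cons.injEq] at h2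
          obtain ⟨rfl, rfl, rfl⟩ := h2
          subst h1
          exact (D.reducible_overlap hab hab' ih).symm
        · simp only [List.cons_append, List.cons.injEq] at h2
          obtain ⟨rfl, rfl, rfl⟩ := h2
          subst h1
          exact (D.reducible_disjoint hab hab' ih).symm
      · rw [hw] at ih
        rcases s with _ | ⟨x, _ | ⟨y, s⟩⟩
        · simp only [List.append_nil] at h1
          simp only [List.nil_append, List.cons.injEq] at h2
          obtain ⟨rfl, rfl, rfl⟩ := h2
          rw [h1]
        · simp only [List.cons_append, List.nil_append, List.cons.injEq] at h2
          obtain ⟨rfl, rfl, rfl⟩ := h2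
          subst h1
          exact D.reducible_overlap hab' hab ih
        · simp only [List.cons_append, List.cons.injEq] at h2
          obtain ⟨rfl, rfl, rfl⟩ := h2
          subst h1
          exact D.reducible_disjoint hab' hab ih
    · exact absurd ⟨u, a, b, v, rfl, hab⟩ h

theorem nf_exchange (u : List I) (a b : I) (v : List I) :
    D.nf (u ++ a :: b :: v) = D.sgn a b • D.nf (u ++ b :: a :: v) +
      linearCombination ℂ (fun k => D.nf (u ++ k :: v)) (D.br a b) :=
  D.exchange_of_reducible (fun w _ => D.reducible w) u a b v rfl

theorem nf_square (u : List I) {a : I} (v : List I) (ha : D.odd a = true) :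
    D.nf (u ++ a :: a :: v) = 0 :=
  (D.reducible _).odd ha

theorem std_of_not_inv {w : List I} (hw : ¬ ∃ (u : List I) (b : I), w = u ++ [b] ∧ D.bd b)
    (h : ¬ ∃ (u : List I) (a b : I) (v : List I), w = u ++ a :: b :: v ∧ D.Inv a b) :
    D.Std w := by
  have hc : w.IsChain (fun a b => ¬ D.Inv a b) :=
    List.isChain_iff_forall_rel_of_append_cons_cons.2 fun a b u v e hi => h ⟨u, a, b, v, e, hi⟩
  have : IsTrans I (fun a b => ¬ D.Inv a b) := ⟨fun a b c h1 h2 h3 => by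
    simp only [Inv, not_or, not_lt, not_and] at h1 h2
    rcases h3 with h3 | ⟨rfl, h3⟩
    · exact absurd (h1.1.trans h2.1) (not_le.2 h3)
    · exact h1.2 (le_antisymm h1.1 h2.1) h3⟩
  have hp : w.Pairwise (fun a b => ¬ D.Inv a b) := List.isChain_iff_pairwise.1 hc
  refine ⟨hp, fun a ha hb => ?_⟩
  rcases List.eq_nil_or_concat w with rfl | ⟨u, z, rfl⟩
  · simp at ha
  · apply hw
    refine ⟨u, z, by simp, ?_⟩
    rw [List.concat_eq_append] at ha hp
    rcases List.mem_append.1 ha with ha | ha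
    · have := (List.pairwise_append.1 hp).2.2 a ha z (by simp)
      simp only [Inv, not_or, not_lt] at this
      exact D.bd_mono _ _ this.1 hb
    · obtain rfl : a = z := by simpa using ha
      exact hb

theorem nf_of_std {w : List I} (hw : D.Std w) : D.nf w = single w 1 := by
  rcases D.nf_cases w (by
    rintro ⟨u, b, rfl, hb⟩
    exact hw.2 b (by simp) hb) with ⟨u, a, b, v, rfl, hab, -⟩ | ⟨-, h⟩
  · have := (List.pairwise_append.1 hw.1).2.1
    simp only [List.pairwise_cons] at this
    exact absurd hab (this.1 b (by simp))
  · exact h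

/-! ### The action of the letters on normal forms, and gradings. -/

/-- Induction along the rewriting of words. -/
theorem word_induction {P : List I → Prop} (last : ∀ u b, D.bd b → P u → P (u ++ [b]))
    (swap : ∀ u a b v, b < a → P (u ++ b :: a :: v) →
      (∀ k, P (u ++ k :: v)) → P (u ++ a :: b :: v))
    (square : ∀ u a v, D.odd a = true → P (u ++ a :: a :: v))
    (std : ∀ w, D.Std w → P w) (w : List I) : P w := by
  refine (smaller_wf (I := I)).induction w fun w ih => ?_
  by_cases hw : ∃ (u : List I) (b : I), w = u ++ [b] ∧ D.bd b
  · obtain ⟨u, b, rfl, hb⟩ := hw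
    exact last u b hb (ih u (Or.inl (by simp)))
  by_cases h : ∃ (u : List I) (a b : I) (v : List I), w = u ++ a :: b :: v ∧ D.Inv a b
  · obtain ⟨u, a, b, v, rfl, hab | ⟨rfl, ha⟩⟩ := h
    · refine swap u a b v hab (ih _ (Or.inr ⟨by simp, inversions_swap_lt u v hab⟩)) fun k =>
        ih _ (Or.inl (by simp))
    · exact square u a v ha
  · exact std w (D.std_of_not_inv hw h)

/-- The action of a letter on linear combinations of words. -/
noncomputable def ρ (x : I) : (List I →₀ ℂ) →ₗ[ℂ] (List I →₀ ℂ) :=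
  linearCombination ℂ fun w => D.nf (x :: w)

theorem ρ_single (x : I) (w : List I) : D.ρ x (single w 1) = D.nf (x :: w) := by
  simp [ρ]

/-- Every rewriting of w is also a rewriting of x followed by w, so by confluence w may be
normalised first. -/
theorem ρ_nf (x : I) (w : List I) : D.ρ x (D.nf w) = D.nf (x :: w) := by
  induction w using D.word_induction with
  | last u b hb ih =>
    rw [nf_append_bd _ _ hb, map_smul, ih, ← List.cons_append, nf_append_bd _ _ hb]
  | swap u a b v hab ih1 ih2 =>
    rw [nf_exchange, map_add, map_smul, ih1, linearCombination_comp_apply,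
      linearCombination_congr fun k _ => ih2 k]
    exact (D.nf_exchange (x :: u) a b v).symm
  | square u a v ha =>
    rw [nf_square _ _ _ ha, map_zero, ← List.cons_append, nf_square _ _ _ ha]
  | std w hw => rw [nf_of_std _ hw, ρ_single]

theorem ρ_exchange (a b : I) (s : List I →₀ ℂ) :
    D.ρ a (D.ρ b s) = D.sgn a b • D.ρ b (D.ρ a s) +
      linearCombination ℂ (fun k => D.ρ k s) (D.br a b) := by
  induction s using Finsupp.induction_linear with
  | zero => simp [linearCombination_apply]
  | add s t hs ht =>
    simp only [map_add, hs, ht, smul_add, linearCombination_add_fun]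
    abel
  | single w z =>
    have : single w z = z • single w 1 := by simp
    rw [this]
    simp only [map_smul, ρ_single, ρ_nf, linearCombination_smul_fun]
    rw [smul_comm _ z, ← smul_add]
    exact congrArg _ (D.nf_exchange [] a b w)

/-- Rewriting preserves any additive degree respected by the bracket, provided that letters removed
with a nonzero scalar have degree zero. This is applied to the mode, the weight and the bidegree. -/
theorem nf_support {A : Type} [AddCommMonoid A] (d : I → A)
    (hbr : ∀ a b k, D.br a b k ≠ 0 → d k = d a + d b)
    (hχ : ∀ b, D.bd b → D.χ b ≠ 0 → d b = 0) (w : List I) :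
    ∀ w', D.nf w w' ≠ 0 → D.Std w' ∧ (w'.map d).sum = (w.map d).sum := by
  induction w using D.word_induction with
  | last u b hb ih =>
    intro w' hw'
    rw [nf_append_bd _ _ hb, Finsupp.smul_apply, smul_eq_mul] at hw'
    obtain ⟨h1, h2⟩ := ih w' (right_ne_zero_of_mul hw')
    refine ⟨h1, ?_⟩
    simp [h2, hχ b hb (left_ne_zero_of_mul hw')]
  | swap u a b v hab ih1 ih2 =>
    intro w' hw'
    rw [nf_exchange, Finsupp.add_apply, Finsupp.smul_apply] at hw'
    by_cases h1 : D.nf (u ++ b :: a :: v) w' = 0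
    · rw [h1, smul_zero, zero_add, linearCombination_apply, Finsupp.sum, finsetSum_apply] at hw'
      obtain ⟨k, hk, hk'⟩ := Finset.exists_ne_zero_of_sum_ne_zero hw'
      rw [Finsupp.smul_apply] at hk'
      have hk := mem_support_iff.1 hk
      obtain ⟨h3, h4⟩ := ih2 k w' (right_ne_zero_of_mul hk')
      refine ⟨h3, h4.trans ?_⟩
      simp [hbr a b k hk, add_assoc]
    · obtain ⟨h3, h4⟩ := ih1 w' h1
      refine ⟨h3, h4.trans ?_⟩
      simp [add_left_comm]
  | square u a v ha =>
    intro w' hw'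
    simp [nf_square _ _ _ ha] at hw'
  | std w hw =>
    intro w' hw'
    rw [nf_of_std _ hw, single_apply] at hw'
    split_ifs at hw' with h
    · subst h
      exact ⟨hw, rfl⟩
    · simp at hw'

end HWData

/-! ### The superconformal bracket, its leading part, and the two highest weight modules. -/

namespace TopN2

/-- The position of a generator in the ordering of the factors of a term. -/
def Gen.cls : Gen → ℕ
  | .L m => if m ≤ -2 then 0 else if m = -1 then 4 else 9
  | .H m => if m ≤ -1 then 1 else 10
  | .G m => if m ≤ -2 then 2 else if m = -1 then 5 else if m = 0 then 7 else 11
  | .Q m => if m ≤ -2 then 3 else if m = -1 then 6 else if m = 0 then 8 else 12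
  | .C => 13

/-- The index of a generator. -/
def Gen.mode : Gen → ℤ
  | .L m => m
  | .H m => m
  | .G m => m
  | .Q m => m
  | .C => 0

/-- The sort key of a generator. -/
def Gen.key (x : Gen) : ℕ ×ₗ ℤ := toLex (x.cls, x.mode)

theorem Gen.key_injective : Function.Injective Gen.key := by
  intro x y h
  simp only [Gen.key, EmbeddingLike.apply_eq_iff_eq, Prod.mk.injEq] at h
  obtain ⟨h1, h2⟩ := h
  cases x <;> cases y <;> simp only [Gen.cls, Gen.mode] at h1 h2 <;> (try subst h2) <;>
    first | rfl | (exfalso; split_ifs at h1 <;> omega)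

/-- The order makes the factors of a term, read from left to right, increasing: first by class, then
by mode inside a class. -/
noncomputable instance : LinearOrder Gen := LinearOrder.lift' Gen.key Gen.key_injective

theorem Gen.lt_iff {x y : Gen} : x < y ↔ x.cls < y.cls ∨ (x.cls = y.cls ∧ x.mode < y.mode) := by
  change x.key < y.key ↔ _
  rw [Gen.key, Gen.key, Prod.Lex.toLex_lt_toLex]

theorem Gen.cls_le {x y : Gen} (h : x ≤ y) : x.cls ≤ y.cls := by
  rcases h.lt_or_eq with h | rfl
  · rcases Gen.lt_iff.1 h with h | h
    · exact h.le
    · exact h.1.le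
  · exact le_rfl

/-- The parity of a generator. -/
def Gen.odd : Gen → Bool
  | .G _ => true
  | .Q _ => true
  | _ => false

/-- The Kronecker symbol `δ_{k,0}`. -/
def delta (k : ℤ) : ℂ := if k = 0 then 1 else 0

theorem delta_mul (k : ℤ) : delta k * k = 0 := by
  by_cases h : k = 0 <;> simp [delta, h]

/-- A generator as a basis vector. -/
noncomputable def e (x : Gen) : Gen →₀ ℂ := single x 1

theorem linearCombination_e {M : Type} [AddCommGroup M] [Module ℂ M] (φ : Gen → M) (x : Gen) :
    linearCombination ℂ φ (e x) = φ x := by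
  simp [e]

/-- The structure constants of the topological `N = 2` superconformal algebra. -/
noncomputable def bracket : Gen → Gen → Gen →₀ ℂ
  | .L m, .L n => ((m : ℂ) - n) • e (.L (m + n))
  | .H m, .H n => ((m : ℂ) / 3 * delta (m + n)) • e .C
  | .L m, .G n => ((m : ℂ) - n) • e (.G (m + n))
  | .G m, .L n => ((m : ℂ) - n) • e (.G (m + n))
  | .H m, .G n => e (.G (m + n))
  | .G m, .H n => (-1 : ℂ) • e (.G (m + n))
  | .L m, .Q n => (-(n : ℂ)) • e (.Q (m + n))
  | .Q m, .L n => (m : ℂ) • e (.Q (m + n))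
  | .H m, .Q n => (-1 : ℂ) • e (.Q (m + n))
  | .Q m, .H n => e (.Q (m + n))
  | .L m, .H n => (-(n : ℂ)) • e (.H (m + n)) +
      (((m : ℂ) ^ 2 + m) / 6 * delta (m + n)) • e .C
  | .H m, .L n => (m : ℂ) • e (.H (m + n)) +
      (-((n : ℂ) ^ 2 + n) / 6 * delta (m + n)) • e .C
  | .G m, .Q n => (2 : ℂ) • e (.L (m + n)) + (-2 * (n : ℂ)) • e (.H (m + n)) +
      (((m : ℂ) ^ 2 + m) / 3 * delta (m + n)) • e .C
  | .Q m, .G n => (2 : ℂ) • e (.L (m + n)) + (-2 * (m : ℂ)) • e (.H (m + n)) +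
      (((n : ℂ) ^ 2 + n) / 3 * delta (m + n)) • e .C
  | _, _ => 0

/-- The part of `bracket` of highest weight, where `L_{-1}` has weight two, the other `L`, and `G`,
`Q` have weight one, and `H` and `C` have weight zero. -/
noncomputable def topBracket : Gen → Gen → Gen →₀ ℂ
  | .L m, .L n => (if m = -1 ∨ n = -1 then 0 else ((m : ℂ) - n) * delta (m + n + 1)) • e (.L (-1))
  | .H m, .H n => ((m : ℂ) / 3 * delta (m + n)) • e .C
  | .H m, .G n => e (.G (m + n))
  | .G m, .H n => (-1 : ℂ) • e (.G (m + n))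
  | .H m, .Q n => (-1 : ℂ) • e (.Q (m + n))
  | .Q m, .H n => e (.Q (m + n))
  | .G m, .Q n => (2 * delta (m + n + 1)) • e (.L (-1))
  | .Q m, .G n => (2 * delta (m + n + 1)) • e (.L (-1))
  | _, _ => 0

theorem bracket_symm (a b : Gen) :
    bracket b a = -(superSign a.odd b.odd) • bracket a b := by
  cases a <;> cases b <;> simp only [bracket, Gen.odd, superSign, Bool.and_self, Bool.and_false,
    Bool.false_and, if_true, if_false, smul_zero, Bool.false_eq_true] <;>
    (try rename_i m n; rw [add_comm n m]) <;> try module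
  have h := delta_mul (m + n)
  push_cast at h
  match_scalars
  linear_combination (1 / 3 : ℂ) * h

theorem topBracket_symm (a b : Gen) :
    topBracket b a = -(superSign a.odd b.odd) • topBracket a b := by
  cases a <;> cases b <;> simp only [topBracket, Gen.odd, superSign, Bool.and_self, Bool.and_false,
    Bool.false_and, if_true, if_false, smul_zero, Bool.false_eq_true] <;>
    (try rename_i m n; rw [add_comm n m]) <;> try module
  · by_cases h1 : m = -1 <;> by_cases h2 : n = -1 <;> simp only [h1, h2, true_or, or_true, if_true,
      or_self, if_false] <;> module
  · have h := delta_mul (m + n)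
    push_cast at h
    match_scalars
    linear_combination (1 / 3 : ℂ) * h

set_option maxHeartbeats 2000000 in
theorem bracket_jacobi (x y z : Gen) : linearCombination ℂ (bracket x) (bracket y z) =
    linearCombination ℂ (fun k => bracket k z) (bracket x y) +
      superSign x.odd y.odd • linearCombination ℂ (bracket y) (bracket x z) := by
  cases x <;> cases y <;> cases z <;>
    simp only [bracket, Gen.odd, superSign, Bool.and_self, Bool.and_false, Bool.false_and, if_true,
      if_false, Bool.false_eq_true, map_add, map_smul, map_zero, linearCombination_e, smul_zero,
      add_zero, zero_add, Int.cast_add] <;>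
    simp only [add_assoc (G := ℤ), add_left_comm (G := ℤ)] <;>
    try module
  all_goals
    rename_i m n p
    -- What survives `ring1` is the central part, carrying δ_{m+n+p,0}: either this symbol vanishes
    -- or p = -m-n can be substituted.
    have hd := delta_mul (m + n + p)
    match_scalars <;> try ring1
    rcases mul_eq_zero.1 hd with h | h
    · simp only [add_assoc] at h
      simp only [h]
      ring1
    · push_cast at h
      have hp : (p : ℂ) = -m - n := by linear_combination h
      rw [hp]
      ring1

set_option maxHeartbeats 2000000 in
theorem topBracket_jacobi (x y z : Gen) : linearCombination ℂ (topBracket x) (topBracket y z) =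
    linearCombination ℂ (fun k => topBracket k z) (topBracket x y) +
      superSign x.odd y.odd • linearCombination ℂ (topBracket y) (topBracket x z) := by
  cases x <;> cases y <;> cases z <;>
    simp only [topBracket, Gen.odd, superSign, Bool.and_self, Bool.and_false, Bool.false_and,
      if_true, true_or, or_true,
      if_false, Bool.false_eq_true, map_smul, map_zero, linearCombination_e, smul_zero,
      zero_smul, add_zero, zero_add] <;>
    simp only [add_assoc (G := ℤ), add_left_comm (G := ℤ)] <;>
    try module

end TopN2

namespace TopN2

theorem apply_ne_zero_of_add {f g : Gen →₀ ℂ} {k : Gen} (h : (f + g) k ≠ 0) :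
    f k ≠ 0 ∨ g k ≠ 0 := by
  by_contra! h'
  exact h (by simp [h'.1, h'.2])

theorem smul_e_apply_ne_zero {z : ℂ} {x k : Gen} (h : (z • e x) k ≠ 0) : z ≠ 0 ∧ k = x := by
  simp only [e, Finsupp.smul_apply, single_apply, smul_eq_mul] at h
  split_ifs at h with h' <;> simp_all

theorem e_apply_ne_zero {x k : Gen} (h : e x k ≠ 0) : k = x := by
  simp only [e, single_apply] at h
  split_ifs at h with h' <;> simp_all

/-- The charge of a generator. -/
def Gen.charge : Gen → ℤ
  | .G _ => 1
  | .Q _ => -1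
  | _ => 0

/-- The weight of a generator, by which the algebra is filtered. -/
def Gen.weight : Gen → ℕ
  | .L m => if m = -1 then 2 else 1
  | .G _ => 1
  | .Q _ => 1
  | _ => 0

theorem eq_zero_of_delta_ne_zero {z : ℂ} {k : ℤ} (h : z * delta k ≠ 0) : k = 0 := by
  by_contra h'
  simp [delta, h'] at h

/-- The bidegree of a generator: its mode and its charge. -/
def Gen.deg (x : Gen) : ℤ × ℤ := (x.mode, x.charge)

theorem bracket_apply_ne_zero {a b k : Gen} (h : bracket a b k ≠ 0) :
    k.odd = xor a.odd b.odd ∧ k.deg = a.deg + b.deg := by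
  cases a <;> cases b <;> simp only [bracket] at h <;>
    first
    | exact absurd rfl h
    | (obtain rfl := e_apply_ne_zero h; simp [Gen.odd, Gen.deg, Gen.mode, Gen.charge])
    | (obtain ⟨h1, rfl⟩ := smul_e_apply_ne_zero h
       first
       | simp [Gen.odd, Gen.deg, Gen.mode, Gen.charge]; done
       | simp [Gen.odd, Gen.deg, Gen.mode, Gen.charge, eq_zero_of_delta_ne_zero h1])
    | (rcases apply_ne_zero_of_add h with h | h
       · first
         | (obtain ⟨h1, rfl⟩ := smul_e_apply_ne_zero h
            simp [Gen.odd, Gen.deg, Gen.mode, Gen.charge])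
         | (rcases apply_ne_zero_of_add h with h | h <;>
            obtain ⟨h1, rfl⟩ := smul_e_apply_ne_zero h <;>
            simp [Gen.odd, Gen.deg, Gen.mode, Gen.charge])
       · obtain ⟨h1, rfl⟩ := smul_e_apply_ne_zero h
         simp [Gen.odd, Gen.deg, Gen.mode, Gen.charge, eq_zero_of_delta_ne_zero h1])

theorem topBracket_apply_ne_zero {a b k : Gen} (h : topBracket a b k ≠ 0) :
    k.odd = xor a.odd b.odd ∧ k.deg = a.deg + b.deg ∧ k.weight = a.weight + b.weight := by
  cases a <;> cases b <;> simp only [topBracket] at h <;>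
    first
    | exact absurd rfl h
    | (obtain rfl := e_apply_ne_zero h; simp [Gen.odd, Gen.deg, Gen.mode, Gen.charge, Gen.weight])
    | (obtain ⟨h1, rfl⟩ := smul_e_apply_ne_zero h
       first
       | simp [Gen.odd, Gen.deg, Gen.mode, Gen.charge, Gen.weight]; done
       | (have h2 := eq_zero_of_delta_ne_zero h1
          simp [Gen.odd, Gen.deg, Gen.mode, Gen.charge, Gen.weight]; omega)
       | simp [Gen.odd, Gen.deg, Gen.mode, Gen.charge, Gen.weight, eq_zero_of_delta_ne_zero h1]
       | (split_ifs at h1 with h2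
          · exact absurd rfl h1
          · have h3 := eq_zero_of_delta_ne_zero h1
            rw [not_or] at h2
            simp [Gen.odd, Gen.deg, Gen.mode, Gen.charge, Gen.weight, h2]; omega))

theorem Gen.one_le_weight_L (m : ℤ) : 1 ≤ (Gen.L m).weight := by
  simp only [Gen.weight]; split_ifs <;> omega

theorem Gen.weight_L_of_ne {m : ℤ} (h : m ≠ -1) : (Gen.L m).weight = 1 := by
  simp [Gen.weight, h]

theorem weight_lt_of_acomm_sub {m n : ℤ} {u v : Gen →₀ ℂ} {k : Gen}
    (h : ((2 : ℂ) • e (.L (m + n)) + u + v - (2 * delta (m + n + 1)) • e (.L (-1))) k ≠ 0)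
    (hu : ∀ k, u k ≠ 0 → k.weight = 0) (hv : ∀ k, v k ≠ 0 → k.weight = 0) : k.weight < 2 := by
  by_cases hmn : m + n = -1
  · rw [hmn, show delta (-1 + 1) = 1 by simp [delta], mul_one, add_assoc, add_sub_cancel_left] at h
    rcases apply_ne_zero_of_add h with h | h
    · rw [hu k h]; omega
    · rw [hv k h]; omega
  · rw [show delta (m + n + 1) = 0 by rw [delta, if_neg (by omega)], mul_zero, zero_smul,
      sub_zero] at h
    rcases apply_ne_zero_of_add h with h | h
    · rcases apply_ne_zero_of_add h with h | h
      · obtain ⟨-, rfl⟩ := smul_e_apply_ne_zero h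
        rw [Gen.weight_L_of_ne hmn]; omega
      · rw [hu k h]; omega
    · rw [hv k h]; omega

/-- This makes `topBracket` the bracket of the associated graded algebra: what it omits has strictly
smaller weight. -/
theorem weight_lt_of_bracket_sub {a b k : Gen} (h : (bracket a b - topBracket a b) k ≠ 0) :
    k.weight < a.weight + b.weight := by
  have hG : ∀ m, (Gen.G m).weight = 1 := fun _ => rfl
  have hQ : ∀ m, (Gen.Q m).weight = 1 := fun _ => rfl
  have hH : ∀ m, (Gen.H m).weight = 0 := fun _ => rfl
  have hC : Gen.C.weight = 0 := rfl
  cases a <;> cases b <;>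
    simp only [bracket, topBracket, sub_self, sub_zero, Finsupp.coe_zero, Pi.zero_apply, ne_eq,
      not_true_eq_false] at h
  case G.Q | Q.G =>
    exact weight_lt_of_acomm_sub h
      (fun k hk => by obtain ⟨-, rfl⟩ := smul_e_apply_ne_zero hk; rfl)
      (fun k hk => by obtain ⟨-, rfl⟩ := smul_e_apply_ne_zero hk; rfl)
  case L.H m n | H.L n m =>
    have := Gen.one_le_weight_L m
    rcases apply_ne_zero_of_add h with h | h <;> obtain ⟨h1, rfl⟩ := smul_e_apply_ne_zero h <;>
      simp only [hH, hC] <;> omega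
  case L.G m n | G.L n m | L.Q m n | Q.L n m =>
    have := Gen.one_le_weight_L m
    obtain ⟨h1, rfl⟩ := smul_e_apply_ne_zero h
    simp only [hG, hQ]
    omega
  rename_i m n
  by_cases hm : m = -1 ∨ n = -1
  · rw [if_pos hm, zero_smul, sub_zero] at h
    obtain ⟨h1, rfl⟩ := smul_e_apply_ne_zero h
    have h3 : m ≠ n := by rintro rfl; simp at h1
    simp only [Gen.weight]
    split_ifs <;> omega
  · rw [if_neg hm] at h
    rw [not_or] at hm
    rw [Gen.weight_L_of_ne hm.1, Gen.weight_L_of_ne hm.2]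
    by_cases hmn : m + n = -1
    · rw [hmn, show delta (-1 + 1) = 1 by simp [delta], mul_one, sub_self] at h
      exact absurd rfl h
    · rw [show delta (m + n + 1) = 0 by rw [delta, if_neg (by omega)], mul_zero, zero_smul,
        sub_zero] at h
      obtain ⟨-, rfl⟩ := smul_e_apply_ne_zero h
      rw [Gen.weight_L_of_ne hmn]
      omega

/-- The eigenvalue of a generator on the highest weight vector. -/
def hwChar (c q : ℂ) : Gen → ℂ
  | .H m => if m = 0 then q else 0
  | .C => c
  | _ => 0

/-- Class 9 is the threshold for acting by a scalar on the highest weight vector of the Verma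
module; the threshold 7 below, for the Fock module, adds G_0 and Q_0. -/
theorem cls_L {m : ℤ} : 9 ≤ (Gen.L m).cls ↔ 0 ≤ m := by
  simp only [Gen.cls]; split_ifs <;> omega

theorem cls_H {m : ℤ} : 9 ≤ (Gen.H m).cls ↔ 0 ≤ m := by
  simp only [Gen.cls]; split_ifs <;> omega

theorem cls_G {m : ℤ} : 9 ≤ (Gen.G m).cls ↔ 1 ≤ m := by
  simp only [Gen.cls]; split_ifs <;> omega

theorem cls_Q {m : ℤ} : 9 ≤ (Gen.Q m).cls ↔ 1 ≤ m := by
  simp only [Gen.cls]; split_ifs <;> omega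

theorem cls_C : 9 ≤ Gen.C.cls := by decide

theorem cls_L' {m : ℤ} : 7 ≤ (Gen.L m).cls ↔ 0 ≤ m := by
  simp only [Gen.cls]; split_ifs <;> omega

theorem cls_H' {m : ℤ} : 7 ≤ (Gen.H m).cls ↔ 0 ≤ m := by
  simp only [Gen.cls]; split_ifs <;> omega

theorem cls_G' {m : ℤ} : 7 ≤ (Gen.G m).cls ↔ 0 ≤ m := by
  simp only [Gen.cls]; split_ifs <;> omega

theorem cls_Q' {m : ℤ} : 7 ≤ (Gen.Q m).cls ↔ 0 ≤ m := by
  simp only [Gen.cls]; split_ifs <;> omega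

theorem cls_C' : 7 ≤ Gen.C.cls := by decide

theorem bracket_self (a : Gen) : bracket a a = 0 := by
  cases a <;> simp only [bracket]
  · simp
  · rename_i m
    have : (m : ℂ) / 3 * delta (m + m) = 0 := by
      by_cases h : m + m = 0
      · have : m = 0 := by omega
        simp [this]
      · simp [delta, h]
    rw [this, zero_smul]

theorem topBracket_self (a : Gen) : topBracket a a = 0 := by
  cases a <;> simp only [topBracket]
  · simp
  · rename_i m
    have : (m : ℂ) / 3 * delta (m + m) = 0 := by
      by_cases h : m + m = 0
      · have : m = 0 := by omega
        simp [this]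
      · simp [delta, h]
    rw [this, zero_smul]

theorem bracket_upper {a b k : Gen} (ha : 9 ≤ a.cls) (hb : 9 ≤ b.cls) (h : bracket a b k ≠ 0) :
    9 ≤ k.cls := by
  have h2 := congrArg Prod.fst (bracket_apply_ne_zero h).2
  have h1 := (bracket_apply_ne_zero h).1
  simp only [Gen.deg, Prod.fst_add] at h2
  cases k <;> cases a <;> cases b <;>
    simp only [cls_L, cls_H, cls_G, cls_Q, cls_C, Gen.mode, Gen.odd, Bool.xor_false,
      Bool.xor_self, Bool.xor_true, Bool.not_false, Bool.true_eq_false,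
      Bool.false_eq_true] at * <;>
    omega

theorem topBracket_upper {a b k : Gen} (ha : 7 ≤ a.cls) (hb : 7 ≤ b.cls)
    (h : topBracket a b k ≠ 0) : 7 ≤ k.cls := by
  have h2 := congrArg Prod.fst (topBracket_apply_ne_zero h).2.1
  simp only [Gen.deg, Prod.fst_add] at h2
  cases k <;> cases a <;> cases b <;>
    simp only [cls_L', cls_H', cls_G', cls_Q', cls_C', Gen.mode] at * <;>
    omega

/-- The modes are nonnegative, so a central term could occur only at m = n = 0, where its
coefficient vanishes. -/
theorem hwChar_bracket (c q : ℂ) {a b : Gen} (ha : 9 ≤ a.cls) (hb : 9 ≤ b.cls) :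
    linearCombination ℂ (hwChar c q) (bracket a b) = 0 := by
  cases a <;> cases b <;>
    simp only [cls_L, cls_H, cls_G, cls_Q, cls_C, bracket, map_add, map_smul, map_zero,
      linearCombination_e, hwChar, smul_zero, zero_add] at *
  all_goals rename_i m n
  all_goals by_cases h : m = 0 ∧ n = 0
  · simp [h]
  all_goals try simp [h]
  all_goals
    have h' : m + n ≠ 0 := by omega
    simp [h', delta]

theorem hwChar_topBracket (c q : ℂ) {a b : Gen} (ha : 7 ≤ a.cls) (hb : 7 ≤ b.cls) :
    linearCombination ℂ (hwChar c q) (topBracket a b) = 0 := by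
  cases a <;> cases b <;>
    simp only [cls_L', cls_H', cls_G', cls_Q', cls_C', topBracket, map_smul, map_zero,
      linearCombination_e, hwChar, smul_zero] at *
  rename_i m n
  by_cases h : m + n = 0
  · obtain ⟨rfl, rfl⟩ : m = 0 ∧ n = 0 := by omega
    simp
  · simp [h, delta]

theorem hwChar_odd (c q : ℂ) {a : Gen} (h : a.odd = true) : hwChar c q a = 0 := by
  cases a <;> simp_all [Gen.odd, hwChar]

/-- The superconformal algebra with the highest weight `(0, q)` and central charge `c`. -/
noncomputable def verma (c q : ℂ) : HWData Gen where
  odd := Gen.odd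
  br := bracket
  bd x := 9 ≤ x.cls
  χ := hwChar c q
  br_parity _ _ _ h := (bracket_apply_ne_zero h).1
  br_symm := bracket_symm
  br_self := bracket_self
  jacobi := bracket_jacobi
  bd_mono _ _ h h' := h'.trans (Gen.cls_le h)
  bd_br _ _ _ := bracket_upper
  χ_odd _ _ := hwChar_odd c q
  χ_br _ _ := hwChar_bracket c q

/-- The algebra with bracket `topBracket`, and a highest weight vector that `G_0` and `Q_0`
annihilate as well. -/
noncomputable def fock (c q : ℂ) : HWData Gen where
  odd := Gen.odd
  br := topBracket
  bd x := 7 ≤ x.cls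
  χ := hwChar c q
  br_parity _ _ _ h := (topBracket_apply_ne_zero h).1
  br_symm := topBracket_symm
  br_self := topBracket_self
  jacobi := topBracket_jacobi
  bd_mono _ _ h h' := h'.trans (Gen.cls_le h)
  bd_br _ _ _ := topBracket_upper
  χ_odd _ _ := hwChar_odd c q
  χ_br _ _ := hwChar_topBracket c q

end TopN2

/-! ### Separating operators of distinct degrees. -/

namespace HWData

variable {I : Type} [LinearOrder I] (D : HWData I)

theorem nf_nil : D.nf [] = single [] 1 :=
  D.nf_of_std ⟨List.Pairwise.nil, by simp⟩

theorem ρ_apply_eq_sum (x : I) (s : List I →₀ ℂ) (w' : List I) :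
    D.ρ x s w' = s.sum fun w z => z * D.nf (x :: w) w' := by
  rw [ρ, linearCombination_apply, Finsupp.sum, finsetSum_apply]
  rfl

theorem ρ_support {A : Type} [AddCommMonoid A] (d : I → A)
    (hbr : ∀ a b k, D.br a b k ≠ 0 → d k = d a + d b)
    (hχ : ∀ b, D.bd b → D.χ b ≠ 0 → d b = 0) {s : List I →₀ ℂ} {t : A}
    (hs : ∀ w, s w ≠ 0 → (w.map d).sum = t) (x : I) :
    ∀ w', D.ρ x s w' ≠ 0 → D.Std w' ∧ (w'.map d).sum = d x + t := by
  intro w' hw'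
  rw [ρ_apply_eq_sum] at hw'
  obtain ⟨w, hw, hne⟩ := Finset.exists_ne_zero_of_sum_ne_zero hw'
  obtain ⟨h1, h2⟩ := D.nf_support d hbr hχ (x :: w) w' (right_ne_zero_of_mul hne)
  exact ⟨h1, by rw [h2, List.map_cons, List.sum_cons, hs w (mem_support_iff.1 hw)]⟩

/-- A sum of letters of distinct degrees annihilates a homogeneous vector only if each of the
letters does. -/
theorem ρ_eq_zero_of_sum {A : Type} [AddCancelCommMonoid A] (d : I → A)
    (hbr : ∀ a b k, D.br a b k ≠ 0 → d k = d a + d b)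
    (hχ : ∀ b, D.bd b → D.χ b ≠ 0 → d b = 0) {s : List I →₀ ℂ} {t : A}
    (hs : ∀ w, s w ≠ 0 → (w.map d).sum = t) {F : Finset I} (hF : Set.InjOn d F)
    (h : ∑ x ∈ F, D.ρ x s = 0) {x : I} (hx : x ∈ F) : D.ρ x s = 0 := by
  ext w'
  by_contra hne
  have h1 := (D.ρ_support d hbr hχ hs x w' hne).2
  have h2 := DFunLike.congr_fun h w'
  rw [finsetSum_apply, Finset.sum_eq_single_of_mem x hx] at h2
  · exact hne h2
  · intro y hy hyx
    by_contra hne'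
    have h3 := (D.ρ_support d hbr hχ hs y w' hne').2
    exact hyx (hF hy hx (add_right_cancel (h3.symm.trans h1)))

end HWData

/-! ### The enveloping algebra acts on words. -/

namespace TopN2

variable (c q : ℂ)

theorem verma_ρ_exchange (a b : Gen) (s : List Gen →₀ ℂ) :
    (verma c q).ρ a ((verma c q).ρ b s) =
      superSign a.odd b.odd • (verma c q).ρ b ((verma c q).ρ a s) +
        linearCombination ℂ (fun k => (verma c q).ρ k s) (bracket a b) :=
  (verma c q).ρ_exchange a b s

theorem fock_ρ_exchange (a b : Gen) (s : List Gen →₀ ℂ) :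
    (fock c q).ρ a ((fock c q).ρ b s) =
      superSign a.odd b.odd • (fock c q).ρ b ((fock c q).ρ a s) +
        linearCombination ℂ (fun k => (fock c q).ρ k s) (topBracket a b) :=
  (fock c q).ρ_exchange a b s

theorem lift_rel {x y : FreeAlgebra ℂ Gen} (h : Rel x y) :
    FreeAlgebra.lift ℂ (fun x => ((verma c q).ρ x : Module.End ℂ (List Gen →₀ ℂ))) x =
      FreeAlgebra.lift ℂ (fun x => ((verma c q).ρ x : Module.End ℂ (List Gen →₀ ℂ))) y := by
  refine LinearMap.ext fun s => ?_
  cases h <;>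
    simp only [comm, acomm, gen, map_add, map_sub, map_mul, map_smul, map_neg, map_zero,
      FreeAlgebra.lift_ι_apply, Module.End.mul_apply, LinearMap.sub_apply, LinearMap.add_apply,
      LinearMap.smul_apply, LinearMap.neg_apply, LinearMap.zero_apply]
  case central x =>
    rw [verma_ρ_exchange c q .C x]
    cases x <;> simp [bracket, superSign, Gen.odd]
  all_goals
    rename_i m n
  case LL => rw [verma_ρ_exchange]; simp [bracket, superSign, Gen.odd, linearCombination_e]
  case HH =>
    rw [verma_ρ_exchange]
    by_cases h : m + n = 0 <;> simp [bracket, superSign, Gen.odd, linearCombination_e, delta, h]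
  case LG => rw [verma_ρ_exchange]; simp [bracket, superSign, Gen.odd, linearCombination_e]
  case HG => rw [verma_ρ_exchange]; simp [bracket, superSign, Gen.odd, linearCombination_e]
  case LQ => rw [verma_ρ_exchange]; simp [bracket, superSign, Gen.odd, linearCombination_e]
  case HQ => rw [verma_ρ_exchange]; simp [bracket, superSign, Gen.odd, linearCombination_e]
  case LH =>
    rw [verma_ρ_exchange]
    by_cases h : m + n = 0 <;> simp [bracket, superSign, Gen.odd, linearCombination_e, delta, h]
  case GQ =>
    rw [verma_ρ_exchange]
    by_cases h : m + n = 0 <;>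
      simp [bracket, superSign, Gen.odd, linearCombination_e, delta, h, sub_eq_add_neg]
  case GG => rw [verma_ρ_exchange]; simp [bracket, superSign, Gen.odd]
  case QQ => rw [verma_ρ_exchange]; simp [bracket, superSign, Gen.odd]

/-- The action of the enveloping algebra on linear combinations of words. -/
noncomputable def rep : U →ₐ[ℂ] Module.End ℂ (List Gen →₀ ℂ) :=
  RingQuot.liftAlgHom ℂ ⟨FreeAlgebra.lift ℂ fun x => (verma c q).ρ x, fun _ _ => lift_rel c q⟩

theorem rep_op (x : Gen) : rep c q (op x) = (verma c q).ρ x := by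
  rw [rep, op, RingQuot.liftAlgHom_mkAlgHom_apply, FreeAlgebra.lift_ι_apply]

theorem rep_prod (w : List Gen) : rep c q ((w.map op).prod) (single [] 1) = (verma c q).nf w := by
  induction w with
  | nil => simp [HWData.nf_nil]
  | cons x w ih =>
    rw [List.map_cons, List.prod_cons, map_mul, Module.End.mul_apply, ih, rep_op, HWData.ρ_nf]

theorem verma_nf_singleton {x : Gen} (hx : 9 ≤ x.cls) :
    (verma c q).nf [x] = hwChar c q x • single [] 1 := by
  have := (verma c q).nf_append_bd [] (b := x) hx
  rwa [List.nil_append, HWData.nf_nil] at this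

/-- The empty word satisfies the defining relations of the highest weight vector, so the action on
it descends to the quotient `NoLabelVerma`. -/
theorem rep_vermaIdeal {Y : U} (hY : Y ∈ vermaIdeal c q) : rep c q Y (single [] 1) = 0 := by
  induction hY using Submodule.span_induction with
  | zero => simp
  | add a b _ _ ha hb => rw [map_add, LinearMap.add_apply, ha, hb, add_zero]
  | smul a b _ hb => rw [smul_eq_mul, map_mul, Module.End.mul_apply, hb, map_zero]
  | mem Y h =>
    have key : ∀ {x : Gen}, 9 ≤ x.cls →
        rep c q (op x) (single [] 1) = hwChar c q x • single [] 1 := fun {x} hx => by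
      rw [rep_op, HWData.ρ_single, verma_nf_singleton c q hx]
    rcases h with (rfl | rfl | rfl) | ⟨j, hj, rfl | rfl | rfl | rfl⟩
    · rw [key (cls_L.2 le_rfl)]; simp [hwChar]
    · rw [map_sub, LinearMap.sub_apply, key (cls_H.2 le_rfl)]
      simp [hwChar, Module.algebraMap_end_apply]
    · rw [map_sub, LinearMap.sub_apply, key cls_C]
      simp [hwChar, Module.algebraMap_end_apply]
    · rw [key (cls_L.2 (by omega))]; simp [hwChar]
    · rw [key (cls_H.2 (by omega))]; simp [hwChar, show j ≠ 0 by omega]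
    · rw [key (cls_G.2 hj)]; simp [hwChar]
    · rw [key (cls_Q.2 hj)]; simp [hwChar]

/-- The action of the enveloping algebra on the image of the highest weight vector. -/
noncomputable def vermaToWords : NoLabelVerma c q →ₗ[ℂ] (List Gen →₀ ℂ) :=
  (((vermaIdeal c q).restrictScalars ℂ).liftQ
    ((LinearMap.applyₗ (single [] 1)).comp (rep c q).toLinearMap)
    fun Y hY => by simpa using rep_vermaIdeal c q hY).comp
    (Submodule.Quotient.restrictScalarsEquiv ℂ (vermaIdeal c q)).symm.toLinearMap

theorem vermaToWords_smul (Y : U) :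
    vermaToWords c q (Y • hwVec c q) = rep c q Y (single [] 1) := by
  have : Y • hwVec c q = Submodule.Quotient.mk Y := by
    rw [hwVec, ← Submodule.Quotient.mk_smul, smul_eq_mul, mul_one]
  rw [this]
  rfl

/-! ### Terms as standard words. -/

namespace Term

/-- The factors of a term of the given class. -/
def block (X : Term) : ℕ → List Gen
  | 0 => X.Ls.reverse.map fun z : ℕ => .L (-(z : ℤ))
  | 1 => X.Hs.reverse.map fun z : ℕ => .H (-(z : ℤ))
  | 2 => X.Gs.reverse.map fun z : ℕ => .G (-(z : ℤ))
  | 3 => X.Qs.reverse.map fun z : ℕ => .Q (-(z : ℤ))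
  | 4 => List.replicate X.k (.L (-1))
  | 5 => List.replicate X.r₁ (.G (-1))
  | 6 => List.replicate X.r₂ (.Q (-1))
  | 7 => List.replicate X.r₄ (.G 0)
  | 8 => List.replicate X.r₃ (.Q 0)
  | _ => []

/-- The factors of a term other than `G_0` and `Q_0`. -/
def body (X : Term) : List Gen := (List.range 7).flatMap X.block

/-- The factors `G_0` and `Q_0` of a term. -/
def tail (X : Term) : List Gen := X.block 7 ++ X.block 8

/-- The word of all factors of a term. -/
def word (X : Term) : List Gen := (List.range 9).flatMap X.block

theorem word_eq (X : Term) : X.word = X.body ++ X.tail := by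
  simp [word, body, tail, List.range_succ]

theorem modesOp_eq (Z : ℤ → Gen) (zs : List ℕ) :
    modesOp Z zs = (zs.reverse.map fun z : ℕ => op (Z (-(z : ℤ)))).prod := by
  have (l : List ℕ) : (l.flatMap fun a : ℕ => [(a : ℤ)]) = l.map (fun a : ℕ => (a : ℤ)) :=
    List.map_eq_flatMap.symm
  simp [modesOp, this, Function.comp_def]

theorem prod_word (X : Term) : (X.word.map op).prod = X.toU := by
  simp [word, toU, List.range_succ, block, modesOp_eq, mul_assoc, Function.comp_def]

theorem cls_of_mem_block {m : ℕ} {n : ℤ} {X : Term} (hX : X ∈ termSet m n) {i : ℕ} {x : Gen}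
    (hx : x ∈ X.block i) : x.cls = i := by
  obtain ⟨⟨-, h0⟩, ⟨-, h1⟩, ⟨-, h2⟩, ⟨-, h3⟩, -⟩ := hX
  rcases i with _ | _ | _ | _ | _ | _ | _ | _ | _ | i <;>
    simp only [block, List.mem_map, List.mem_reverse, List.mem_replicate, List.not_mem_nil] at hx
  · obtain ⟨z, hz, rfl⟩ := hx
    have := h0 z hz
    simp only [Gen.cls]; split_ifs <;> omega
  · obtain ⟨z, hz, rfl⟩ := hx
    have := h1 z hz
    simp only [Gen.cls]; split_ifs <;> omega
  · obtain ⟨z, hz, rfl⟩ := hx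
    have := h2 z hz
    simp only [Gen.cls]; split_ifs <;> omega
  · obtain ⟨z, hz, rfl⟩ := hx
    have := h3 z hz
    simp only [Gen.cls]; split_ifs <;> omega
  all_goals rw [hx.2]; rfl

theorem not_inv {a b : Gen} (h : a.cls ≤ b.cls)
    (h' : a.cls = b.cls → a.mode < b.mode ∨ (a.mode ≤ b.mode ∧ a.odd = false)) :
    ¬ (verma c q).Inv a b := by
  rintro (hba | ⟨rfl, ha⟩)
  · rcases Gen.lt_iff.1 hba with h1 | ⟨h1, h2⟩
    · omega
    · rcases h' h1.symm with h3 | ⟨h3, -⟩ <;> omega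
  · rcases h' rfl with h3 | ⟨-, h3⟩
    · exact lt_irrefl _ h3
    · exact absurd (h3.symm.trans ha) (by decide)

theorem std_word {m : ℕ} {n : ℤ} {X : Term} (hX : X ∈ termSet m n) : (verma c q).Std X.word := by
  have hc := fun i x => cls_of_mem_block hX (i := i) (x := x)
  have hlt : ∀ i, ∀ a ∈ X.block i, ∀ b ∈ X.block i, a.mode < b.mode → ¬ (verma c q).Inv a b :=
    fun i a ha b hb hm => not_inv c q (by rw [hc i a ha, hc i b hb]) fun _ => Or.inl hm
  have hle : ∀ i, ∀ a ∈ X.block i, ∀ b ∈ X.block i, a.odd = false → a.mode ≤ b.mode →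
      ¬ (verma c q).Inv a b :=
    fun i a ha b hb ho hm => not_inv c q (by rw [hc i a ha, hc i b hb]) fun _ => Or.inr ⟨hm, ho⟩
  obtain ⟨⟨h0, -⟩, ⟨h1, -⟩, ⟨h2, -⟩, ⟨h3, -⟩, h5, h6, h8, h7, -⟩ := hX
  have hrep : ∀ (r : ℕ) (x : Gen), r ≤ 1 →
      (List.replicate r x).Pairwise fun a b => ¬ (verma c q).Inv a b := by
    intro r x hr
    interval_cases r <;> simp
  refine ⟨List.pairwise_flatMap.2 ⟨fun i _ => ?_, ?_⟩, fun x hx => ?_⟩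
  · rcases i with _ | _ | _ | _ | _ | _ | _ | _ | _ | i
    · refine List.pairwise_map.2 (List.pairwise_reverse.2 (h0.imp_of_mem fun {a b} ha hb h => ?_))
      exact hle 0 _ (by simpa [block] using hb) _ (by simpa [block] using ha) rfl
        (by simpa [Gen.mode] using h)
    · refine List.pairwise_map.2 (List.pairwise_reverse.2 (h1.imp_of_mem fun {a b} ha hb h => ?_))
      exact hle 1 _ (by simpa [block] using hb) _ (by simpa [block] using ha) rfl
        (by simpa [Gen.mode] using h)
    · refine List.pairwise_map.2 (List.pairwise_reverse.2 (h2.imp_of_mem fun {a b} ha hb h => ?_))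
      exact hlt 2 _ (by simpa [block] using hb) _ (by simpa [block] using ha)
        (by simpa [Gen.mode] using h)
    · refine List.pairwise_map.2 (List.pairwise_reverse.2 (h3.imp_of_mem fun {a b} ha hb h => ?_))
      exact hlt 3 _ (by simpa [block] using hb) _ (by simpa [block] using ha)
        (by simpa [Gen.mode] using h)
    · refine List.pairwise_replicate.2 (Or.inr (not_inv c q le_rfl fun _ => Or.inr ⟨le_rfl, rfl⟩))
    · exact hrep _ _ h5
    · exact hrep _ _ h6
    · exact hrep _ _ h7
    · exact hrep _ _ h8
    · exact List.Pairwise.nil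
  · refine (List.pairwise_lt_range (n := 9)).imp fun {i j} hij x hx y hy => ?_
    refine not_inv c q ?_ ?_ <;> rw [hc i x hx, hc j y hy] <;> omega
  · obtain ⟨i, hi, hx⟩ := List.mem_flatMap.1 hx
    have := hc i x hx
    change ¬ 9 ≤ x.cls
    simp at hi
    omega

theorem filter_flatMap_range {f : ℕ → List Gen} (hf : ∀ i, ∀ x ∈ f i, x.cls = i) (n i : ℕ) :
    ((List.range n).flatMap f).filter (fun x => x.cls = i) = if i < n then f i else [] := by
  induction n with
  | zero => simp
  | succ n ih =>
    rw [List.range_succ, List.flatMap_append, List.filter_append, ih]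
    rcases lt_trichotomy i n with h | rfl | h
    · rw [if_pos h, if_pos (by omega)]
      have : (f n).filter (fun x => x.cls = i) = [] :=
        List.filter_eq_nil_iff.2 fun x hx => by simp [hf n x hx]; omega
      simp [this]
    · have : (f i).filter (fun x => x.cls = i) = f i :=
        List.filter_eq_self.2 fun x hx => by simp [hf i x hx]
      simp [this]
    · rw [if_neg (by omega), if_neg (by omega)]
      have : (f n).filter (fun x => x.cls = i) = [] :=
        List.filter_eq_nil_iff.2 fun x hx => by simp [hf n x hx]; omega
      simp [this]

/-- The class of a letter tells which block it belongs to, so filtering the word by class recovers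
every block. -/
theorem word_injective {m m' : ℕ} {n n' : ℤ} {X Y : Term} (hX : X ∈ termSet m n)
    (hY : Y ∈ termSet m' n') (h : X.word = Y.word) : X = Y := by
  have hb : ∀ i < 9, X.block i = Y.block i := fun i hi => by
    have h1 := filter_flatMap_range (fun i x => cls_of_mem_block hX) 9 i
    have h2 := filter_flatMap_range (fun i x => cls_of_mem_block hY) 9 i
    rw [if_pos hi] at h1 h2
    rw [← h1, ← h2]
    exact congrArg _ h
  have hl : ∀ (f : ℕ → Gen), Function.Injective f → ∀ s t : List ℕ,
      s.reverse.map f = t.reverse.map f → s = t := fun f hf s t h =>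
    List.reverse_injective (List.map_injective_iff.2 hf h)
  have hr : ∀ (x : Gen) (r t : ℕ), List.replicate r x = List.replicate t x → r = t :=
    fun x r t h => by simpa using congrArg List.length h
  ext1
  · exact hl _ (fun a b h => by simpa using h) _ _ (hb 0 (by omega))
  · exact hl _ (fun a b h => by simpa using h) _ _ (hb 1 (by omega))
  · exact hl _ (fun a b h => by simpa using h) _ _ (hb 2 (by omega))
  · exact hl _ (fun a b h => by simpa using h) _ _ (hb 3 (by omega))
  · exact hr _ _ _ (hb 4 (by omega))
  · exact hr _ _ _ (hb 5 (by omega))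
  · exact hr _ _ _ (hb 6 (by omega))
  · exact hr _ _ _ (hb 7 (by omega))
  · exact hr _ _ _ (hb 8 (by omega))

theorem sum_deg_map (f : ℕ → Gen) (t : ℤ) (hf : ∀ z, (f z).deg = (-(z : ℤ), t)) (l : List ℕ) :
    ((l.map f).map Gen.deg).sum = (-(l.sum : ℤ), l.length * t) := by
  induction l with
  | nil => simp [Prod.zero_eq_mk]
  | cons z l ih =>
    rw [List.map_cons, List.map_cons, List.sum_cons, ih, hf]
    ext
    · simp; ring
    · simp; ring

theorem deg_word (X : Term) : (X.word.map Gen.deg).sum = (-(X.level : ℤ), X.charge) := by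
  have h0 := sum_deg_map (fun z : ℕ => .L (-(z : ℤ))) 0 (fun _ => rfl) X.Ls.reverse
  have h1 := sum_deg_map (fun z : ℕ => .H (-(z : ℤ))) 0 (fun _ => rfl) X.Hs.reverse
  have h2 := sum_deg_map (fun z : ℕ => .G (-(z : ℤ))) 1 (fun _ => rfl) X.Gs.reverse
  have h3 := sum_deg_map (fun z : ℕ => .Q (-(z : ℤ))) (-1) (fun _ => rfl) X.Qs.reverse
  simp only [word, List.range_succ, List.range_zero, List.nil_append, List.flatMap_append,
    List.flatMap_cons, List.flatMap_nil, List.append_nil, block, List.map_append, List.sum_append,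
    h0, h1, h2, h3, List.map_replicate, List.sum_replicate, List.length_reverse, List.sum_reverse]
  ext
  · simp [Gen.deg, Gen.mode, level]; ring
  · simp [Gen.deg, Gen.charge, charge]; ring

end Term
end TopN2

/-! ### Comparison of the Verma module with the Fock module, up to lower weight. -/

namespace HWData

variable {I : Type} [LinearOrder I] (D : HWData I)

/-- The action of a word. -/
noncomputable def ρword (u : List I) : (List I →₀ ℂ) →ₗ[ℂ] (List I →₀ ℂ) :=
  u.foldr (fun x T => (D.ρ x).comp T) LinearMap.id

theorem ρword_nf (u v : List I) : D.ρword u (D.nf v) = D.nf (u ++ v) := by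
  induction u with
  | nil => rfl
  | cons x u ih =>
    change D.ρ x (D.ρword u (D.nf v)) = _
    rw [ih, ρ_nf, List.cons_append]

end HWData

namespace TopN2

variable (c q : ℂ)

/-- The products of the zero modes `G_0` and `Q_0`. -/
inductive IsTail : List Gen → Prop
  | nil : IsTail []
  | G : IsTail [.G 0]
  | Q : IsTail [.Q 0]
  | GQ : IsTail [.G 0, .Q 0]

/-- The charge of a word. -/
def wordCharge (w : List Gen) : ℤ := (w.map Gen.charge).sum

/-- The weight of a word. -/
def wordWeight (w : List Gen) : ℕ := (w.map Gen.weight).sum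

/-- The weight of a word, in which the zero modes `G_0` and `Q_0` count zero. -/
noncomputable def reducedWeight (w : List Gen) : ℕ :=
  (w.map fun x => if x = .G 0 ∨ x = .Q 0 then 0 else x.weight).sum

theorem IsTail.std {t : List Gen} (ht : IsTail t) : (verma c q).Std t := by
  cases ht <;> refine ⟨?_, ?_⟩ <;> simp [verma, Gen.cls, HWData.Inv, Gen.lt_iff]

theorem IsTail.nf_eq {t : List Gen} (ht : IsTail t) : (verma c q).nf t = single t 1 :=
  (verma c q).nf_of_std (ht.std c q)

theorem IsTail.reducedWeight_append {t : List Gen} (ht : IsTail t) (w : List Gen) :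
    reducedWeight (w ++ t) = reducedWeight w := by
  cases ht <;> simp [reducedWeight]

theorem ρ_vacuum {x : Gen} (hx : 9 ≤ x.cls) :
    (verma c q).ρ x (single [] 1) = hwChar c q x • single [] 1 := by
  rw [HWData.ρ_single, verma_nf_singleton c q hx]

theorem ρ_L_vacuum {m : ℤ} (hm : 0 ≤ m) : (verma c q).ρ (.L m) (single [] 1) = 0 := by
  rw [ρ_vacuum c q (cls_L.2 hm)]; simp [hwChar]

theorem ρ_H_vacuum {m : ℤ} (hm : 0 ≤ m) : (verma c q).ρ (.H m) (single [] 1) =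
    (if m = 0 then q else 0) • single [] 1 := by
  rw [ρ_vacuum c q (cls_H.2 hm)]; simp [hwChar]

theorem ρ_G_vacuum {m : ℤ} (hm : 1 ≤ m) : (verma c q).ρ (.G m) (single [] 1) = 0 := by
  rw [ρ_vacuum c q (cls_G.2 hm)]; simp [hwChar]

theorem ρ_Q_vacuum {m : ℤ} (hm : 1 ≤ m) : (verma c q).ρ (.Q m) (single [] 1) = 0 := by
  rw [ρ_vacuum c q (cls_Q.2 hm)]; simp [hwChar]

theorem ρ_C (s : List Gen →₀ ℂ)
    (h : (verma c q).ρ .C s = c • s) (x : Gen) :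
    (verma c q).ρ .C ((verma c q).ρ x s) = c • (verma c q).ρ x s := by
  rw [verma_ρ_exchange, h]
  cases x <;> simp [bracket, superSign, Gen.odd]

theorem single_G : (verma c q).ρ (.G 0) (single [] 1) = single [.G 0] 1 := by
  rw [HWData.ρ_single, IsTail.G.nf_eq]

theorem single_Q : (verma c q).ρ (.Q 0) (single [] 1) = single [.Q 0] 1 := by
  rw [HWData.ρ_single, IsTail.Q.nf_eq]

theorem single_GQ : (verma c q).ρ (.G 0) (single [.Q 0] 1) = single [.G 0, .Q 0] 1 := by
  rw [HWData.ρ_single, IsTail.GQ.nf_eq]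

theorem ρ_G_zero_sq (s : List Gen →₀ ℂ) :
    (verma c q).ρ (.G 0) ((verma c q).ρ (.G 0) s) = 0 := by
  have h := verma_ρ_exchange c q (.G 0) (.G 0) s
  simp only [superSign, Gen.odd, Bool.and_self, if_true, bracket, map_zero, add_zero,
    neg_smul, one_smul] at h
  exact self_eq_neg.1 h

theorem ρ_Q_zero_sq (s : List Gen →₀ ℂ) :
    (verma c q).ρ (.Q 0) ((verma c q).ρ (.Q 0) s) = 0 := by
  have h := verma_ρ_exchange c q (.Q 0) (.Q 0) s
  simp only [superSign, Gen.odd, Bool.and_self, if_true, bracket, map_zero, add_zero,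
    neg_smul, one_smul] at h
  exact self_eq_neg.1 h

/-- The action of the letters that annihilate the highest weight vector of the Fock module on the
products of zero modes. -/
theorem ρ_tail {b : Gen} (hb : 7 ≤ b.cls) {t : List Gen} (ht : IsTail t) :
    ∃ (z : ℂ) (t' : List Gen), IsTail t' ∧ (z = 0 ∨ 1 ≤ b.weight) ∧
      (verma c q).ρ b (single t 1) =
        hwChar c (q + wordCharge t) b • single t 1 + z • single t' 1 := by
  have of_zero : (verma c q).ρ b (single t 1) = hwChar c (q + wordCharge t) b • single t 1 →
      ∃ (z : ℂ) (t' : List Gen), IsTail t' ∧ (z = 0 ∨ 1 ≤ b.weight) ∧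
      (verma c q).ρ b (single t 1) =
        hwChar c (q + wordCharge t) b • single t 1 + z • single t' 1 :=
    fun h => ⟨0, t, ht, Or.inl rfl, by rw [h, zero_smul, add_zero]⟩
  have LG : ∀ m : ℤ, 0 ≤ m → (verma c q).ρ (.L m) (single [.G 0] 1) = 0 := fun m hm => by
    rw [← single_G, verma_ρ_exchange, ρ_L_vacuum c q hm]
    rcases hm.eq_or_lt with rfl | hm
    · simp [bracket]
    · simp [bracket, linearCombination_e, ρ_G_vacuum c q (show 1 ≤ m by omega)]
  have LQ : ∀ m : ℤ, 0 ≤ m → (verma c q).ρ (.L m) (single [.Q 0] 1) = 0 := fun m hm => by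
    rw [← single_Q, verma_ρ_exchange, ρ_L_vacuum c q hm]
    simp [bracket]
  have GG : ∀ m : ℤ, 0 ≤ m → (verma c q).ρ (.G m) (single [.G 0] 1) = 0 := fun m hm => by
    rcases hm.eq_or_lt with rfl | hm
    · rw [← single_G, ρ_G_zero_sq]
    · rw [← single_G, verma_ρ_exchange, ρ_G_vacuum c q (show 1 ≤ m by omega)]
      simp [bracket]
  have QQ : ∀ m : ℤ, 0 ≤ m → (verma c q).ρ (.Q m) (single [.Q 0] 1) = 0 := fun m hm => by
    rcases hm.eq_or_lt with rfl | hm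
    · rw [← single_Q, ρ_Q_zero_sq]
    · rw [← single_Q, verma_ρ_exchange, ρ_Q_vacuum c q (show 1 ≤ m by omega)]
      simp [bracket]
  have GQ : ∀ m : ℤ, 1 ≤ m → (verma c q).ρ (.G m) (single [.Q 0] 1) = 0 := fun m hm => by
    rw [← single_Q, verma_ρ_exchange, ρ_G_vacuum c q hm]
    simp [bracket, linearCombination_e, ρ_L_vacuum c q (show 0 ≤ m by omega), delta,
      show m ≠ 0 by omega]
  have QG : ∀ m : ℤ, 1 ≤ m → (verma c q).ρ (.Q m) (single [.G 0] 1) = 0 := fun m hm => by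
    rw [← single_G, verma_ρ_exchange, ρ_Q_vacuum c q hm]
    simp [bracket, linearCombination_e, ρ_L_vacuum c q (show 0 ≤ m by omega), delta,
      show m ≠ 0 by omega, ρ_H_vacuum c q (show 0 ≤ m by omega)]
  -- {Q_0, G_0} = 2 L_0, and L_0 has eigenvalue 0 on the highest weight vector, so the two zero
  -- modes anticommute there.
  have QG0 : (verma c q).ρ (.Q 0) (single [.G 0] 1) = - single [.G 0, .Q 0] 1 := by
    rw [← single_G, verma_ρ_exchange, single_Q, single_GQ]
    simp [bracket, linearCombination_e, ρ_L_vacuum c q le_rfl, superSign, Gen.odd]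
  have HG : ∀ m : ℤ, 0 ≤ m → (verma c q).ρ (.H m) (single [.G 0] 1) =
      (if m = 0 then q + 1 else 0) • single [.G 0] 1 := fun m hm => by
    rw [← single_G, verma_ρ_exchange, ρ_H_vacuum c q hm]
    rcases hm.eq_or_lt with rfl | hm
    · simp [bracket, linearCombination_e, superSign, Gen.odd, add_smul, single_G]
      rw [← smul_single_one ([] : List Gen) q, map_smul, single_G, smul_single_one]
    · simp [bracket, linearCombination_e, ρ_G_vacuum c q (show 1 ≤ m by omega), hm.ne']
  have HQ : ∀ m : ℤ, 0 ≤ m → (verma c q).ρ (.H m) (single [.Q 0] 1) =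
      (if m = 0 then q - 1 else 0) • single [.Q 0] 1 := fun m hm => by
    rw [← single_Q, verma_ρ_exchange, ρ_H_vacuum c q hm]
    rcases hm.eq_or_lt with rfl | hm
    · simp [bracket, linearCombination_e, superSign, Gen.odd, sub_eq_add_neg, add_smul, single_Q]
      rw [← smul_single_one ([] : List Gen) q, map_smul, single_Q, smul_single_one]
    · simp [bracket, linearCombination_e, ρ_Q_vacuum c q (show 1 ≤ m by omega), hm.ne']
  have HGQ : ∀ m : ℤ, 0 ≤ m → (verma c q).ρ (.H m) (single [.G 0, .Q 0] 1) =
      (if m = 0 then q else 0) • single [.G 0, .Q 0] 1 := fun m hm => by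
    rw [← single_GQ, verma_ρ_exchange, HQ m hm]
    rcases hm.eq_or_lt with rfl | hm
    · simp [bracket, linearCombination_e, superSign, Gen.odd, sub_smul, single_GQ]
      rw [← smul_single_one [Gen.Q 0] q, map_smul, single_GQ, smul_single_one]
    · simp [bracket, linearCombination_e, GQ m (show 1 ≤ m by omega), hm.ne']
  have Cv : (verma c q).ρ .C (single [] 1) = c • single [] 1 := by
    rw [ρ_vacuum c q cls_C]; rfl
  have CG : (verma c q).ρ .C (single [.G 0] 1) = c • single [.G 0] 1 := by
    rw [← single_G c q]; exact ρ_C c q _ Cv _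
  have CQ : (verma c q).ρ .C (single [.Q 0] 1) = c • single [.Q 0] 1 := by
    rw [← single_Q c q]; exact ρ_C c q _ Cv _
  have CGQ : (verma c q).ρ .C (single [.G 0, .Q 0] 1) = c • single [.G 0, .Q 0] 1 := by
    rw [← single_GQ c q]; exact ρ_C c q _ CQ _
  cases b with
  | L m =>
    have hm := cls_L'.1 hb
    apply of_zero
    rw [show hwChar c (q + wordCharge t) (.L m) = 0 from rfl, zero_smul]
    cases ht
    · exact ρ_L_vacuum c q hm
    · exact LG m hm
    · exact LQ m hm
    · rw [← single_GQ c q, verma_ρ_exchange, LQ m hm]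
      rcases hm.eq_or_lt with rfl | hm
      · simp [bracket]
      · simp [bracket, linearCombination_e, GQ m (show 1 ≤ m by omega)]
  | H m =>
    have hm := cls_H'.1 hb
    apply of_zero
    cases ht
    · rw [ρ_H_vacuum c q hm]; simp [hwChar, wordCharge]
    · rw [HG m hm]; simp [hwChar, wordCharge, Gen.charge]
    · rw [HQ m hm]; simp [hwChar, wordCharge, Gen.charge, sub_eq_add_neg]
    · rw [HGQ m hm]; simp [hwChar, wordCharge, Gen.charge]
  | G m =>
    have hm := cls_G'.1 hb
    rcases hm.eq_or_lt with rfl | hm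
    · rw [show hwChar c (q + wordCharge t) (.G 0) = 0 from rfl]
      cases ht
      · exact ⟨1, _, .G, Or.inr le_rfl, by rw [single_G]; simp⟩
      · exact ⟨0, _, .G, Or.inl rfl, by rw [GG 0 le_rfl]; simp⟩
      · exact ⟨1, _, .GQ, Or.inr le_rfl, by rw [single_GQ]; simp⟩
      · exact ⟨0, _, .G, Or.inl rfl, by rw [← single_GQ c q, ρ_G_zero_sq]; simp⟩
    · apply of_zero
      rw [show hwChar c (q + wordCharge t) (.G m) = 0 from rfl, zero_smul]
      cases ht
      · exact ρ_G_vacuum c q (by omega)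
      · exact GG m hm.le
      · exact GQ m (by omega)
      · rw [← single_GQ c q, verma_ρ_exchange, GQ m (by omega)]
        simp [bracket]
  | Q m =>
    have hm := cls_Q'.1 hb
    rcases hm.eq_or_lt with rfl | hm
    · rw [show hwChar c (q + wordCharge t) (.Q 0) = 0 from rfl]
      cases ht
      · exact ⟨1, _, .Q, Or.inr le_rfl, by rw [single_Q]; simp⟩
      · exact ⟨-1, _, .GQ, Or.inr le_rfl, by rw [QG0]; simp⟩
      · exact ⟨0, _, .G, Or.inl rfl, by rw [QQ 0 le_rfl]; simp⟩
      · refine ⟨0, _, .G, Or.inl rfl, ?_⟩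
        rw [← single_GQ c q, verma_ρ_exchange, QQ 0 le_rfl]
        simp [bracket, linearCombination_e, LQ 0 le_rfl]
    · apply of_zero
      rw [show hwChar c (q + wordCharge t) (.Q m) = 0 from rfl, zero_smul]
      cases ht
      · exact ρ_Q_vacuum c q (by omega)
      · exact QG m (by omega)
      · exact QQ m hm.le
      · rw [← single_GQ c q, verma_ρ_exchange, QQ m hm.le]
        simp [bracket, linearCombination_e, LQ m hm.le, HQ m hm.le, hm.ne', delta]
  | C =>
    apply of_zero
    rw [show hwChar c (q + wordCharge t) .C = c from rfl]
    cases ht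
    · exact Cv
    · exact CG
    · exact CQ
    · exact CGQ

theorem fock_nf_support (w : List Gen) : ∀ w', (fock c q).nf w w' ≠ 0 →
    (fock c q).Std w' ∧ wordWeight w' = wordWeight w :=
  (fock c q).nf_support Gen.weight (fun _ _ _ h => (topBracket_apply_ne_zero h).2.2)
    (fun b _ hb => by cases b <;> simp_all [fock, hwChar, Gen.weight]) w

theorem reducedWeight_of_std {w : List Gen} (hw : (fock c q).Std w) :
    reducedWeight w = wordWeight w := by
  unfold reducedWeight wordWeight
  congr 1
  refine List.map_congr_left fun x hx => ?_
  rw [if_neg]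
  rintro (rfl | rfl) <;> exact hw.2 _ hx (by simp [fock, Gen.cls])

/-- Linear combinations of words of reduced weight less than `d`. -/
noncomputable def lower (d : ℕ) : Submodule ℂ (List Gen →₀ ℂ) :=
  supported ℂ ℂ {w | reducedWeight w < d}

theorem lower_mono {d d' : ℕ} (h : d ≤ d') : lower d ≤ lower d' :=
  supported_mono fun _ hw => lt_of_lt_of_le hw h

theorem fock_nf_append_mem_lower {u t : List Gen} (ht : IsTail t) {d : ℕ} (h : wordWeight u < d) :
    lmapDomain ℂ ℂ (· ++ t) ((fock c q).nf u) ∈ lower d := by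
  rw [lower, mem_supported]
  intro w hw
  have hw := mapDomain_support hw
  obtain ⟨w', hw', rfl⟩ := Finset.mem_image.1 hw
  obtain ⟨h1, h2⟩ := fock_nf_support c q u w' (mem_support_iff.1 hw')
  change reducedWeight (w' ++ t) < d
  rw [ht.reducedWeight_append, reducedWeight_of_std c q h1, h2]
  exact h

theorem linearCombination_mem {J M : Type} [AddCommGroup M] [Module ℂ M] (p : Submodule ℂ M)
    {φ : J → M} {f : J →₀ ℂ} (h : ∀ k, f k ≠ 0 → φ k ∈ p) : linearCombination ℂ φ f ∈ p :=
  p.sum_mem fun k hk => p.smul_mem _ (h k (mem_support_iff.1 hk))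

/-- Up to lower weight, the normal form of a word in the Verma module is that in the Fock module. -/
theorem nf_append_tail (u : List Gen) : ∀ t, IsTail t →
    (verma c q).nf (u ++ t) - lmapDomain ℂ ℂ (· ++ t) ((fock c (q + wordCharge t)).nf u) ∈
      lower (wordWeight u) := by
  refine (fock c q).word_induction (P := fun u => ∀ t, IsTail t →
    (verma c q).nf (u ++ t) - lmapDomain ℂ ℂ (· ++ t) ((fock c (q + wordCharge t)).nf u) ∈
      lower (wordWeight u)) ?_ ?_ ?_ ?_ u
  -- The letter b is absorbed by the tail: it acts as a scalar, with the H_0-eigenvalue shifted by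
  -- the charge of t, or turns t into another tail. In the second case b has weight at least one,
  -- which is lost.
  · intro u b hb ih t ht
    obtain ⟨z, t', ht', hz, h⟩ := ρ_tail c q hb ht
    have h1 : (verma c q).nf (u ++ [b] ++ t) =
        hwChar c (q + wordCharge t) b • (verma c q).nf (u ++ t) +
          z • (verma c q).nf (u ++ t') := by
      rw [List.append_assoc, ← HWData.ρword_nf, List.singleton_append, ← HWData.ρ_single, h,
        map_add, map_smul, map_smul, ← ht.nf_eq c q, ← ht'.nf_eq c q, HWData.ρword_nf,
        HWData.ρword_nf]
    have h2 : (fock c (q + wordCharge t)).nf (u ++ [b]) =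
        hwChar c (q + wordCharge t) b • (fock c (q + wordCharge t)).nf u :=
      HWData.nf_append_bd _ _ hb
    have hw : wordWeight (u ++ [b]) = wordWeight u + b.weight := by simp [wordWeight]
    rw [h1, h2, map_smul, hw, add_sub_right_comm, ← smul_sub]
    refine Submodule.add_mem _ (Submodule.smul_mem _ _ (lower_mono (by omega) (ih t ht))) ?_
    rcases hz with rfl | hz
    · simp
    · refine Submodule.smul_mem _ _ ?_
      rw [← sub_add_cancel ((verma c q).nf (u ++ t'))]
      exact Submodule.add_mem _ (lower_mono (by omega) (ih t' ht'))
        (fock_nf_append_mem_lower c _ ht' (by omega))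
  -- Both normal forms obey an exchange relation. The two brackets agree up to terms of smaller
  -- weight, which fall into `lower`.
  · intro u a b v hab ih1 ih2 t ht
    have hw : ∀ k, wordWeight (u ++ k :: v) = wordWeight u + k.weight + wordWeight v :=
      fun k => by simp [wordWeight, add_assoc]
    have hw1 : wordWeight (u ++ b :: a :: v) = wordWeight (u ++ a :: b :: v) := by
      simp [wordWeight]; omega
    have hw2 : wordWeight (u ++ a :: b :: v) =
        wordWeight u + (a.weight + b.weight) + wordWeight v := by
      simp [wordWeight]; omega
    have e1 := (verma c q).nf_exchange u a b (v ++ t)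
    have e2 := (fock c (q + wordCharge t)).nf_exchange u a b v
    change _ = superSign a.odd b.odd • _ + linearCombination ℂ _ (bracket a b) at e1
    change _ = superSign a.odd b.odd • _ + linearCombination ℂ _ (topBracket a b) at e2
    have e3 : bracket a b = (bracket a b - topBracket a b) + topBracket a b := by abel
    rw [List.append_assoc, List.cons_append, List.cons_append, e1, e2, map_add, map_smul, e3,
      map_add, HWData.linearCombination_comp_apply]
    have i1 := ih1 t ht
    rw [List.append_assoc, List.cons_append, List.cons_append, hw1] at i1
    have i2 : linearCombination ℂ (fun k => (verma c q).nf (u ++ k :: (v ++ t))) (topBracket a b) -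
        linearCombination ℂ (fun k => lmapDomain ℂ ℂ (· ++ t)
          ((fock c (q + wordCharge t)).nf (u ++ k :: v))) (topBracket a b) ∈
        lower (wordWeight (u ++ a :: b :: v)) := by
      have : linearCombination ℂ (fun k => (verma c q).nf (u ++ k :: (v ++ t)) -
          lmapDomain ℂ ℂ (· ++ t) ((fock c (q + wordCharge t)).nf (u ++ k :: v)))
          (topBracket a b) ∈ lower (wordWeight (u ++ a :: b :: v)) := by
        refine linearCombination_mem _ fun k hk => ?_
        have := ih2 k t ht
        rw [hw k, (topBracket_apply_ne_zero hk).2.2, ← hw2] at this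
        simpa using this
      simp only [linearCombination_apply, smul_sub, Finsupp.sum_sub] at this
      simpa only [linearCombination_apply] using this
    have i3 : linearCombination ℂ (fun k => (verma c q).nf (u ++ k :: (v ++ t)))
        (bracket a b - topBracket a b) ∈ lower (wordWeight (u ++ a :: b :: v)) := by
      refine linearCombination_mem _ fun k hk => ?_
      have hlt : wordWeight (u ++ k :: v) < wordWeight (u ++ a :: b :: v) := by
        rw [hw2, hw k]
        have := weight_lt_of_bracket_sub hk
        omega
      have := ih2 k t ht
      rw [List.append_assoc, List.cons_append] at this
      rw [← sub_add_cancel ((verma c q).nf (u ++ k :: (v ++ t)))]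
      exact Submodule.add_mem _ (lower_mono hlt.le this) (fock_nf_append_mem_lower c _ ht hlt)
    have e4 : ∀ (z : ℂ) (a b c d e : List Gen →₀ ℂ),
        z • a + (b + c) - (z • d + e) = z • (a - d) + b + (c - e) := fun z a b c d e => by module
    rw [e4]
    exact Submodule.add_mem _ (Submodule.add_mem _ (Submodule.smul_mem _ _ i1) i3) i2
  · intro u a v ha t ht
    have e2 := (fock c (q + wordCharge t)).nf_square u v ha
    have e1 := (verma c q).nf_square u (v ++ t) ha
    rw [List.append_assoc, List.cons_append, List.cons_append, e1, e2]
    simp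
  -- The letters of u have class below 7 and those of t have class at least 7, so the concatenation
  -- is already standard.
  · intro u hu t ht
    have h1 : (fock c (q + wordCharge t)).nf u = single u 1 := HWData.nf_of_std _ hu
    have h2 : (verma c q).nf (u ++ t) = single (u ++ t) 1 := by
      refine HWData.nf_of_std _ ⟨List.pairwise_append.2 ⟨hu.1, (ht.std c q).1, ?_⟩, ?_⟩
      · intro a ha b hb
        have h1 : ¬ 7 ≤ a.cls := hu.2 a ha
        have h2 : 7 ≤ b.cls := by
          cases ht <;> simp at hb
          · subst hb; decide
          · subst hb; decide
          · rcases hb with rfl | rfl <;> decide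
        exact Term.not_inv c q (by omega) (by omega)
      · intro a ha
        rcases List.mem_append.1 ha with ha | ha
        · intro h
          exact hu.2 a ha (le_trans (by norm_num) h)
        · exact (ht.std c q).2 a ha
    rw [h1, h2]
    simp

end TopN2

/-! ### Derivations that replace one letter by a central one. -/

namespace HWData

variable {I : Type} [LinearOrder I] (D : HWData I)

theorem Std.of_cons {D : HWData I} {y : I} {w : List I} (h : D.Std (y :: w)) : D.Std w :=
  ⟨(List.pairwise_cons.1 h.1).2, fun a ha => h.2 a (List.mem_cons_of_mem _ ha)⟩

theorem Std.le_of_mem {D : HWData I} {y z : I} {w : List I} (h : D.Std (y :: w)) (hz : z ∈ w) :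
    y ≤ z := by
  have := (List.pairwise_cons.1 h.1).1 z hz
  rw [Inv, not_or, not_lt] at this
  exact this.1

theorem Std.eq_of_perm {D : HWData I} {w w' : List I} (h : D.Std w) (h' : D.Std w')
    (hp : w.Perm w') : w = w' := by
  have key : ∀ {w : List I}, D.Std w → w.Pairwise (· ≤ ·) := fun hw =>
    hw.1.imp fun h => by rw [Inv, not_or, not_lt] at h; exact h.1
  exact hp.eq_of_pairwise (fun _ _ _ _ => le_antisymm) (key h) (key h')

/-- An even central element. -/
structure IsCentral (x : I) : Prop where
  even : D.odd x = false
  br : ∀ y, D.br y x = 0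

variable {D}

theorem IsCentral.nf {x : I} (hx : D.IsCentral x) (y : I) (w : List I) :
    D.nf (y :: x :: w) = D.nf (x :: y :: w) := by
  have := D.nf_exchange [] y x w
  rw [hx.br, map_zero, add_zero, sgn, hx.even] at this
  simpa [superSign] using this

theorem IsCentral.ρ {x : I} (hx : D.IsCentral x) (y : I) (s : List I →₀ ℂ) :
    D.ρ y (D.ρ x s) = D.ρ x (D.ρ y s) := by
  rw [D.ρ_exchange, hx.br, map_zero, add_zero, sgn, hx.even]
  simp [superSign]

/-- A central even letter slides to its sorted position without a sign and without bracket terms, so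
a single word results. -/
theorem IsCentral.nf_cons {x : I} (hx : D.IsCentral x) (hbd : ¬ D.bd x) {w : List I}
    (hw : D.Std w) : ∃ w', D.Std w' ∧ w'.Perm (x :: w) ∧ D.nf (x :: w) = single w' 1 := by
  induction w with
  | nil =>
    have : D.Std [x] := ⟨by simp, by simpa using hbd⟩
    exact ⟨[x], this, List.Perm.refl _, D.nf_of_std this⟩
  | cons y w ih =>
    rcases le_or_gt x y with h | h
    · have : D.Std (x :: y :: w) := by
        refine ⟨List.pairwise_cons.2 ⟨fun z hz => ?_, hw.1⟩, ?_⟩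
        · rw [Inv, hx.even, not_or, not_lt]
          refine ⟨?_, by simp⟩
          rcases List.mem_cons.1 hz with rfl | hz
          · exact h
          · exact h.trans (hw.le_of_mem hz)
        · intro a ha
          rcases List.mem_cons.1 ha with rfl | ha
          · exact hbd
          · exact hw.2 a ha
      exact ⟨_, this, List.Perm.refl _, D.nf_of_std this⟩
    · obtain ⟨w', h1, h2, h3⟩ := ih hw.of_cons
      have : D.Std (y :: w') := by
        refine ⟨List.pairwise_cons.2 ⟨fun z hz => ?_, h1.1⟩, ?_⟩
        · rcases List.mem_cons.1 (h2.mem_iff.1 hz) with rfl | hz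
          · rintro (h' | ⟨rfl, -⟩)
            · exact absurd h (not_lt.2 h'.le)
            · exact lt_irrefl _ h
          · exact (List.pairwise_cons.1 hw.1).1 z hz
        · intro a ha
          rcases List.mem_cons.1 ha with rfl | ha
          · exact hw.2 _ (by simp)
          · exact h1.2 a ha
      refine ⟨_, this, (h2.cons y).trans (List.Perm.swap _ _ _), ?_⟩
      rw [← hx.nf, ← ρ_nf, h3, ρ_single, D.nf_of_std this]

/-- A twisted derivation that sends the letter `y₀` to a multiple of the central element `x`. -/
structure IsDerivation (D : HWData I) (T : (List I →₀ ℂ) →ₗ[ℂ] (List I →₀ ℂ))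
    (A : List I → Prop) (x y₀ : I) (η : I → ℂ) (κ : ℂ) : Prop where
  tail : ∀ y w, D.Std (y :: w) → A (y :: w) → A w
  vacuum : T (single [] 1) = 0
  twist : ∀ y, η y ≠ 0
  twist_self : D.odd y₀ = true ∨ η y₀ = 1
  apply_of_ne : ∀ y w, D.Std (y :: w) → A (y :: w) → y ≠ y₀ →
    T (D.nf (y :: w)) = η y • D.ρ y (T (D.nf w))
  apply_self : ∀ w, D.Std (y₀ :: w) → A (y₀ :: w) →
    T (D.nf (y₀ :: w)) = η y₀ • D.ρ y₀ (T (D.nf w)) + κ • D.ρ x (D.nf w)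

/-- The operator passes the letters before the first y₀, collecting their twists in ε, and then each
copy of y₀ contributes one replacement. -/
theorem IsDerivation.apply {T : (List I →₀ ℂ) →ₗ[ℂ] (List I →₀ ℂ)} {A : List I → Prop}
    {x y₀ : I} {η : I → ℂ} {κ : ℂ} (hT : D.IsDerivation T A x y₀ η κ) (hx : D.IsCentral x)
    {w : List I} (hw : D.Std w) (hA : A w) : ∃ ε : ℂ, ε ≠ 0 ∧ ((∀ y ∈ w, y₀ ≤ y) → ε = 1) ∧
      T (D.nf w) = (κ * w.count y₀ * ε) • D.nf (x :: w.erase y₀) := by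
  induction w with
  | nil => exact ⟨1, one_ne_zero, fun _ => rfl, by simp [nf_nil, hT.vacuum]⟩
  | cons y w ih =>
    obtain ⟨ε, h1, h2, h3⟩ := ih hw.of_cons (hT.tail y w hw hA)
    by_cases hy : y = y₀
    · subst hy
      have hε := h2 fun z hz => hw.le_of_mem hz
      refine ⟨1, one_ne_zero, fun _ => rfl, ?_⟩
      rw [hT.apply_self w hw hA, h3, hε, map_smul, ρ_nf, ρ_nf, hx.nf, List.count_cons_self,
        List.erase_cons_head, smul_smul]
      -- In a standard word a repeated letter is even, hence has twist 1, and the contributions of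
      -- its copies add up instead of cancelling.
      by_cases hyw : y ∈ w
      · have hη : η y = 1 := by
          refine hT.twist_self.resolve_left fun ho => ?_
          exact (List.pairwise_cons.1 hw.1).1 y hyw (Or.inr ⟨rfl, ho⟩)
        have : (y :: w.erase y).Perm w := (List.perm_cons_erase hyw).symm
        have hp : D.nf (x :: y :: w.erase y) = D.nf (x :: w) := by
          have hs : D.Std (y :: w.erase y) := by
            have hsub : (y :: w.erase y).Sublist (y :: w) := List.erase_sublist.cons_cons y
            exact ⟨hw.1.sublist hsub, fun a ha => hw.2 a (hsub.subset ha)⟩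
          rw [hs.eq_of_perm hw.of_cons this]
        rw [hp, hη]
        push_cast
        module
      · rw [List.count_eq_zero_of_not_mem hyw]
        simp
    · rw [hT.apply_of_ne y w hw hA hy, h3, map_smul, ρ_nf, hx.nf, List.count_cons_of_ne hy,
        List.erase_cons_tail (by simpa using hy), smul_smul]
      by_cases hlt : y₀ ≤ y
      · have : y₀ ∉ w := fun h => hy (le_antisymm (hw.le_of_mem h) hlt)
        refine ⟨1, one_ne_zero, fun _ => rfl, ?_⟩
        rw [List.count_eq_zero_of_not_mem this]
        simp
      · refine ⟨η y * ε, mul_ne_zero (hT.twist y) h1, fun h => absurd (h y (by simp)) hlt, ?_⟩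
        ring_nf

/-- Replacing one y₀ by x is injective on standard words containing y₀, as the multiset of letters
of the result determines the original. The image of w₀ therefore cannot cancel, and its coefficient
is nonzero in characteristic zero. -/
theorem IsDerivation.notMem {T : (List I →₀ ℂ) →ₗ[ℂ] (List I →₀ ℂ)} {A : List I → Prop}
    {x y₀ : I} {η : I → ℂ} {κ : ℂ} (hT : D.IsDerivation T A x y₀ η κ) (hx : D.IsCentral x)
    (hbd : ¬ D.bd x) (hκ : κ ≠ 0) {s : List I →₀ ℂ} (hs : ∀ w, s w ≠ 0 → D.Std w ∧ A w)
    (h0 : T s = 0) {w₀ : List I} (hw₀ : s w₀ ≠ 0) : y₀ ∉ w₀ := by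
  intro hy₀
  have key : ∀ w, D.Std w → A w → ∃ (z : ℂ) (w' : List I), T (single w 1) = z • single w' 1 ∧
      (z ≠ 0 ↔ y₀ ∈ w) ∧ w'.Perm (x :: w.erase y₀) := by
    intro w hw hA
    obtain ⟨ε, h1, -, h3⟩ := hT.apply hx hw hA
    have he : D.Std (w.erase y₀) :=
      ⟨hw.1.sublist List.erase_sublist, fun a ha => hw.2 a (List.mem_of_mem_erase ha)⟩
    obtain ⟨w', -, h4, h5⟩ := hx.nf_cons hbd he
    rw [D.nf_of_std hw, h5] at h3
    refine ⟨_, _, h3, ?_, h4⟩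
    rw [← List.count_pos_iff, Nat.pos_iff_ne_zero]
    simp [hκ, h1]
  obtain ⟨z, w', h1, h2, h3⟩ := key w₀ (hs w₀ hw₀).1 (hs w₀ hw₀).2
  have h4 : T s w' = s w₀ * z := by
    have : T s = s.sum fun w a => a • T (single w 1) := by
      conv_lhs => rw [← s.sum_single, map_finsuppSum]
      refine Finsupp.sum_congr fun w _ => ?_
      rw [← map_smul, smul_single_one]
    rw [this, Finsupp.sum, finsetSum_apply,
      Finset.sum_eq_single_of_mem w₀ (mem_support_iff.2 hw₀)]
    · rw [h1]; simp
    · intro w hw hne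
      have hw := mem_support_iff.1 hw
      obtain ⟨z', w'', g1, g2, g3⟩ := key w (hs w hw).1 (hs w hw).2
      by_cases hy : y₀ ∈ w
      · rw [g1, Finsupp.smul_apply, Finsupp.smul_apply, single_apply, if_neg]
        · simp
        · rintro rfl
          apply hne
          refine (hs w hw).1.eq_of_perm (hs w₀ hw₀).1 ?_
          have := (g3.symm.trans h3).cons_inv
          exact (List.perm_cons_erase hy).trans ((this.cons y₀).trans
            (List.perm_cons_erase hy₀).symm)
      · have : z' = 0 := by
          by_contra h
          exact hy (g2.1 h)
        rw [g1, this]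
        simp
  rw [h0] at h4
  exact mul_ne_zero hw₀ (h2.2 hy₀) h4.symm

end HWData

/-! ### Operators on the Fock module that detect single letters. -/

namespace TopN2

variable (c q : ℂ)

theorem fock_isCentral : (fock c q).IsCentral (.L (-1)) :=
  ⟨rfl, fun y => by cases y <;> simp [fock, topBracket]⟩

theorem fock_not_bd : ¬ (fock c q).bd (.L (-1)) := by
  intro h
  have : (0 : ℤ) ≤ -1 := cls_L'.1 h
  omega

theorem fock_mode_neg {x : Gen} (hx : ¬ (fock c q).bd x) : x.mode ≤ -1 := by
  by_contra! h
  apply hx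
  cases x with
  | L m => exact cls_L'.2 (by change -1 < m at h; omega)
  | H m => exact cls_H'.2 (by change -1 < m at h; omega)
  | G m => exact cls_G'.2 (by change -1 < m at h; omega)
  | Q m => exact cls_Q'.2 (by change -1 < m at h; omega)
  | C => exact cls_C'

/-- The sum of the modes of a word. -/
def wordMode (w : List Gen) : ℤ := (w.map Gen.mode).sum

theorem wordMode_cons (y : Gen) (w : List Gen) : wordMode (y :: w) = y.mode + wordMode w := by
  simp [wordMode]

theorem fock_wordMode_nonpos {w : List Gen} (hw : (fock c q).Std w) : wordMode w ≤ 0 := by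
  induction w with
  | nil => exact le_rfl
  | cons y w ih =>
    rw [wordMode_cons]
    have := fock_mode_neg c q (hw.2 y (by simp))
    have := ih hw.of_cons
    omega

/-- Rewriting preserves the total mode, and standard words have nonpositive mode. Sufficiently
positive letters therefore kill any given word, which makes truncated sums behave like infinite
ones. -/
theorem fock_nf_eq_zero {w : List Gen} (hw : 0 < wordMode w) : (fock c q).nf w = 0 := by
  ext w'
  by_contra h
  have := (fock c q).nf_support Gen.mode
    (fun _ _ _ h => congrArg Prod.fst (topBracket_apply_ne_zero h).2.1)
    (fun b _ hb => by cases b <;> simp_all [fock, hwChar, Gen.mode]) w w' h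
  have h1 := fock_wordMode_nonpos c q this.1
  rw [wordMode, this.2] at h1
  exact absurd hw (not_lt.2 h1)

theorem fock_ρ_vacuum {x : Gen} (hx : 7 ≤ x.cls) :
    (fock c q).ρ x (single [] 1) = hwChar c q x • single [] 1 := by
  have := (fock c q).nf_append_bd [] (b := x) hx
  rw [HWData.ρ_single]
  rwa [List.nil_append, HWData.nf_nil] at this

theorem fock_ρ_C (w : List Gen) : (fock c q).ρ .C ((fock c q).nf w) = c • (fock c q).nf w := by
  induction w with
  | nil => rw [HWData.nf_nil, fock_ρ_vacuum c q cls_C']; rfl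
  | cons y w ih =>
    rw [← HWData.ρ_nf, fock_ρ_exchange, ih]
    cases y <;> simp [topBracket, superSign, Gen.odd]

/-- `L_j` acts on the Fock module as a derivation that only sees the letter `L_{-1-j}`. -/
theorem isDerivation_L {j : ℤ} (hj : 1 ≤ j) : (fock c q).IsDerivation ((fock c q).ρ (.L j))
    (fun _ => True) (.L (-1)) (.L (-1 - j)) (fun _ => 1) (2 * j + 1) where
  tail _ _ _ _ := trivial
  vacuum := by rw [fock_ρ_vacuum c q (cls_L'.2 (by omega))]; simp [hwChar]
  twist _ := one_ne_zero
  twist_self := Or.inr rfl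
  apply_of_ne y w _ _ hy := by
    rw [← HWData.ρ_nf, fock_ρ_exchange]
    have : topBracket (.L j) y = 0 := by
      cases y with
      | L n =>
        have : j + n + 1 ≠ 0 := fun h => hy (by congr 1; omega)
        simp [topBracket, delta, this]
      | _ => rfl
    rw [this]
    simp [superSign, Gen.odd]
  apply_self w _ _ := by
    rw [← HWData.ρ_nf, fock_ρ_exchange]
    have : topBracket (.L j) (.L (-1 - j)) = (2 * j + 1 : ℂ) • e (.L (-1)) := by
      have h1 : ¬ (j = -1 ∨ -1 - j = -1) := by omega
      simp only [topBracket, if_neg h1, delta]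
      rw [if_pos (by ring)]
      push_cast
      ring_nf
    rw [this, map_smul, linearCombination_e]
    simp [superSign, Gen.odd]

/-- On words without `H`-letters, `G_j` only sees the letter `Q_{-1-j}`. -/
theorem isDerivation_G {j : ℤ} (hj : 0 ≤ j) : (fock c q).IsDerivation ((fock c q).ρ (.G j))
    (fun w => ∀ n, .H n ∉ w) (.L (-1)) (.Q (-1 - j)) (fun y => superSign true y.odd) 2 where
  tail y w _ h n hn := h n (List.mem_cons_of_mem _ hn)
  vacuum := by rw [fock_ρ_vacuum c q (cls_G'.2 hj)]; simp [hwChar]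
  twist y := by cases y <;> simp [superSign, Gen.odd]
  twist_self := Or.inl rfl
  apply_of_ne y w _ hA hy := by
    rw [← HWData.ρ_nf, fock_ρ_exchange]
    have : topBracket (.G j) y = 0 := by
      cases y with
      | Q n =>
        have : j + n + 1 ≠ 0 := fun h => hy (by congr 1; omega)
        simp [topBracket, delta, this]
      | H n => exact absurd (by simp) (hA n)
      | _ => rfl
    rw [this, map_zero, add_zero]
    rfl
  apply_self w _ _ := by
    rw [← HWData.ρ_nf, fock_ρ_exchange]
    have : topBracket (.G j) (.Q (-1 - j)) = (2 : ℂ) • e (.L (-1)) := by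
      simp only [topBracket, delta]
      rw [if_pos (by ring), mul_one]
    rw [this, map_smul, linearCombination_e]
    rfl

/-- On words without `H`-letters, `Q_j` only sees the letter `G_{-1-j}`. -/
theorem isDerivation_Q {j : ℤ} (hj : 0 ≤ j) : (fock c q).IsDerivation ((fock c q).ρ (.Q j))
    (fun w => ∀ n, .H n ∉ w) (.L (-1)) (.G (-1 - j)) (fun y => superSign true y.odd) 2 where
  tail y w _ h n hn := h n (List.mem_cons_of_mem _ hn)
  vacuum := by rw [fock_ρ_vacuum c q (cls_Q'.2 hj)]; simp [hwChar]
  twist y := by cases y <;> simp [superSign, Gen.odd]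
  twist_self := Or.inl rfl
  apply_of_ne y w _ hA hy := by
    rw [← HWData.ρ_nf, fock_ρ_exchange]
    have : topBracket (.Q j) y = 0 := by
      cases y with
      | G n =>
        have : j + n + 1 ≠ 0 := fun h => hy (by congr 1; omega)
        simp [topBracket, delta, this]
      | H n => exact absurd (by simp) (hA n)
      | _ => rfl
    rw [this, map_zero, add_zero]
    rfl
  apply_self w _ _ := by
    rw [← HWData.ρ_nf, fock_ρ_exchange]
    have : topBracket (.Q j) (.G (-1 - j)) = (2 : ℂ) • e (.L (-1)) := by
      simp only [topBracket, delta]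
      rw [if_pos (by ring), mul_one]
    rw [this, map_smul, linearCombination_e]
    rfl

/-! ### The current that detects H-letters. -/

/-- The product `Q_{h-1-a} G_a`. -/
noncomputable def quad (h a : ℤ) : (List Gen →₀ ℂ) →ₗ[ℂ] (List Gen →₀ ℂ) :=
  ((fock c q).ρ (.Q (h - 1 - a))).comp ((fock c q).ρ (.G a))

/-- The truncated current `2 L_{-1} H_h + ∑ Q_{h-1-a} G_a`. -/
noncomputable def current (h N : ℤ) : (List Gen →₀ ℂ) →ₗ[ℂ] (List Gen →₀ ℂ) :=
  (2 : ℂ) • ((fock c q).ρ (.L (-1))).comp ((fock c q).ρ (.H h)) +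
    ∑ a ∈ Finset.Icc (-N) N, quad c q h a

theorem current_apply (h N : ℤ) (s : List Gen →₀ ℂ) : current c q h N s =
    (2 : ℂ) • (fock c q).ρ (.L (-1)) ((fock c q).ρ (.H h) s) +
      ∑ a ∈ Finset.Icc (-N) N, quad c q h a s := by
  simp [current, LinearMap.sum_apply]

theorem quad_swap (h a : ℤ) (s : List Gen →₀ ℂ) : quad c q h a s =
    -((fock c q).ρ (.G a) ((fock c q).ρ (.Q (h - 1 - a)) s)) +
      (2 * delta h) • (fock c q).ρ (.L (-1)) s := by
  rw [quad, LinearMap.comp_apply, fock_ρ_exchange]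
  simp only [superSign, Gen.odd, Bool.and_self, if_true, topBracket, map_smul, linearCombination_e]
  rw [show h - 1 - a + a + 1 = h by ring]
  simp

/-- For h ≥ 1 the modes of Q_{h-1-a} and G_a do not add up to -1, so the two anticommute and either
factor may act first. -/
theorem current_eq_zero {h N : ℤ} (hh : 1 ≤ h) {s : List Gen →₀ ℂ}
    (hH : (fock c q).ρ (.H h) s = 0)
    (hGQ : ∀ a, (fock c q).ρ (.G a) s = 0 ∨ (fock c q).ρ (.Q (h - 1 - a)) s = 0) :
    current c q h N s = 0 := by
  rw [current_apply, hH, map_zero, smul_zero, zero_add]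
  refine Finset.sum_eq_zero fun a _ => ?_
  rcases hGQ a with h1 | h1
  · rw [quad, LinearMap.comp_apply, h1, map_zero]
  · rw [quad_swap, h1, delta, if_neg (by omega)]
    simp

theorem quad_L (h a n : ℤ) (s : List Gen →₀ ℂ) :
    quad c q h a ((fock c q).ρ (.L n) s) = (fock c q).ρ (.L n) (quad c q h a s) := by
  simp only [quad, LinearMap.comp_apply]
  rw [fock_ρ_exchange c q (.G a), map_add, map_smul, fock_ρ_exchange c q (.Q _) (.L n)]
  simp [topBracket, superSign, Gen.odd]

theorem quad_G (h a n : ℤ) (s : List Gen →₀ ℂ) :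
    quad c q h a ((fock c q).ρ (.G n) s) = (fock c q).ρ (.G n) (quad c q h a s) -
      (2 * delta (h - a + n)) • (fock c q).ρ (.L (-1)) ((fock c q).ρ (.G a) s) := by
  simp only [quad, LinearMap.comp_apply]
  rw [fock_ρ_exchange c q (.G a), map_add, map_smul, fock_ρ_exchange c q (.Q _) (.G n)]
  simp [topBracket, superSign, Gen.odd, linearCombination_e]
  rw [show h - 1 - a + n + 1 = h - a + n by ring]
  module

theorem quad_Q (h a n : ℤ) (s : List Gen →₀ ℂ) :
    quad c q h a ((fock c q).ρ (.Q n) s) = (fock c q).ρ (.Q n) (quad c q h a s) +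
      (2 * delta (a + n + 1)) • (fock c q).ρ (.L (-1)) ((fock c q).ρ (.Q (h - 1 - a)) s) := by
  simp only [quad, LinearMap.comp_apply]
  rw [fock_ρ_exchange c q (.G a), map_add, map_smul, fock_ρ_exchange c q (.Q _) (.Q n)]
  simp [topBracket, superSign, Gen.odd, linearCombination_e, (fock_isCentral c q).ρ]

theorem quad_H (h a n : ℤ) (s : List Gen →₀ ℂ) :
    quad c q h a ((fock c q).ρ (.H n) s) = (fock c q).ρ (.H n) (quad c q h a s) +
      quad c q (h + n) a s - quad c q (h + n) (a + n) s := by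
  simp only [quad, LinearMap.comp_apply]
  rw [fock_ρ_exchange c q (.G a), map_add, map_smul, fock_ρ_exchange c q (.Q _) (.H n)]
  simp [topBracket, superSign, Gen.odd, linearCombination_e]
  rw [show h + n - 1 - (a + n) = h - 1 - a by ring, show h + n - 1 - a = h - 1 - a + n by ring]
  module

end TopN2

/-- For n ≤ 0 the common part cancels and two boundary strips of length -n remain. -/
theorem sum_Icc_sub_sum_shift {V : Type} [AddCommGroup V] (f : ℤ → V) {n N : ℤ} (hn : n ≤ 0)
    (hN : -n ≤ N) : ∑ a ∈ Finset.Icc (-N) N, f a - ∑ a ∈ Finset.Icc (-N) N, f (a + n) =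
      ∑ a ∈ Finset.Ioc (N + n) N, f a - ∑ a ∈ Finset.Ico (-N + n) (-N), f a := by
  have h1 : ∑ a ∈ Finset.Icc (-N) N, f (a + n) = ∑ a ∈ Finset.Icc (-N + n) (N + n), f a := by
    rw [← Finset.map_add_right_Icc, Finset.sum_map]
    rfl
  have h2 : Finset.Icc (-N) N = Finset.Icc (-N) (N + n) ∪ Finset.Ioc (N + n) N := by
    ext a; simp only [Finset.mem_union, Finset.mem_Icc, Finset.mem_Ioc]; omega
  have h3 : Finset.Icc (-N + n) (N + n) = Finset.Ico (-N + n) (-N) ∪ Finset.Icc (-N) (N + n) := by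
    ext a; simp only [Finset.mem_union, Finset.mem_Icc, Finset.mem_Ico]; omega
  rw [h1, h2, h3, Finset.sum_union, Finset.sum_union]
  · abel
  all_goals
    refine Finset.disjoint_left.2 fun a ha hb => ?_
    simp only [Finset.mem_Icc, Finset.mem_Ioc, Finset.mem_Ico] at ha hb
    omega

namespace TopN2

variable (c q : ℂ)

theorem fock_nf_cons_eq_zero {x : Gen} {w : List Gen} (h : 0 < x.mode + wordMode w) :
    (fock c q).ρ x ((fock c q).nf w) = 0 := by
  rw [HWData.ρ_nf]
  exact fock_nf_eq_zero c q (by rwa [wordMode_cons])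

/-- The anomaly that shifts c to c-3. Formally the two sums differ by a reindexing, but truncation
leaves boundary strips. On the upper one G_a is too positive and vanishes; on the lower one
reordering Q G, with Q too positive, leaves 2 δ L_{-1} for each of the -n indices. -/
theorem sum_quad_sub {h n M N : ℤ} (hh : 1 ≤ h) (hn : n ≤ -1) (hM : -n ≤ M) (hN : 2 * M ≤ N)
    {w : List Gen} (hw : -M ≤ wordMode w) :
    ∑ a ∈ Finset.Icc (-N) N, quad c q (h + n) a ((fock c q).nf w) -
      ∑ a ∈ Finset.Icc (-N) N, quad c q (h + n) (a + n) ((fock c q).nf w) =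
      (2 * n * delta (h + n)) • (fock c q).ρ (.L (-1)) ((fock c q).nf w) := by
  rw [sum_Icc_sub_sum_shift (fun a => quad c q (h + n) a ((fock c q).nf w)) (by omega) (by omega)]
  have h1 : ∑ a ∈ Finset.Ioc (N + n) N, quad c q (h + n) a ((fock c q).nf w) = 0 := by
    refine Finset.sum_eq_zero fun a ha => ?_
    rw [Finset.mem_Ioc] at ha
    rw [quad, LinearMap.comp_apply, fock_nf_cons_eq_zero c q, map_zero]
    change 0 < a + _
    omega
  have h2 : ∑ a ∈ Finset.Ico (-N + n) (-N), quad c q (h + n) a ((fock c q).nf w) =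
      ∑ a ∈ Finset.Ico (-N + n) (-N),
        (2 * delta (h + n)) • (fock c q).ρ (.L (-1)) ((fock c q).nf w) := by
    refine Finset.sum_congr rfl fun a ha => ?_
    rw [Finset.mem_Ico] at ha
    rw [quad_swap, fock_nf_cons_eq_zero c q (x := .Q (h + n - 1 - a)), map_zero, neg_zero,
      zero_add]
    change 0 < h + n - 1 - a + _
    omega
  rw [h1, h2, Finset.sum_const, Int.card_Ico, zero_sub, ← Nat.cast_smul_eq_nsmul ℂ, smul_smul,
    ← neg_smul]
  congr 1
  have : (((-N - (-N + n)).toNat : ℕ) : ℂ) = -n := by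
    rw [show -N - (-N + n) = -n by ring, ← Int.cast_natCast, Int.toNat_of_nonneg (by omega)]
    push_cast
    rfl
  rw [this]
  ring

theorem sum_delta_smul {V : Type} [AddCommGroup V] [Module ℂ V] {F : Finset ℤ} {a₀ : ℤ}
    (h : a₀ ∈ F) {d : ℤ → ℤ} (hd : ∀ a, d a = 0 ↔ a = a₀) (f : ℤ → V) :
    ∑ a ∈ F, (2 * delta (d a)) • f a = (2 : ℂ) • f a₀ := by
  rw [Finset.sum_eq_single_of_mem a₀ h]
  · rw [delta, if_pos ((hd a₀).2 rfl), mul_one]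
  · intro b _ hb
    rw [delta, if_neg (mt (hd b).1 hb), mul_zero, zero_smul]

/-- On words of bounded level, the truncated current only sees the letter `H_{-h}`. -/
theorem isDerivation_current {h M N : ℤ} (hh : 1 ≤ h) (hN : 2 * M + h ≤ N) :
    (fock c q).IsDerivation (current c q h N) (fun w => -M ≤ wordMode w) (.L (-1)) (.H (-h))
      (fun _ => 1) (2 * h / 3 * (c - 3)) := by
  have mode_le : ∀ {y w}, (fock c q).Std (y :: w) → -M ≤ wordMode (y :: w) →
      y.mode ≤ -1 ∧ -M ≤ y.mode ∧ -M ≤ wordMode w := by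
    intro y w hs hA
    rw [wordMode_cons] at hA
    have h1 := fock_mode_neg c q (hs.2 y (by simp))
    have h2 := fock_wordMode_nonpos c q hs.of_cons
    omega
  have apply_H : ∀ n w, (fock c q).Std (.H n :: w) → -M ≤ wordMode (.H n :: w) →
      current c q h N ((fock c q).nf (.H n :: w)) =
        (fock c q).ρ (.H n) (current c q h N ((fock c q).nf w)) +
        ((2 * h / 3 * c + 2 * n) * delta (h + n)) • (fock c q).ρ (.L (-1)) ((fock c q).nf w) := by
    intro n w hs hA
    obtain ⟨h1, h2, h3⟩ := mode_le hs hA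
    change n ≤ -1 at h1
    change -M ≤ n at h2
    -- The bracket [H_h, H_n] supplies the c-term and the boundary strips supply 2n; at n = -h their
    -- sum is (2h/3)(c-3).
    have h4 := sum_quad_sub c q hh h1 (M := M) (N := N) (by omega) (by omega) h3
    rw [← HWData.ρ_nf, current_apply, current_apply]
    simp only [quad_H, Finset.sum_sub_distrib, Finset.sum_add_distrib, map_add, map_smul, map_sum]
    rw [add_sub_assoc, h4, fock_ρ_exchange c q (.H h)]
    simp only [topBracket, superSign, Gen.odd, Bool.and_self, Bool.false_eq_true, if_false,
      one_smul, map_add, map_smul, linearCombination_e, fock_ρ_C, (fock_isCentral c q).ρ]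
    module
  refine ⟨fun y w hs hA => (mode_le hs hA).2.2, ?_, fun _ => one_ne_zero, Or.inr rfl, ?_, ?_⟩
  · refine current_eq_zero c q hh ?_ fun a => ?_
    · rw [fock_ρ_vacuum c q (cls_H'.2 (by omega)), hwChar, if_neg (by omega), zero_smul]
    · rcases le_or_gt 0 a with ha | ha
      · exact Or.inl (by rw [fock_ρ_vacuum c q (cls_G'.2 ha)]; simp [hwChar])
      · exact Or.inr (by rw [fock_ρ_vacuum c q (cls_Q'.2 (by omega))]; simp [hwChar])
  · intro y w hs hA hy
    obtain ⟨h1, h2, h3⟩ := mode_le hs hA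
    rw [one_smul]
    cases y with
    | L n =>
      rw [← HWData.ρ_nf, current_apply, current_apply]
      simp only [quad_L, map_add, map_smul, map_sum]
      rw [fock_ρ_exchange c q (.H h)]
      simp [topBracket, superSign, Gen.odd, (fock_isCentral c q).ρ]
    | H n =>
      rw [apply_H n w hs hA, delta, if_neg, mul_zero, zero_smul, add_zero]
      intro h'
      exact hy (by congr 1; omega)
    | G n =>
      change n ≤ -1 at h1
      change -M ≤ n at h2
      rw [← HWData.ρ_nf, current_apply, current_apply]
      simp only [quad_G, Finset.sum_sub_distrib, map_add, map_smul, map_sum]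
      -- Only a = h+n meets G_n, and its contribution -2 L_{-1} G_{h+n} cancels 2 L_{-1} [H_h, G_n].
      -- The bound on N keeps this index inside the range.
      rw [sum_delta_smul (a₀ := h + n) (by rw [Finset.mem_Icc]; omega) (by intro a; omega)
        fun a => (fock c q).ρ (.L (-1)) ((fock c q).ρ (.G a) ((fock c q).nf w)),
        fock_ρ_exchange c q (.H h)]
      simp only [topBracket, superSign, Gen.odd, Bool.and_true, Bool.false_eq_true, if_false,
        one_smul, map_add, linearCombination_e, (fock_isCentral c q).ρ]
      module
    | Q n =>
      change n ≤ -1 at h1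
      change -M ≤ n at h2
      rw [← HWData.ρ_nf, current_apply, current_apply]
      simp only [quad_Q, Finset.sum_add_distrib, map_add, map_smul, map_sum]
      -- Here the index a = -1-n contributes 2 L_{-1} Q_{h+n}, which cancels 2 L_{-1} [H_h, Q_n].
      rw [sum_delta_smul (a₀ := -1 - n) (by rw [Finset.mem_Icc]; omega) (by intro a; omega)
        fun a => (fock c q).ρ (.L (-1)) ((fock c q).ρ (.Q (h - 1 - a)) ((fock c q).nf w)),
        fock_ρ_exchange c q (.H h), show h - 1 - (-1 - n) = h + n by ring]
      simp only [topBracket, superSign, Gen.odd, Bool.and_true, Bool.false_eq_true, if_false,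
        one_smul, map_add, map_smul, linearCombination_e, (fock_isCentral c q).ρ]
      module
    | C => exact absurd cls_C' (hs.2 .C (by simp))
  · intro w hs hA
    rw [apply_H _ w hs hA, delta, if_pos (by ring)]
    push_cast
    module

variable {c}

/-- The letters of words in a vector of the Fock module that is annihilated by all positive modes:
only `L_{-1}`, `G_{-1}` and `Q_{-1}` are left. -/
theorem fock_singular (hc : c ≠ 3) {s : List Gen →₀ ℂ} (hs : ∀ w, s w ≠ 0 → (fock c q).Std w)
    (hL : ∀ j, 1 ≤ j → (fock c q).ρ (.L j) s = 0) (hH : ∀ j, 1 ≤ j → (fock c q).ρ (.H j) s = 0)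
    (hG : ∀ j, 1 ≤ j → (fock c q).ρ (.G j) s = 0) (hQ : ∀ j, 1 ≤ j → (fock c q).ρ (.Q j) s = 0)
    (hZ : (fock c q).ρ (.G 0) s = 0 ∨ (fock c q).ρ (.Q 0) s = 0) {w : List Gen} (hw : s w ≠ 0) :
    ∀ y ∈ w, y = .L (-1) ∨ ((fock c q).ρ (.Q 0) s ≠ 0 ∧ y = .G (-1)) ∨
      ((fock c q).ρ (.G 0) s ≠ 0 ∧ y = .Q (-1)) := by
  have cen := fock_isCentral c q
  have nbd := fock_not_bd c q
  -- The support is finite, so one truncation bound serves all its words.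
  obtain ⟨M, hM⟩ : ∃ M : ℤ, ∀ w, s w ≠ 0 → -M ≤ wordMode w := by
    refine ⟨∑ w ∈ s.support, |wordMode w|, fun w hw => ?_⟩
    have := Finset.single_le_sum (f := fun w => |wordMode w|) (fun _ _ => abs_nonneg _)
      (mem_support_iff.2 hw)
    exact (neg_le_neg this).trans (neg_abs_le (wordMode w))
  have noH : ∀ w, s w ≠ 0 → ∀ n, .H n ∉ w := by
    intro w hw n hn
    have hn1 : n ≤ -1 := fock_mode_neg c q ((hs w hw).2 _ hn)
    have h1 : (1 : ℤ) ≤ -n := by omega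
    -- The only place where c ≠ 3 enters.
    have hκ : (2 * (-n : ℤ) / 3 * (c - 3) : ℂ) ≠ 0 := by
      have : (n : ℂ) ≠ 0 := by exact_mod_cast (by omega : n ≠ 0)
      have := sub_ne_zero.2 hc
      push_cast
      simp_all
    refine (isDerivation_current c q h1 le_rfl).notMem cen nbd hκ
      (fun w hw => ⟨hs w hw, hM w hw⟩) ?_ hw (by rwa [neg_neg])
    refine current_eq_zero c q h1 (hH _ h1) fun a => ?_
    -- For a > 0 the factor G_a kills s, for a < 0 the factor Q_{h-1-a} does. At a = 0 either G_0
    -- kills s, or Q_{h-1} does, which for h = 1 is the zero mode Q_0.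
    rcases lt_trichotomy a 0 with ha | rfl | ha
    · exact Or.inr (hQ _ (by omega))
    · rcases hZ with hZ | hZ
      · exact Or.inl hZ
      · rcases h1.eq_or_lt with h | h
        · rw [← h]; exact Or.inr hZ
        · exact Or.inr (hQ _ (by omega))
    · exact Or.inl (hG _ (by omega))
  have hs' : ∀ w, s w ≠ 0 → (fock c q).Std w ∧ ∀ n, .H n ∉ w := fun w hw => ⟨hs w hw, noH w hw⟩
  intro y hy
  have hy1 := fock_mode_neg c q ((hs w hw).2 y hy)
  cases y with
  | L n =>
    change n ≤ -1 at hy1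
    by_contra hne
    have hne : n ≠ -1 := by rintro rfl; simp at hne
    have h1 : (1 : ℤ) ≤ -1 - n := by omega
    have hκ : (2 * (-1 - n : ℤ) + 1 : ℂ) ≠ 0 := by exact_mod_cast (by omega)
    exact (isDerivation_L c q h1).notMem cen nbd hκ (fun w hw => ⟨hs w hw, trivial⟩) (hL _ h1) hw
      (by rwa [sub_sub_cancel])
  | H n => exact absurd hy (noH w hw n)
  | G n =>
    change n ≤ -1 at hy1
    have key : (fock c q).ρ (.Q (-1 - n)) s ≠ 0 := fun h0 =>
      (isDerivation_Q c q (show 0 ≤ -1 - n by omega)).notMem cen nbd two_ne_zero hs' h0 hw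
        (by rwa [sub_sub_cancel])
    have hn : n = -1 := by
      by_contra hne
      exact key (hQ _ (by omega))
    subst hn
    exact Or.inr (Or.inl ⟨key, rfl⟩)
  | Q n =>
    change n ≤ -1 at hy1
    have key : (fock c q).ρ (.G (-1 - n)) s ≠ 0 := fun h0 =>
      (isDerivation_G c q (show 0 ≤ -1 - n by omega)).notMem cen nbd two_ne_zero hs' h0 hw
        (by rwa [sub_sub_cancel])
    have hn : n = -1 := by
      by_contra hne
      exact key (hG _ (by omega))
    subst hn
    exact Or.inr (Or.inr ⟨key, rfl⟩)
  | C => exact absurd cls_C' ((hs w hw).2 .C hy)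

end TopN2

/-! ### From singular vectors of the Verma module to their leading part. -/

namespace TopN2

variable (c q : ℂ)

theorem IsTail.cls {t : List Gen} (ht : IsTail t) : ∀ x ∈ t, 7 ≤ x.cls ∧ x.cls < 9 := by
  cases ht <;> simp [Gen.cls]

/-- The part of a word that consists of lower letters. -/
def bodyPart (w : List Gen) : List Gen := w.filter fun x => x.cls < 7

/-- The part of a word that consists of zero modes. -/
def tailPart (w : List Gen) : List Gen := w.filter fun x => 7 ≤ x.cls

/-- A word that is a standard word of the Fock module followed by zero modes. -/
def IsSplit (w : List Gen) : Prop :=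
  ∃ u t, (fock c q).Std u ∧ IsTail t ∧ w = u ++ t

theorem bodyPart_append {u t : List Gen} (hu : (fock c q).Std u) (ht : IsTail t) :
    bodyPart (u ++ t) = u := by
  rw [bodyPart, List.filter_append, List.filter_eq_self.2, List.filter_eq_nil_iff.2,
    List.append_nil]
  · intro x hx
    have := (ht.cls x hx).1
    simpa using this
  · intro x hx
    have : ¬ 7 ≤ x.cls := hu.2 x hx
    simpa using this

theorem tailPart_append {u t : List Gen} (hu : (fock c q).Std u) (ht : IsTail t) :
    tailPart (u ++ t) = t := by
  rw [tailPart, List.filter_append, List.filter_eq_nil_iff.2, List.nil_append,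
    List.filter_eq_self.2]
  · intro x hx
    have := (ht.cls x hx).1
    simpa using this
  · intro x hx
    have : ¬ 7 ≤ x.cls := hu.2 x hx
    simpa using this

theorem apply_eq_zero_of_mem_lower {d : ℕ} {f : List Gen →₀ ℂ} (hf : f ∈ lower d)
    {w : List Gen} (hw : d ≤ reducedWeight w) : f w = 0 := by
  by_contra h
  have : reducedWeight w < d := (mem_supported ℂ f).1 hf (mem_support_iff.2 h)
  omega

/-- The top coefficients of the action of a letter are those in the Fock module. -/
theorem nf_cons_append_apply (x : Gen) {u t u' t' : List Gen} {W : ℕ}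
    (ht : IsTail t) (hu' : (fock c q).Std u') (ht' : IsTail t') (hW : wordWeight u ≤ W)
    (hW' : wordWeight u' = x.weight + W) :
    (verma c q).nf (x :: (u ++ t)) (u' ++ t') =
      if t = t' ∧ wordWeight u = W then (fock c (q + wordCharge t')).nf (x :: u) u' else 0 := by
  have h1 := nf_append_tail c q (x :: u) t ht
  have hx : wordWeight (x :: u) = x.weight + wordWeight u := by simp [wordWeight]
  have h2 := apply_eq_zero_of_mem_lower h1 (w := u' ++ t') (by
    rw [ht'.reducedWeight_append, reducedWeight_of_std c q hu', hx]; omega)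
  rw [Finsupp.sub_apply, sub_eq_zero, List.cons_append] at h2
  rw [h2, lmapDomain_apply]
  by_cases htt : t = t'
  · subst htt
    rw [mapDomain_apply (fun a b h => List.append_cancel_right h)]
    by_cases hw : wordWeight u = W
    · rw [if_pos ⟨rfl, hw⟩]
    · rw [if_neg (by tauto)]
      by_contra h
      have := (fock_nf_support c _ _ _ h).2
      omega
  · rw [if_neg (by tauto)]
    by_contra h
    obtain ⟨v, hv, hv'⟩ := Finset.mem_image.1 (mapDomain_support (mem_support_iff.2 h))
    have hv := (fock_nf_support c _ _ _ (mem_support_iff.1 hv)).1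
    apply htt
    rw [← tailPart_append c _ hv ht, ← tailPart_append c q hu' ht']
    exact congrArg tailPart hv'

open Classical in
/-- The part of weight `W` of a vector of the Verma module, among the words that end with `t`. -/
noncomputable def topPart (W : ℕ) (t : List Gen) : (List Gen →₀ ℂ) →ₗ[ℂ] (List Gen →₀ ℂ) :=
  linearCombination ℂ fun w =>
    if tailPart w = t ∧ reducedWeight w = W then single (bodyPart w) 1 else 0

theorem topPart_apply (W : ℕ) (t : List Gen) (s : List Gen →₀ ℂ) (u : List Gen) :
    topPart W t s u = s.sum fun w z =>
      if tailPart w = t ∧ reducedWeight w = W ∧ bodyPart w = u then z else 0 := by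
  rw [topPart, linearCombination_apply, Finsupp.sum, finsetSum_apply]
  refine Finset.sum_congr rfl fun w _ => ?_
  by_cases h : tailPart w = t ∧ reducedWeight w = W <;> by_cases h' : bodyPart w = u <;>
    simp [h, h']

theorem topPart_apply_append {W : ℕ} {s : List Gen →₀ ℂ} (hs : ∀ w, s w ≠ 0 → IsSplit c q w)
    {u t : List Gen} (hu : (fock c q).Std u) (ht : IsTail t) (hW : reducedWeight (u ++ t) = W) :
    topPart W t s u = s (u ++ t) := by
  classical
  rw [topPart_apply, Finsupp.sum, Finset.sum_eq_single (u ++ t)]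
  · rw [if_pos ⟨tailPart_append c q hu ht, hW, bodyPart_append c q hu ht⟩]
  · intro w hw hne
    rw [if_neg]
    rintro ⟨rfl, -, rfl⟩
    obtain ⟨u', t', hu', ht', rfl⟩ := hs w (mem_support_iff.1 hw)
    apply hne
    rw [tailPart_append c q hu' ht', bodyPart_append c q hu' ht']
  · intro h
    rw [notMem_support_iff.1 h, ite_self]

theorem topPart_std {W : ℕ} {s : List Gen →₀ ℂ} (hs : ∀ w, s w ≠ 0 → IsSplit c q w)
    {t u : List Gen} (h : topPart W t s u ≠ 0) : (fock c q).Std u ∧ wordWeight u = W := by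
  rw [topPart_apply] at h
  obtain ⟨w, hw, hw'⟩ := Finset.exists_ne_zero_of_sum_ne_zero h
  obtain ⟨u', t', hu', ht', rfl⟩ := hs w (mem_support_iff.1 hw)
  rw [ite_ne_right_iff] at hw'
  obtain ⟨⟨-, h1, rfl⟩, -⟩ := hw'
  rw [bodyPart_append c q hu' ht']
  rw [ht'.reducedWeight_append, reducedWeight_of_std c q hu'] at h1
  exact ⟨hu', h1⟩

/-- The top part of a vector is annihilated by the letters that annihilate the vector. -/
theorem fock_ρ_topPart {W : ℕ} {s : List Gen →₀ ℂ} (hs : ∀ w, s w ≠ 0 → IsSplit c q w)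
    (hW : ∀ w, s w ≠ 0 → reducedWeight w ≤ W) {x : Gen} (hx : (verma c q).ρ x s = 0)
    {t : List Gen} (ht : IsTail t) :
    (fock c (q + wordCharge t)).ρ x (topPart W t s) = 0 := by
  classical
  ext u'
  rw [Finsupp.zero_apply]
  by_contra hne
  -- The Fock action adds weights exactly, so u' lies in the top weight, where its coefficient
  -- agrees with that of the Verma action.
  have hu' : (fock c q).Std u' ∧ wordWeight u' = x.weight + W := by
    refine (fock c (q + wordCharge t)).ρ_support Gen.weight
      (fun _ _ _ h => (topBracket_apply_ne_zero h).2.2)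
      (fun b _ hb => by cases b <;> simp_all [fock, hwChar, Gen.weight])
      (fun w hw => (topPart_std c q hs hw).2) x u' hne
  apply hne
  have h0 : (verma c q).ρ x s (u' ++ t) = 0 := by rw [hx]; rfl
  rw [← h0, HWData.ρ_apply_eq_sum (verma c q)]
  rw [topPart, HWData.linearCombination_comp_apply, linearCombination_apply, Finsupp.sum,
    finsetSum_apply]
  refine Finset.sum_congr rfl fun w hw => ?_
  obtain ⟨u, t', hu, ht', rfl⟩ := hs w (mem_support_iff.1 hw)
  have hwt : wordWeight u ≤ W := by
    rw [← reducedWeight_of_std c q hu, ← ht'.reducedWeight_append]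
    exact hW _ (mem_support_iff.1 hw)
  dsimp only
  rw [nf_cons_append_apply c q x ht' hu'.1 ht hwt hu'.2, tailPart_append c q hu ht',
    bodyPart_append c q hu ht', ht'.reducedWeight_append, reducedWeight_of_std c q hu,
    Finsupp.smul_apply, smul_eq_mul]
  split_ifs
  · rw [HWData.ρ_single]
  · simp

variable {c}

/-- The letters of the words of maximal weight in a vector of the Verma module that is annihilated
by all positive modes. -/
theorem verma_singular (hc : c ≠ 3) {W : ℕ} {s : List Gen →₀ ℂ}
    (hs : ∀ w, s w ≠ 0 → IsSplit c q w) (hW : ∀ w, s w ≠ 0 → reducedWeight w ≤ W)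
    (hL : ∀ j, 1 ≤ j → (verma c q).ρ (.L j) s = 0) (hH : ∀ j, 1 ≤ j → (verma c q).ρ (.H j) s = 0)
    (hG : ∀ j, 1 ≤ j → (verma c q).ρ (.G j) s = 0) (hQ : ∀ j, 1 ≤ j → (verma c q).ρ (.Q j) s = 0)
    (hZ : (verma c q).ρ (.G 0) s = 0 ∨ (verma c q).ρ (.Q 0) s = 0)
    {u t : List Gen} (hu : (fock c q).Std u) (ht : IsTail t) (hut : s (u ++ t) ≠ 0)
    (hWu : reducedWeight (u ++ t) = W) : ∀ y ∈ u, y = .L (-1) ∨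
      ((verma c q).ρ (.Q 0) s ≠ 0 ∧ y = .G (-1)) ∨ ((verma c q).ρ (.G 0) s ≠ 0 ∧ y = .Q (-1)) := by
  have key : ∀ {x}, (verma c q).ρ x s = 0 →
      (fock c (q + wordCharge t)).ρ x (topPart W t s) = 0 := fun h =>
    fock_ρ_topPart c q hs hW h ht
  have h := fock_singular (q + wordCharge t) hc (s := topPart W t s)
    (fun w hw => (topPart_std c q hs hw).1)
    (fun j hj => key (hL j hj)) (fun j hj => key (hH j hj)) (fun j hj => key (hG j hj))
    (fun j hj => key (hQ j hj)) (hZ.imp key key) (w := u)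
    (by rwa [topPart_apply_append c q hs hu ht hWu])
  intro y hy
  exact (h y hy).imp_right fun h => h.imp (And.imp_left (mt key)) (And.imp_left (mt key))

end TopN2

/-! ### Adapted orderings by linear algebra, and the ordering of terms. -/

/-- Take a functional f vanishing on T but not at u. A basis adapted to ker f ⊕ ℂu, suitably scaled,
has f as its last coordinate. -/
theorem exists_basis_of_notMem_span {M : Type} [AddCommGroup M] [Module ℂ M] {u : M} {T : Set M}
    (hu : u ∉ Submodule.span ℂ T) : ∃ (ι : Type) (b : Module.Basis ι ℂ M) (i : ι),
      b.repr u i ≠ 0 ∧ ∀ t ∈ T, b.repr t i = 0 := by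
  obtain ⟨f, hf, hT⟩ := Submodule.exists_le_ker_of_notMem hu
  have hker : ∀ x, x - (f x * (f u)⁻¹) • u ∈ LinearMap.ker f := fun x => by
    rw [LinearMap.mem_ker, map_sub, map_smul, smul_eq_mul, mul_assoc, inv_mul_cancel₀ hf, mul_one,
      sub_self]
  let E : M ≃ₗ[ℂ] (LinearMap.ker f × ℂ) :=
    { toFun := fun x => (⟨x - (f x * (f u)⁻¹) • u, hker x⟩, f x)
      map_add' := fun x y => by
        ext
        · simp only [map_add, Prod.mk_add_mk, Submodule.coe_add]
          module
        · simp
      map_smul' := fun z x => by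
        ext
        · simp only [map_smul, smul_eq_mul, RingHom.id_apply, Prod.smul_mk, Submodule.coe_smul]
          module
        · simp
      invFun := fun p => p.1 + (p.2 * (f u)⁻¹) • u
      left_inv := fun x => by simp
      right_inv := fun p => by
        have h0 : f p.1 = 0 := p.1.2
        have h1 : f (p.1 + (p.2 * (f u)⁻¹) • u) = p.2 := by
          rw [map_add, map_smul, h0, smul_eq_mul, mul_assoc, inv_mul_cancel₀ hf, mul_one, zero_add]
        ext
        · simp [h1]
        · exact h1 }
  let b := ((Module.Basis.ofVectorSpace ℂ (LinearMap.ker f)).prod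
    (Module.Basis.singleton Unit ℂ)).map E.symm
  have hb : ∀ x, b.repr x (Sum.inr ()) = f x := fun x => by
    simp [b, E]
  exact ⟨_, b, Sum.inr (), by rwa [hb], fun t ht => by
    rw [hb]; exact hT (Submodule.subset_span ht)⟩

theorem finite_setOf_sum_le (m : ℕ) : {l : List ℕ | l.sum ≤ m ∧ ∀ a ∈ l, 1 ≤ a}.Finite := by
  induction m with
  | zero =>
    refine (Set.finite_singleton []).subset fun l hl => ?_
    rcases l with _ | ⟨a, l⟩
    · rfl
    · have h1 := hl.1
      have h2 := hl.2 a (by simp)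
      rw [List.sum_cons] at h1
      omega
  | succ m ih =>
    refine ((Set.finite_singleton []).union
      (Set.Finite.image2 List.cons (Set.finite_Iic (m + 1)) ih)).subset fun l hl => ?_
    rcases l with _ | ⟨a, l⟩
    · exact Or.inl rfl
    · have h1 := hl.1
      have h2 := hl.2 a (by simp)
      rw [List.sum_cons] at h1
      exact Or.inr ⟨a, by rw [Set.mem_Iic]; omega, l,
        ⟨by omega, fun b hb => hl.2 b (List.mem_cons_of_mem _ hb)⟩, rfl⟩

namespace TopN2

theorem finite_termSet (m : ℕ) (n : ℤ) : (termSet m n).Finite := by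
  let f : (List ℕ × List ℕ × List ℕ × List ℕ) × (ℕ × ℕ × ℕ × ℕ × ℕ) → Term := fun p =>
    ⟨p.1.1, p.1.2.1, p.1.2.2.1, p.1.2.2.2, p.2.1, p.2.2.1, p.2.2.2.1, p.2.2.2.2.1, p.2.2.2.2.2⟩
  have hl := finite_setOf_sum_le m
  have h1 := Set.finite_Iic 1 (α := ℕ)
  refine (((hl.prod (hl.prod (hl.prod hl))).prod
    ((Set.finite_Iic m).prod (h1.prod (h1.prod (h1.prod h1))))).image f).subset fun X hX => ?_
  obtain ⟨⟨-, h0⟩, ⟨-, h2⟩, ⟨-, h3⟩, ⟨-, h4⟩, h5, h6, h7, h8, h9, -⟩ := hX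
  rw [Term.level] at h9
  refine ⟨((X.Ls, X.Hs, X.Gs, X.Qs), (X.k, X.r₁, X.r₂, X.r₄, X.r₃)), ?_, rfl⟩
  simp only [Set.mem_prod, Set.mem_ofPred_eq, Set.mem_Iic]
  refine ⟨⟨⟨by omega, fun a ha => ?_⟩, ⟨by omega, h2⟩, ⟨by omega, fun a ha => ?_⟩,
    ⟨by omega, fun a ha => ?_⟩⟩, by omega, h5, h6, h8, h7⟩
  · exact one_le_two.trans (h0 a ha)
  · exact one_le_two.trans (h3 a ha)
  · exact one_le_two.trans (h4 a ha)

/-- A list, with a top element put at its end. -/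
def listKey (l : List ℕ) : List (WithTop ℕ) := l.map (↑) ++ [⊤]

theorem listKey_cons (a : ℕ) (l : List ℕ) : listKey (a :: l) = (a : WithTop ℕ) :: listKey l := rfl

theorem listKey_inj {l l' : List ℕ} : listKey l = listKey l' ↔ l = l' := by
  refine ⟨fun h => ?_, fun h => h ▸ rfl⟩
  exact List.map_injective_iff.2 WithTop.coe_injective (List.append_cancel_right h)

/-- The final ⊤ makes a proper prefix larger than its extensions, so "the longer product is smaller"
becomes ordinary lexicographic order. -/
theorem seqLT_iff (l l' : List ℕ) : seqLT l l' ↔ listKey l < listKey l' := by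
  induction l generalizing l' with
  | nil =>
    rcases l' with _ | ⟨b, l'⟩
    · simp [seqLT]
    · simp only [seqLT, false_iff, listKey_cons]
      intro h
      rcases List.cons_lt_cons_iff.1 h with h | ⟨h, -⟩
      · exact not_top_lt h
      · exact WithTop.top_ne_coe h
  | cons a l ih =>
    rcases l' with _ | ⟨b, l'⟩
    · simp only [seqLT, true_iff, listKey_cons]
      exact List.cons_lt_cons_iff.2 (Or.inl (WithTop.coe_lt_top a))
    · rw [seqLT, ih, listKey_cons, listKey_cons, List.cons_lt_cons_iff, Nat.cast_lt,
        Nat.cast_inj]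

/-- The sort key of a term. -/
def Term.key (X : Term) : ℕᵒᵈ ×ₗ ℕᵒᵈ ×ₗ List (WithTop ℕ) ×ₗ List (WithTop ℕ) ×ₗ
    List (WithTop ℕ) ×ₗ List (WithTop ℕ) ×ₗ ℕᵒᵈ ×ₗ ℕᵒᵈ :=
  toLex (OrderDual.toDual X.k, toLex (OrderDual.toDual (X.r₁ + X.r₂), toLex (listKey X.Qs,
    toLex (listKey X.Gs, toLex (listKey X.Ls, toLex (listKey X.Hs,
      toLex (OrderDual.toDual X.r₁, OrderDual.toDual (X.r₃ + X.r₄))))))))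

theorem termLT_iff (X Y : Term) : termLT X Y ↔ X.key < Y.key := by
  simp only [termLT, Term.key, Prod.Lex.toLex_lt_toLex, seqLT_iff, listKey_inj,
    OrderDual.toDual_lt_toDual, gt_iff_lt, EmbeddingLike.apply_eq_iff_eq]

/-- The key records only r₃+r₄; for terms of equal charge the difference r₄-r₃ is determined as
well. -/
theorem key_injOn (m : ℕ) (n : ℤ) : Set.InjOn Term.key (termSet m n) := by
  intro X hX Y hY h
  obtain ⟨-, -, -, -, -, -, -, -, -, hX⟩ := hX
  obtain ⟨-, -, -, -, -, -, -, -, -, hY⟩ := hY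
  rw [Term.charge] at hX hY
  simp only [Term.key, EmbeddingLike.apply_eq_iff_eq, Prod.mk.injEq, listKey_inj] at h
  obtain ⟨h1, h2, h3, h4, h5, h6, h7, h8⟩ := h
  rw [h3, h4] at hX
  ext1 <;> first | assumption | omega

theorem termLE_iff {m : ℕ} {n : ℤ} {X Y : Term} (hX : X ∈ termSet m n) (hY : Y ∈ termSet m n) :
    termLE X Y ↔ X.key ≤ Y.key := by
  rw [termLE, termLT_iff, le_iff_eq_or_lt, (key_injOn m n).eq_iff hX hY]

/-- An ordering is adapted as soon as, for every term outside the kernel, some annihilation operator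
separates it from the larger terms. -/
theorem isAdaptedWithKernel_of_notMem_span {M : Type} [AddCommGroup M] [Module ℂ M] [Module U M]
    {v : M} {K : Set U} {m : ℕ} {n : ℤ} {N : Set Term} (hN : N ⊆ termSet m n)
    (h : ∀ X ∈ termSet m n, X ∉ N → ∃ Γ ∈ K, Γ • X.toU • v ∉ Submodule.span ℂ
      ((fun Y : Term => Γ • Y.toU • v) '' {Y ∈ termSet m n | termLE X Y ∧ X ≠ Y})) :
    IsAdaptedWithKernel v K (termSet m n) N termLE := by
  refine ⟨hN, Set.sdiff_subset, fun X _ => Or.inl rfl, fun X hX Y hY h1 h2 => ?_,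
    fun X hX Y hY Z hZ h1 h2 => ?_, fun X hX Y hY => ?_, fun hne => ?_, fun X hX => ?_⟩
  · rw [termLE_iff hX hY] at h1
    rw [termLE_iff hY hX] at h2
    exact key_injOn m n hX hY (le_antisymm h1 h2)
  · rw [termLE_iff hX hY] at h1
    rw [termLE_iff hY hZ] at h2
    rw [termLE_iff hX hZ]
    exact h1.trans h2
  · rw [termLE_iff hX hY, termLE_iff hY hX]
    exact le_total _ _
  · obtain ⟨X, hX, hmin⟩ := Set.exists_min_image _ Term.key (finite_termSet m n) hne
    exact ⟨X, hX, fun Y hY => (termLE_iff hX hY).2 (hmin Y hY)⟩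
  · obtain ⟨Γ, hΓ, hs⟩ := h X hX.1 hX.2
    obtain ⟨ι, b, i, h1, h2⟩ := exists_basis_of_notMem_span hs
    exact ⟨Γ, hΓ, ι, b, i, h1, fun Y hY hle hne => h2 _ ⟨Y, ⟨hY, hle, hne⟩, rfl⟩⟩

theorem op_rel {x y : FreeAlgebra ℂ Gen} (h : Rel x y) :
    RingQuot.mkAlgHom ℂ Rel x = RingQuot.mkAlgHom ℂ Rel y := RingQuot.mkAlgHom_rel ℂ h

/-- [L_0, X_m] = -m X_m for X = G, Q, H; the central term of [L_0, H_m] has coefficient zero. -/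
theorem op_mem_positivePart {x : Gen} (hx : x.odd = true ∨ ∃ j, x = .H j) (hm : 1 ≤ x.mode) :
    op x ∈ positivePart := by
  refine Submodule.subset_span ⟨-x.mode, by omega, ?_⟩
  cases x with
  | L m => rcases hx with hx | ⟨j, hx⟩ <;> simp [Gen.odd] at hx
  | C => rcases hx with hx | ⟨j, hx⟩ <;> simp [Gen.odd] at hx
  | G m =>
    have := op_rel (Rel.LG 0 m)
    simp only [comm, op, Gen.mode, map_sub, map_mul, map_smul] at this ⊢
    simpa using this
  | Q m =>
    have := op_rel (Rel.LQ 0 m)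
    simp only [comm, op, Gen.mode, map_sub, map_mul, map_smul] at this ⊢
    simpa using this
  | H m =>
    have := op_rel (Rel.LH 0 m)
    simp only [comm, op, Gen.mode, map_sub, map_mul, map_smul, map_add] at this ⊢
    simpa using this

end TopN2

/-! ### The smallest term of a singular vector. -/

namespace TopN2

variable (c q : ℂ)

theorem Term.isTail_tail {m : ℕ} {n : ℤ} {X : Term} (hX : X ∈ termSet m n) : IsTail X.tail := by
  obtain ⟨-, -, -, -, -, -, h3, h4, -⟩ := hX
  have h3 : X.r₃ = 0 ∨ X.r₃ = 1 := by omega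
  have h4 : X.r₄ = 0 ∨ X.r₄ = 1 := by omega
  rcases h3 with h3 | h3 <;> rcases h4 with h4 | h4 <;> simp only [tail, block, h3, h4]
  exacts [.nil, .G, .Q, .GQ]

theorem Term.std_body {m : ℕ} {n : ℤ} {X : Term} (hX : X ∈ termSet m n) :
    (fock c q).Std X.body := by
  have h := std_word c q hX
  rw [Term.word_eq] at h
  refine ⟨(List.pairwise_append.1 h.1).1, fun a ha hbd => ?_⟩
  obtain ⟨i, hi, ha⟩ := List.mem_flatMap.1 ha
  have h1 := cls_of_mem_block hX ha
  have h2 : 7 ≤ a.cls := hbd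
  rw [List.mem_range] at hi
  omega

theorem Term.mem_body {X : Term} {i : ℕ} (hi : i < 7) {y : Gen} (hy : y ∈ X.block i) :
    y ∈ X.body :=
  List.mem_flatMap.2 ⟨i, List.mem_range.2 hi, hy⟩

theorem Term.reducedWeight_shortTerm (k r₁ r₂ r₄ r₃ : ℕ) :
    reducedWeight (shortTerm k r₁ r₂ r₄ r₃).word = 2 * k + r₁ + r₂ := by
  simp [word, shortTerm, List.range_succ, block, reducedWeight, Gen.weight]
  ring

theorem Term.eq_nil_of_block {X : Term}
    (h : ∀ y ∈ X.body, y = .L (-1) ∨ y = .G (-1) ∨ y = .Q (-1)) {m : ℕ} {n : ℤ}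
    (hX : X ∈ termSet m n) : X = shortTerm X.k X.r₁ X.r₂ X.r₄ X.r₃ := by
  have key : ∀ i < 4, X.block i = [] := fun i hi => by
    refine List.eq_nil_iff_forall_not_mem.2 fun y hy => ?_
    have h1 := cls_of_mem_block hX hy
    rcases h y (mem_body (by omega) hy) with rfl | rfl | rfl <;> simp [Gen.cls] at h1 <;> omega
  have k0 := key 0 (by omega)
  have k1 := key 1 (by omega)
  have k2 := key 2 (by omega)
  have k3 := key 3 (by omega)
  simp only [block, List.map_eq_nil_iff, List.reverse_eq_nil_iff] at k0 k1 k2 k3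
  ext1 <;> simp [shortTerm, *]

theorem eq_nil_of_sum_eq_zero {l : List ℕ} (h : l.sum = 0) (h' : ∀ a ∈ l, 1 ≤ a) : l = [] := by
  refine List.eq_nil_iff_forall_not_mem.2 fun a ha => ?_
  have := List.sum_eq_zero_iff.1 h a ha
  have := h' a ha
  omega

/-- The modes in the four lists are positive, so there is no level left for them. -/
theorem Term.eq_shortTerm_of_level {X : Term} {m : ℕ} {n : ℤ} (hX : X ∈ termSet m n)
    (h : m ≤ X.k + X.r₁ + X.r₂) :
    X = shortTerm X.k X.r₁ X.r₂ X.r₄ X.r₃ ∧ m = X.k + X.r₁ + X.r₂ := by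
  obtain ⟨⟨-, h0⟩, ⟨-, h1⟩, ⟨-, h2⟩, ⟨-, h3⟩, -, -, -, -, hm, -⟩ := hX
  rw [level] at hm
  have k0 := eq_nil_of_sum_eq_zero (l := X.Ls) (by omega) fun a ha => one_le_two.trans (h0 a ha)
  have k1 := eq_nil_of_sum_eq_zero (l := X.Hs) (by omega) h1
  have k2 := eq_nil_of_sum_eq_zero (l := X.Gs) (by omega) fun a ha => one_le_two.trans (h2 a ha)
  have k3 := eq_nil_of_sum_eq_zero (l := X.Qs) (by omega) fun a ha => one_le_two.trans (h3 a ha)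
  refine ⟨?_, by omega⟩
  ext1 <;> simp [shortTerm, *]

/-- Only the first two comparisons of the ordering constrain the leading term of a singular vector.
-/
theorem termLE.le {X Y : Term} (h : termLE X Y) :
    Y.k < X.k ∨ (X.k = Y.k ∧ Y.r₁ + Y.r₂ ≤ X.r₁ + X.r₂) := by
  rcases h with rfl | h
  · exact Or.inr ⟨rfl, le_rfl⟩
  · rcases h with h | ⟨h1, h2 | ⟨h2, -⟩⟩
    · exact Or.inl h
    · exact Or.inr ⟨h1, h2.le⟩
    · exact Or.inr ⟨h1, h2.ge⟩

variable {c}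

/-- The smallest term of a vector that is annihilated by all positive modes and one of `G_0`,
`Q_0`. -/
theorem eq_shortTerm_of_singular (hc : c ≠ 3) {m : ℕ} {n : ℤ} {s : List Gen →₀ ℂ} {X : Term}
    (hX : X ∈ termSet m n) (hsX : s X.word ≠ 0)
    (hs : ∀ w, s w ≠ 0 → ∃ Y ∈ termSet m n, termLE X Y ∧ w = Y.word)
    (hL : ∀ j, 1 ≤ j → (verma c q).ρ (.L j) s = 0) (hH : ∀ j, 1 ≤ j → (verma c q).ρ (.H j) s = 0)
    (hG : ∀ j, 1 ≤ j → (verma c q).ρ (.G j) s = 0) (hQ : ∀ j, 1 ≤ j → (verma c q).ρ (.Q j) s = 0)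
    (hZ : (verma c q).ρ (.G 0) s = 0 ∨ (verma c q).ρ (.Q 0) s = 0) :
    X = shortTerm m 0 0 X.r₄ X.r₃ ∨
      ((verma c q).ρ (.Q 0) s ≠ 0 ∧ X = shortTerm (m - 1) 1 0 X.r₄ X.r₃) ∨
      ((verma c q).ρ (.G 0) s ≠ 0 ∧ X = shortTerm (m - 1) 0 1 X.r₄ X.r₃) := by
  -- The weight-maximal word Y need not be the smallest term X. The letters of Y are controlled
  -- first, and X is then compared with Y through the ordering.
  obtain ⟨w, hw, hmax⟩ := Finset.exists_max_image s.support reducedWeight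
    ⟨X.word, mem_support_iff.2 hsX⟩
  obtain ⟨Y, hY, hle, rfl⟩ := hs w (mem_support_iff.1 hw)
  have hsplit : ∀ w, s w ≠ 0 → IsSplit c q w := fun w hw => by
    obtain ⟨Y, hY, -, rfl⟩ := hs w hw
    exact ⟨_, _, Term.std_body c q hY, Term.isTail_tail hY, Y.word_eq⟩
  have letters : ∀ X' ∈ termSet m n, s X'.word ≠ 0 → reducedWeight X'.word = reducedWeight Y.word →
      X' = shortTerm X'.k X'.r₁ X'.r₂ X'.r₄ X'.r₃ ∧
        (X'.r₁ ≠ 0 → (verma c q).ρ (.Q 0) s ≠ 0) ∧ (X'.r₂ ≠ 0 → (verma c q).ρ (.G 0) s ≠ 0) := by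
    intro X' hX' hs' hw'
    rw [Term.word_eq X'] at hs' hw'
    have h := verma_singular q hc hsplit (fun w hw => hmax w (mem_support_iff.2 hw)) hL hH hG hQ hZ
      (Term.std_body c q hX') (Term.isTail_tail hX') hs' hw'
    refine ⟨Term.eq_nil_of_block
      (fun y hy => (h y hy).imp_right (Or.imp And.right And.right)) hX', fun hr => ?_, fun hr => ?_⟩
    · have := h (.G (-1)) (Term.mem_body (i := 5) (by omega) (by simp [Term.block, hr]))
      simpa using this
    · have := h (.Q (-1)) (Term.mem_body (i := 6) (by omega) (by simp [Term.block, hr]))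
      simpa using this
  obtain ⟨hY1, hY2, hY3⟩ := letters Y hY (mem_support_iff.1 hw) rfl
  have hYr : ¬ (Y.r₁ ≠ 0 ∧ Y.r₂ ≠ 0) := fun h => by
    rcases hZ with hZ | hZ
    · exact hY3 h.2 hZ
    · exact hY2 h.1 hZ
  have hYl : m = Y.k + Y.r₁ + Y.r₂ := by
    have : Y.level = m := hY.2.2.2.2.2.2.2.2.1
    rw [← this, hY1]
    simp [Term.level, shortTerm]
  have hYr1 : Y.r₁ ≤ 1 := hY.2.2.2.2.1
  have hYr2 : Y.r₂ ≤ 1 := hY.2.2.2.2.2.1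
  -- Y has at most one of G_{-1}, Q_{-1}, so Y.k ≥ m-1. A larger k, or an equal k with r₁+r₂ no
  -- smaller, forces X to use up the whole level.
  obtain ⟨hX1, hXl⟩ := Term.eq_shortTerm_of_level hX (by have := hle.le; omega)
  rcases hle.le with hk | ⟨hk, hr⟩
  · have h1 : X.r₁ = 0 := by omega
    have h2 : X.r₂ = 0 := by omega
    have h3 : X.k = m := by omega
    left
    rwa [h1, h2, h3] at hX1
  -- With equal k and equal level, X has the same reduced weight as Y and is maximal too.
  · obtain ⟨-, g2, g3⟩ := letters X hX hsX (by
      rw [hX1, hY1, Term.reducedWeight_shortTerm, Term.reducedWeight_shortTerm]; omega)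
    by_cases h1 : X.r₁ = 0
    · by_cases h2 : X.r₂ = 0
      · have h3 : X.k = m := by omega
        left
        rwa [h1, h2, h3] at hX1
      · have h4 : X.r₂ = 1 := by omega
        have h3 : X.k = m - 1 := by omega
        refine Or.inr (Or.inr ⟨g3 h2, ?_⟩)
        rwa [h1, h4, h3] at hX1
    · have h2 : X.r₂ = 0 := by omega
      have h4 : X.r₁ = 1 := by omega
      have h3 : X.k = m - 1 := by omega
      refine Or.inr (Or.inl ⟨g2 h1, ?_⟩)
      rwa [h4, h2, h3] at hX1

variable (c)

/-! ### One separating operator for all terms, and the theorem. -/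

/-- The generators that are used to separate terms of level `m`. -/
noncomputable def separators (m : ℕ) (Z : Gen) : Finset Gen :=
  insert Z ((Finset.Icc 1 (m : ℤ)).image .G ∪ (Finset.Icc 1 (m : ℤ)).image .Q ∪
    (Finset.Icc 1 (m : ℤ)).image .H)

theorem mem_separators {m : ℕ} {Z x : Gen} : x ∈ separators m Z ↔ x = Z ∨
    ∃ j : ℤ, (1 ≤ j ∧ j ≤ m) ∧ (x = .G j ∨ x = .Q j ∨ x = .H j) := by
  simp only [separators, Finset.mem_insert, Finset.mem_union, Finset.mem_image, Finset.mem_Icc]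
  constructor
  · rintro (h | ((⟨j, hj, rfl⟩ | ⟨j, hj, rfl⟩) | ⟨j, hj, rfl⟩))
    · exact Or.inl h
    all_goals exact Or.inr ⟨j, hj, by simp⟩
  · rintro (h | ⟨j, hj, rfl | rfl | rfl⟩)
    · exact Or.inl h
    all_goals simp [hj.1, hj.2]

/-- Mode and charge distinguish G_j, Q_j and H_j. L_j would share its bidegree with H_j, which is
why it is left out. -/
theorem injOn_deg_separators {m : ℕ} {Z : Gen} (hZ : Z = .G 0 ∨ Z = .Q 0) :
    Set.InjOn Gen.deg (separators m Z) := by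
  have key : ∀ x ∈ separators m Z, ∃ j, x = .G j ∨ x = .Q j ∨ x = .H j := fun x hx => by
    rcases mem_separators.1 hx with rfl | ⟨j, -, h⟩
    · rcases hZ with rfl | rfl
      · exact ⟨0, Or.inl rfl⟩
      · exact ⟨0, Or.inr (Or.inl rfl)⟩
    · exact ⟨j, h⟩
  intro x hx y hy h
  obtain ⟨j, rfl | rfl | rfl⟩ := key x hx <;> obtain ⟨k, rfl | rfl | rfl⟩ := key y hy <;>
    simp [Gen.deg, Gen.mode, Gen.charge] at h <;> rw [h]

/-- The sum of the separating generators. -/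
noncomputable def separator (m : ℕ) (Z : Gen) : U := ∑ x ∈ separators m Z, op x

theorem separator_mem (m : ℕ) (Z : Gen) : separator m Z ∈ annihilators (op Z) := by
  refine Submodule.sum_mem _ fun x hx => ?_
  rcases mem_separators.1 hx with rfl | ⟨j, hj, h⟩
  · exact Submodule.mem_sup_right (Submodule.mem_span_singleton_self _)
  · refine Submodule.mem_sup_left ?_
    rcases h with rfl | rfl | rfl
    · exact op_mem_positivePart (Or.inl rfl) hj.1
    · exact op_mem_positivePart (Or.inl rfl) hj.1
    · exact op_mem_positivePart (Or.inr ⟨j, rfl⟩) hj.1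

theorem verma_bracket_deg (a b k : Gen) (h : (verma c q).br a b k ≠ 0) :
    k.deg = a.deg + b.deg := (bracket_apply_ne_zero h).2

theorem verma_hwChar_deg (b : Gen) (_ : (verma c q).bd b) (h : (verma c q).χ b ≠ 0) :
    b.deg = 0 := by
  cases b <;> simp_all [verma, hwChar, Gen.deg, Gen.mode, Gen.charge]

/-- The result would have positive total mode, while every letter of a standard word has mode at
most 0. -/
theorem verma_ρ_eq_zero {s : List Gen →₀ ℂ} {m : ℕ} {n : ℤ}
    (hs : ∀ w, s w ≠ 0 → (w.map Gen.deg).sum = (-(m : ℤ), n)) {x : Gen} (hx : m < x.mode) :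
    (verma c q).ρ x s = 0 := by
  ext w
  by_contra h
  obtain ⟨h1, h2⟩ := (verma c q).ρ_support Gen.deg (verma_bracket_deg c q) (verma_hwChar_deg c q) hs
    x w h
  have h3 : ∀ w : List Gen, (verma c q).Std w → ((w.map Gen.deg).sum).1 ≤ 0 := by
    intro w hw
    induction w with
    | nil => exact le_rfl
    | cons y w ih =>
      have h4 := ih hw.of_cons
      have h5 : y.mode ≤ 0 := by
        by_contra! h
        apply hw.2 y (by simp)
        cases y with
        | L m => exact cls_L.2 h.le
        | H m => exact cls_H.2 h.le
        | G m => exact cls_G.2 h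
        | Q m => exact cls_Q.2 h
        | C => exact cls_C
      rw [List.map_cons, List.sum_cons, Prod.fst_add]
      change y.mode + _ ≤ 0
      omega
  have h4 := h3 w h1
  rw [h2, Prod.fst_add] at h4
  change x.mode + -(m : ℤ) ≤ 0 at h4
  omega

/-- A homogeneous vector that the separator annihilates is annihilated by all positive modes. -/
theorem ρ_eq_zero_of_separator {s : List Gen →₀ ℂ} {m : ℕ} {n : ℤ} {Z : Gen}
    (hZ : Z = .G 0 ∨ Z = .Q 0) (hs : ∀ w, s w ≠ 0 → (w.map Gen.deg).sum = (-(m : ℤ), n))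
    (h : rep c q (separator m Z) s = 0) : (verma c q).ρ Z s = 0 ∧
      ∀ j, 1 ≤ j → (verma c q).ρ (.L j) s = 0 ∧ (verma c q).ρ (.H j) s = 0 ∧
        (verma c q).ρ (.G j) s = 0 ∧ (verma c q).ρ (.Q j) s = 0 := by
  rw [separator, map_sum, LinearMap.sum_apply] at h
  simp only [rep_op] at h
  have key : ∀ x ∈ separators m Z, (verma c q).ρ x s = 0 := fun x hx =>
    (verma c q).ρ_eq_zero_of_sum Gen.deg (verma_bracket_deg c q) (verma_hwChar_deg c q) hs
      (injOn_deg_separators hZ) h hx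
  have hZ0 := key Z (mem_separators.2 (Or.inl rfl))
  have all : ∀ j : ℤ, 1 ≤ j → ∀ x : Gen, (x = .G j ∨ x = .Q j ∨ x = .H j) →
      (verma c q).ρ x s = 0 := fun j hj x hx => by
    rcases le_or_gt j m with hjm | hjm
    · exact key x (mem_separators.2 (Or.inr ⟨j, ⟨hj, hjm⟩, hx⟩))
    · refine verma_ρ_eq_zero c q hs ?_
      rcases hx with rfl | rfl | rfl <;> exact hjm
  refine ⟨hZ0, fun j hj => ?_⟩
  have hG := all j hj (.G j) (by simp)
  have hQ := all j hj (.Q j) (by simp)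
  have hH := all j hj (.H j) (by simp)
  refine ⟨?_, hH, hG, hQ⟩
  -- L_j is recovered from {G_0, Q_j} = 2 L_j - 2j H_j or from {G_j, Q_0} = 2 L_j.
  rcases hZ with rfl | rfl
  · have := verma_ρ_exchange c q (.G 0) (.Q j) s
    simpa [hZ0, hQ, hH, bracket, linearCombination_e, delta, show j ≠ 0 by omega] using this.symm
  · have := verma_ρ_exchange c q (.G j) (.Q 0) s
    simpa [hZ0, hG, bracket, linearCombination_e, delta, show j ≠ 0 by omega] using this.symm

variable {c}

/-- A term whose image under the separator is a combination of the images of larger terms. -/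
theorem exists_singular_of_mem_span {m : ℕ} {n : ℤ} {Z : Gen} {X : Term} (hX : X ∈ termSet m n)
    (h : separator m Z • X.toU • hwVec c q ∈ Submodule.span ℂ
      ((fun Y : Term => separator m Z • Y.toU • hwVec c q) ''
        {Y ∈ termSet m n | termLE X Y ∧ X ≠ Y})) :
    ∃ s : List Gen →₀ ℂ, s X.word ≠ 0 ∧ rep c q (separator m Z) s = 0 ∧
      ∀ w, s w ≠ 0 → ∃ Y ∈ termSet m n, termLE X Y ∧ w = Y.word := by
  have himg : ∀ Y ∈ termSet m n, vermaToWords c q (separator m Z • Y.toU • hwVec c q) =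
      rep c q (separator m Z) (single Y.word 1) := fun Y hY => by
    rw [smul_smul, vermaToWords_smul, map_mul, Module.End.mul_apply, ← Term.prod_word, rep_prod,
      (verma c q).nf_of_std (Term.std_word c q hY)]
  set T := {Y ∈ termSet m n | termLE X Y ∧ X ≠ Y} with hT
  -- A linear relation in the Verma module maps to one among words; injectivity of `vermaToWords` is
  -- not needed.
  have h1 := Submodule.mem_map_of_mem (f := vermaToWords c q) h
  rw [himg X hX, Submodule.map_span, ← Set.image_comp] at h1
  have h2 : (vermaToWords c q ∘ fun Y : Term => separator m Z • Y.toU • hwVec c q) '' T =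
      (rep c q (separator m Z)) '' ((fun w => single w (1 : ℂ)) '' (Term.word '' T)) := by
    rw [← Set.image_comp, ← Set.image_comp]
    exact Set.image_congr fun Y hY => himg Y hY.1
  rw [h2, ← Submodule.map_span, ← supported_eq_span_single] at h1
  obtain ⟨t, ht, hteq⟩ := Submodule.mem_map.1 h1
  rw [mem_supported] at ht
  have htX : t X.word = 0 := by
    by_contra hne
    obtain ⟨Y, hY, hw⟩ := ht (mem_support_iff.2 hne)
    exact hY.2.2 (Term.word_injective hX hY.1 hw.symm)
  refine ⟨single X.word 1 - t, ?_, ?_, fun w hw => ?_⟩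
  · rw [Finsupp.sub_apply, htX]
    simp
  · rw [map_sub, hteq, sub_self]
  · by_cases hwX : w = X.word
    · exact ⟨X, hX, Or.inl rfl, hwX⟩
    · rw [Finsupp.sub_apply, single_apply, if_neg (Ne.symm hwX), zero_sub, neg_ne_zero] at hw
      obtain ⟨Y, hY, hw⟩ := ht (mem_support_iff.2 hw)
      exact ⟨Y, hY.1, hY.2.1, hw.symm⟩

/-- If separation by Γ failed for a term, that term would be the smallest one of a singular vector,
hence one of the short terms, which N contains by assumption. -/
theorem isAdaptedWithKernel_of_shortTerm (hc : c ≠ 3) {m : ℕ} {n : ℤ} {Z : Gen}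
    (hZ : Z = .G 0 ∨ Z = .Q 0) {N : Set Term} (hN : N ⊆ termSet m n)
    (h : ∀ X ∈ termSet m n, X = shortTerm m 0 0 X.r₄ X.r₃ ∨
      (Z = .G 0 ∧ X = shortTerm (m - 1) 1 0 X.r₄ X.r₃) ∨
      (Z = .Q 0 ∧ X = shortTerm (m - 1) 0 1 X.r₄ X.r₃) → X ∈ N) :
    IsAdaptedWithKernel (hwVec c q) (annihilators (op Z) : Set U) (termSet m n) N termLE := by
  refine isAdaptedWithKernel_of_notMem_span hN fun X hX hXN =>
    ⟨separator m Z, separator_mem m Z, fun hspan => hXN (h X hX ?_)⟩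
  obtain ⟨s, h1, h2, h3⟩ := exists_singular_of_mem_span q hX hspan
  obtain ⟨g1, g2⟩ := ρ_eq_zero_of_separator c q hZ (n := n) (fun w hw => by
    obtain ⟨Y, hY, -, rfl⟩ := h3 w hw
    rw [Term.deg_word, hY.2.2.2.2.2.2.2.2.1, hY.2.2.2.2.2.2.2.2.2]) h2
  refine (eq_shortTerm_of_singular q hc hX h1 h3 (fun j hj => (g2 j hj).1)
    (fun j hj => (g2 j hj).2.1) (fun j hj => (g2 j hj).2.2.1) (fun j hj => (g2 j hj).2.2.2)
    (by rcases hZ with rfl | rfl; exacts [Or.inl g1, Or.inr g1])).imp_right ?_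
  rintro (⟨h4, h5⟩ | ⟨h4, h5⟩)
  · exact Or.inl ⟨hZ.resolve_right fun h => h4 (h ▸ g1), h5⟩
  · exact Or.inr ⟨hZ.resolve_left fun h => h4 (h ▸ g1), h5⟩

theorem shortTerm_cases {m : ℕ} {n : ℤ} {k r₁ r₂ : ℕ} {X : Term} (hX : X ∈ termSet m n)
    (h : X = shortTerm k r₁ r₂ X.r₄ X.r₃) :
    (X = shortTerm k r₁ r₂ 0 0 ∧ n = r₁ - r₂) ∨ (X = shortTerm k r₁ r₂ 1 1 ∧ n = r₁ - r₂) ∨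
      (X = shortTerm k r₁ r₂ 1 0 ∧ n = r₁ - r₂ + 1) ∨
      (X = shortTerm k r₁ r₂ 0 1 ∧ n = r₁ - r₂ - 1) := by
  obtain ⟨-, -, -, -, -, -, h3, h4, -, hn⟩ := hX
  rw [h] at hn
  have h3 : X.r₃ = 0 ∨ X.r₃ = 1 := by omega
  have h4 : X.r₄ = 0 ∨ X.r₄ = 1 := by omega
  rcases h3 with h3 | h3 <;> rcases h4 with h4 | h4 <;>
    rw [h3, h4] at h hn <;> simp [Term.charge, shortTerm] at hn
  · exact Or.inl ⟨h, by omega⟩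
  · exact Or.inr (Or.inr (Or.inl ⟨h, by omega⟩))
  · exact Or.inr (Or.inr (Or.inr ⟨h, by omega⟩))
  · exact Or.inr (Or.inl ⟨h, by omega⟩)

end TopN2

theorem mainTheorem4 (c : ℂ) (hc : c ≠ 3) (q : ℂ) (m : ℕ) (n : ℤ) :
    TopN2.IsAdaptedWithKernel (TopN2.hwVec c q)
      (TopN2.annihilators (TopN2.op (TopN2.Gen.G 0)) : Set TopN2.U)
      (TopN2.termSet m n) (TopN2.kernelG m n) TopN2.termLE ∧
    TopN2.IsAdaptedWithKernel (TopN2.hwVec c q)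
      (TopN2.annihilators (TopN2.op (TopN2.Gen.Q 0)) : Set TopN2.U)
      (TopN2.termSet m n) (TopN2.kernelQ m n) TopN2.termLE := by
  constructor
  -- The charge of a short term fixes its tail up to the choice between 1 and G_0 Q_0. For m = 0 the
  -- truncated m-1 is harmless, since membership in `termSet` is carried along.
  · refine TopN2.isAdaptedWithKernel_of_shortTerm q hc (Or.inl rfl) Set.inter_subset_right
      fun X hX h => ⟨?_, hX⟩
    rcases h with h | ⟨-, h⟩ | ⟨h, -⟩
    · rcases TopN2.shortTerm_cases hX h with ⟨h, rfl⟩ | ⟨h, rfl⟩ | ⟨h, rfl⟩ | ⟨h, rfl⟩ <;> simp [h]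
    · rcases TopN2.shortTerm_cases hX h with ⟨h, rfl⟩ | ⟨h, rfl⟩ | ⟨h, rfl⟩ | ⟨h, rfl⟩ <;> simp [h]
    · cases h
  · refine TopN2.isAdaptedWithKernel_of_shortTerm q hc (Or.inr rfl) Set.inter_subset_right
      fun X hX h => ⟨?_, hX⟩
    rcases h with h | ⟨h, -⟩ | ⟨-, h⟩
    · rcases TopN2.shortTerm_cases hX h with ⟨h, rfl⟩ | ⟨h, rfl⟩ | ⟨h, rfl⟩ | ⟨h, rfl⟩ <;> simp [h]
    · cases h
    · rcases TopN2.shortTerm_cases hX h with ⟨h, rfl⟩ | ⟨h, rfl⟩ | ⟨h, rfl⟩ | ⟨h, rfl⟩ <;> simp [h]
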